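/- For positive reals write $a\ll b$ for "$a\le f(b)$", where $f:(0,\infty)\to(0,\infty)$ is a suitable increasing function. Digraphs are finite and have no loops and no multiple edges, but two oppositely oriented edges between a pair of vertices are allowed. For a digraph $G$ let $d^+_X(x)$ and $d^-_X(x)$ denote the numbers of out- and inneighbours of the vertex $x$ in the set $X\subseteq V(G)$, write $d^\pm_X(x)\ge c$ for "$d^+_X(x)\ge c$ and $d^-_X(x)\ge c$", and let $\delta^0(G)$ be the minimum of all in- and outdegrees of vertices of $G$. Given $\varepsilon_3,\eta_2>0$, a digraph $G$ on $n$ vertices is called $ST$-extremal if $V(G)$ has a partition into (possibly empty) sets $A,B,S,T$ of sizes $a,b,s,t$ such that 1. $a\le b$ and $s\le t$; 2. $\lfloor n/2\rfloor-\varepsilon_3 n\le s,t\le\lceil n/2\rceil+\varepsilon_3 n$; 3. $\delta^0(G[S]),\ \delta^0(G[T])\ge\eta_2 n$; 4. $d^\pm_S(x)\ge n/2-\varepsilon_3 n$ for all but at most $\varepsilon_3 n$ vertices $x\in S$; 5. $d^\pm_T(x)\ge n/2-\varepsilon_3 n$ for all but at most $\varepsilon_3 n$ vertices $x\in T$; 6.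 $a+b\le\varepsilon_3 n$; 7. $d^-_T(x),d^+_S(x)>n/2-3\eta_2 n$ and $d^-_S(x),d^+_T(x)\le 3\eta_2 n$ for all $x\in A$; 8. $d^-_S(x),d^+_T(x)>n/2-3\eta_2 n$ and $d^-_T(x),d^+_S(x)\le 3\eta_2 n$ for all $x\in B$. **Lemma.** There is an increasing function $f:(0,\infty)\to(0,\infty)$ such that the following holds whenever $n$ is a positive integer and $\varepsilon_3,\varepsilon_4,\eta_2>0$ are reals with $$1/n\ll\varepsilon_3\ll\varepsilon_4\ll\eta_2\ll 1$$ (that is, $1/n\le f(\varepsilon_3)$, $\varepsilon_3\le f(\varepsilon_4)$, $\varepsilon_4\le f(\eta_2)$ and $\eta_2\le f(1)$). Let $G$ be a digraph on $n$ vertices such that $\delta^0(G)\ge n/2$ and $G$ is $ST$-extremal with parameters $\varepsilon_3,\eta_2$. If $C$ is any orientation of a cycle on $n$ vertices (the antidirected orientation included), then $G$ contains a copy of $C$, i.e. a subdigraph isomorphic to $C$. -/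

import Mathlib

namespace Digraph

/-- No loops. (Mathlib digraphs may have loops; antiparallel pairs of edges are allowed.) -/
def Loopless {V : Type*} (G : Digraph V) : Prop :=
  ∀ x, ¬ G.Adj x x

/-- At most one edge between any two vertices (and, taking `x = y`, no loops). -/
def IsOriented {V : Type*} (G : Digraph V) : Prop :=
  ∀ x y, G.Adj x y → ¬ G.Adj y x

/-- `C` is an orientation of a cycle on `n` vertices: an oriented graph whose underlying
simple graph is isomorphic to the `n`-cycle. -/
def IsOrientationOfCycle {W : Type*} (C : Digraph W) (n : ℕ) : Prop :=
  3 ≤ n ∧ C.IsOriented ∧ Nonempty (C.toSimpleGraphInclusive ≃g SimpleGraph.cycleGraph n)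

/-- `G` contains a copy of `C` as a (not necessarily induced) subdigraph. -/
def ContainsCopy {V W : Type*} (G : Digraph V) (C : Digraph W) : Prop :=
  ∃ φ : W → V, Function.Injective φ ∧ ∀ x y, C.Adj x y → G.Adj (φ x) (φ y)

open Classical in
/-- `d⁺_A(x)`: the number of outneighbours of `x` in `A`. -/
noncomputable def outDegIn {V : Type*} (G : Digraph V) (A : Finset V) (x : V) : ℕ :=
  (A.filter fun y => G.Adj x y).card

open Classical in
/-- `d⁻_A(x)`: the number of inneighbours of `x` in `A`. -/
noncomputable def inDegIn {V : Type*} (G : Digraph V) (A : Finset V) (x : V) : ℕ :=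
  (A.filter fun y => G.Adj y x).card

/-- The minimum semidegree `δ⁰(G)`: the minimum of all in- and outdegrees
(`0` for the digraph without vertices). -/
noncomputable def minSemidegree {V : Type*} [Fintype V] (G : Digraph V) : ℕ :=
  ⨅ x : V, min (G.outDegIn Finset.univ x) (G.inDegIn Finset.univ x)

/-- The induced subdigraph `G[S]`. -/
def inducedOn {V : Type*} (G : Digraph V) (S : Finset V) : Digraph S where
  Adj x y := G.Adj x y

theorem le_minSemidegree_iff {V : Type*} [Fintype V] [Nonempty V] (G : Digraph V) (d : ℕ) :
    d ≤ G.minSemidegree ↔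
      ∀ x, d ≤ G.outDegIn Finset.univ x ∧ d ≤ G.inDegIn Finset.univ x := by
  unfold minSemidegree
  rw [le_ciInf_iff (OrderBot.bddBelow _)]
  simp

/-- `A, B, S, T` is a partition of the vertex set (classes may be empty). -/
def IsPartition {V : Type*} (A B S T : Finset V) : Prop :=
  (∀ x, x ∈ A ∨ x ∈ B ∨ x ∈ S ∨ x ∈ T) ∧
    Disjoint A B ∧ Disjoint A S ∧ Disjoint A T ∧ Disjoint B S ∧ Disjoint B T ∧ Disjoint S T

open Classical in
/-- The conditions on a partition `A, B, S, T` which witness that `G` is `ST`-extremal. -/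
structure IsSTPartition {V : Type*} [Fintype V] (G : Digraph V) (ε₃ η₂ : ℝ)
    (A B S T : Finset V) : Prop where
  partition : IsPartition A B S T
  card_A_le : A.card ≤ B.card
  card_S_le : S.card ≤ T.card
  le_card_S : (⌊(Fintype.card V : ℝ) / 2⌋ : ℝ) - ε₃ * Fintype.card V ≤ S.card
  card_S_le_half : (S.card : ℝ) ≤ (⌈(Fintype.card V : ℝ) / 2⌉ : ℝ) + ε₃ * Fintype.card V
  le_card_T : (⌊(Fintype.card V : ℝ) / 2⌋ : ℝ) - ε₃ * Fintype.card V ≤ T.card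
  card_T_le_half : (T.card : ℝ) ≤ (⌈(Fintype.card V : ℝ) / 2⌉ : ℝ) + ε₃ * Fintype.card V
  minSemidegree_S : η₂ * Fintype.card V ≤ ((G.inducedOn S).minSemidegree : ℝ)
  minSemidegree_T : η₂ * Fintype.card V ≤ ((G.inducedOn T).minSemidegree : ℝ)
  few_exceptions_S :
    ((S.filter fun x =>
      ¬ ((Fintype.card V : ℝ) / 2 - ε₃ * Fintype.card V ≤ G.outDegIn S x ∧
        (Fintype.card V : ℝ) / 2 - ε₃ * Fintype.card V ≤ G.inDegIn S x)).card : ℝ)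
      ≤ ε₃ * Fintype.card V
  few_exceptions_T :
    ((T.filter fun x =>
      ¬ ((Fintype.card V : ℝ) / 2 - ε₃ * Fintype.card V ≤ G.outDegIn T x ∧
        (Fintype.card V : ℝ) / 2 - ε₃ * Fintype.card V ≤ G.inDegIn T x)).card : ℝ)
      ≤ ε₃ * Fintype.card V
  card_A_add_card_B : (A.card : ℝ) + B.card ≤ ε₃ * Fintype.card V
  degrees_A : ∀ x ∈ A,
    (Fintype.card V : ℝ) / 2 - 3 * η₂ * Fintype.card V < G.inDegIn T x ∧
    (Fintype.card V : ℝ) / 2 - 3 * η₂ * Fintype.card V < G.outDegIn S x ∧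
    (G.inDegIn S x : ℝ) ≤ 3 * η₂ * Fintype.card V ∧
    (G.outDegIn T x : ℝ) ≤ 3 * η₂ * Fintype.card V
  degrees_B : ∀ x ∈ B,
    (Fintype.card V : ℝ) / 2 - 3 * η₂ * Fintype.card V < G.inDegIn S x ∧
    (Fintype.card V : ℝ) / 2 - 3 * η₂ * Fintype.card V < G.outDegIn T x ∧
    (G.inDegIn T x : ℝ) ≤ 3 * η₂ * Fintype.card V ∧
    (G.outDegIn S x : ℝ) ≤ 3 * η₂ * Fintype.card V

/-- `G` is `ST`-extremal, with parameters `ε₃` and `η₂`. -/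
def IsSTExtremal {V : Type*} [Fintype V] (G : Digraph V) (ε₃ η₂ : ℝ) : Prop :=
  ∃ A B S T : Finset V, G.IsSTPartition ε₃ η₂ A B S T

end Digraph

/-! Fix the direction pattern `w` of the cycle. The sides `S` and `T` are almost complete digraphs,
so a path of any orientation can be wound through the typical vertices of one side. The cycle is cut
into one long arc per side, joined by two crossings. What needs care is the crossings, the
exceptional vertices in `A` and `B`, the few atypical vertices of the sides, and the exact lengths
of the arcs. Each local task is carried out in a window of twelve consecutive positions (`FeasN`).
Once disjoint windows are filled, the other positions receive the remaining typical vertices of the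
right side arbitrarily, and exchanges of free vertices remove the wrong edges
(`hasSignedCycle_of_arrangement`). The only global condition is a count: the positions left on the
`T`-arc must be as many as the vertices left in `T`.

By its natural edges a vertex of `B` leads from `S` to `T`, and one of `A` from `T` to `S`. At a
source or sink of the cycle, however, such a vertex sends both edges to the same side, and the
choice between source and sink puts it on either side. The proof therefore depends on the number of
sign changes of `w`.

Many changes. Exceptional vertices are absorbed at sign changes of either arc, so the length of the
`T`-arc may vary over an interval, and only two crossings are needed. If `|T| ≥ |S| + |A| + |B|`,
the semidegree condition yields edges between the sides for all sign patterns up to rotation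
(`hasSignedCycle_of_le_card`, which also settles the case `A = B = ∅` for every `w`). Otherwise
there are two disjoint edges from `T` to `S`, or two disjoint edges that join vertices of `B` to the
wrong side (`exists_edges_or_unnatural`). They cross at two positions of opposite signs at distance
about `n / 2`, which `exists_balanced_gap` provides.

Few changes. The cycle is almost everywhere locally a directed path, so a passage from `S` to `T`
through a vertex of `B` must be compensated by a passage back. König's theorem gives a matching of
`|B| - |A| + 2` edges from `T ∪ B` to `S ∪ B` (`exists_linkMatching`). Its edges yield passages from
`T` to `S` or allow a vertex of `B` to be inserted into one side. There are then exactly two more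
passages back than unmatched vertices of `B`; for a submatching with two edges fewer the numbers
agree. Pairing them up, except for two pieces, leaves crossings for opposite signs in the first case
and for equal signs in the second. Among three equally spaced positions of the cycle, two
consecutive ones have usable signs. -/

namespace Digraph

/-! ### Sign patterns of oriented cycles -/

variable {V : Type*}

/-- Adjacency along a signed edge: `true` is an edge from `x` to `y`, `false` one from `y` to
`x`. -/
def SAdj (G : Digraph V) (s : Bool) (x y : V) : Prop :=
  (s = true → G.Adj x y) ∧ (s = false → G.Adj y x)

@[simp] theorem sAdj_true {G : Digraph V} {x y : V} : G.SAdj true x y ↔ G.Adj x y := by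
  simp [SAdj]

@[simp] theorem sAdj_false {G : Digraph V} {x y : V} : G.SAdj false x y ↔ G.Adj y x := by
  simp [SAdj]

theorem sAdj_not {G : Digraph V} {s : Bool} {x y : V} : G.SAdj (!s) x y ↔ G.SAdj s y x := by
  cases s <;> simp

/-- `G` contains a cyclic arrangement of distinct vertices with edge directions given by `w`. -/
def HasSignedCycle (G : Digraph V) {n : ℕ} (w : ZMod n → Bool) : Prop :=
  ∃ φ : ZMod n → V, Function.Injective φ ∧ ∀ i, G.SAdj (w i) (φ i) (φ (i + 1))

theorem HasSignedCycle.of_rotate {G : Digraph V} {n : ℕ} {w : ZMod n → Bool} (r : ZMod n)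
    (h : G.HasSignedCycle fun i => w (i + r)) : G.HasSignedCycle w := by
  obtain ⟨φ, hφ, h⟩ := h
  refine ⟨fun i => φ (i - r), fun i j hij => sub_left_injective (hφ hij), fun i => ?_⟩
  have := h (i - r)
  simpa [sub_add_eq_add_sub] using this

/-- Each edge of the underlying cycle carries exactly one orientation, so recording whether it
points forwards along the cyclic order determines `C`. Adjacent vertices of the cycle graph differ
by one in `ZMod n`. -/
theorem containsCopy_of_forall_hasSignedCycle {W : Type*} {G : Digraph V} {C : Digraph W} {n : ℕ}
    (hC : C.IsOrientationOfCycle n) (h : ∀ w : ZMod n → Bool, G.HasSignedCycle w) :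
    G.ContainsCopy C := by
  classical
  obtain ⟨hn, hO, ⟨e⟩⟩ := hC
  obtain ⟨k, rfl⟩ : ∃ k, n = k + 3 := ⟨n - 3, by omega⟩
  let e' : W ≃ ZMod (k + 3) := e.toEquiv
  obtain ⟨φ, hφ, hw⟩ := h fun i => decide (C.Adj (e'.symm i) (e'.symm (i + 1)))
  refine ⟨fun x => φ (e' x), hφ.comp e'.injective, fun x y hxy => ?_⟩
  have hne : x ≠ y := by
    rintro rfl
    exact hO x x hxy hxy
  have hadj : (SimpleGraph.cycleGraph (k + 3)).Adj (e x) (e y) :=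
    e.map_rel_iff.2 (by simp [toSimpleGraphInclusive, hne, hxy])
  have hadj' : e' x - e' y = 1 ∨ e' y - e' x = 1 := SimpleGraph.cycleGraph_adj.1 hadj
  rcases hadj' with h1 | h1
  · have hx : e' x = e' y + 1 := by rw [← h1]; ring
    have := hw (e' y)
    simp only [← hx, Equiv.symm_apply_apply] at this
    simpa [hO x y hxy] using this
  · have hy : e' y = e' x + 1 := by rw [← h1]; ring
    have := hw (e' x)
    simp only [← hy, Equiv.symm_apply_apply] at this
    simpa [hxy] using this

open Classical in
/-- The number of neighbours of `x` in `X` along edges of sign `s`. -/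
noncomputable def sDeg (G : Digraph V) (s : Bool) (X : Finset V) (x : V) : ℕ :=
  (X.filter fun y => G.SAdj s x y).card

theorem sDeg_true (G : Digraph V) (X : Finset V) (x : V) : G.sDeg true X x = G.outDegIn X x := by
  unfold sDeg outDegIn
  congr 1
  ext y
  simp

theorem sDeg_false (G : Digraph V) (X : Finset V) (x : V) : G.sDeg false X x = G.inDegIn X x := by
  unfold sDeg inDegIn
  congr 1
  ext y
  simp

/-! ### Correcting arrangements and extending partial ones -/

/-- A cyclic arrangement in which every edge with an end outside `F` joins two vertices of one
class can be corrected by exchanging vertices outside `F`. -/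
theorem hasSignedCycle_of_arrangement [Fintype V] {G : Digraph V} {n : ℕ} [NeZero n]
    (w : ZMod n → Bool) (Q : Bool → Finset V) (hQ : Disjoint (Q false) (Q true)) (k : ℕ)
    (hloop : G.Loopless)
    (hk : ∀ c, ∀ x ∈ Q c, ∃ X : Finset V, X.card ≤ k ∧ ∀ y ∈ Q c, y ∉ X → ∀ s, G.SAdj s x y)
    (F : Finset (ZMod n)) (φ₀ : ZMod n ≃ V)
    (hF : ∀ i ∈ F, i + 1 ∈ F → G.SAdj (w i) (φ₀ i) (φ₀ (i + 1)))
    (hfree : ∀ i, (i ∉ F ∨ i + 1 ∉ F) → ∃ c, φ₀ i ∈ Q c ∧ φ₀ (i + 1) ∈ Q c)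
    (hbig : ∀ c, ∃ Y : Finset (ZMod n), 4 * k < Y.card ∧ ∀ i ∈ Y, i ∉ F ∧ φ₀ i ∈ Q c) :
    G.HasSignedCycle w := by
  classical
  have huniq : ∀ {x c c'}, x ∈ Q c → x ∈ Q c' → c = c' := by
    intro x c c' h h'
    have := Finset.disjoint_left.1 hQ
    cases c <;> cases c' <;> simp_all
  -- Induction on the number of wrong edges. A wrong edge has a free end `u`. Exchanging its vertex
  -- with that at a suitable free position `v` of the same class makes all edges at `u` and `v`
  -- correct and touches no others, so the number drops.
  let bad : (ZMod n ≃ V) → Finset (ZMod n) := fun φ =>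
    Finset.univ.filter fun i => ¬ G.SAdj (w i) (φ i) (φ (i + 1))
  suffices H : ∀ N : ℕ, ∀ φ : ZMod n ≃ V, (bad φ).card = N → (∀ i ∈ F, φ i = φ₀ i) →
      (∀ i c, φ i ∈ Q c ↔ φ₀ i ∈ Q c) → G.HasSignedCycle w from
    H _ φ₀ rfl (fun _ _ => rfl) fun _ _ => Iff.rfl
  intro N
  induction N using Nat.strong_induction_on with
  | _ N ih =>
  intro φ hN hfix hcol
  by_cases hb : bad φ = ∅
  · refine ⟨φ, φ.injective, fun i => ?_⟩
    by_contra hi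
    have : i ∈ bad φ := by simp [bad, hi]
    simp [hb] at this
  obtain ⟨e, he⟩ := Finset.nonempty_iff_ne_empty.2 hb
  have hebad : ¬ G.SAdj (w e) (φ e) (φ (e + 1)) := by simpa [bad] using he
  -- a free end of the bad edge
  have hef : e ∉ F ∨ e + 1 ∉ F := by
    by_contra hcon
    push Not at hcon
    apply hebad
    rw [hfix _ hcon.1, hfix _ hcon.2]
    exact hF e hcon.1 hcon.2
  obtain ⟨u, huF, hue⟩ : ∃ u, u ∉ F ∧ (u = e ∨ u = e + 1) := by
    rcases hef with h | h
    · exact ⟨e, h, Or.inl rfl⟩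
    · exact ⟨e + 1, h, Or.inr rfl⟩
  obtain ⟨c, hc1, hc2⟩ := hfree u (Or.inl huF)
  obtain ⟨c', hc3, hc4⟩ := hfree (u - 1) (Or.inr (by simpa using huF))
  rw [sub_add_cancel] at hc4
  obtain rfl := huniq hc1 hc4
  have hu : φ u ∈ Q c := (hcol _ _).2 hc1
  have hu1 : φ (u + 1) ∈ Q c := (hcol _ _).2 hc2
  have hu0 : φ (u - 1) ∈ Q c := (hcol _ _).2 hc3
  -- vertices that do not fit at `u`, and positions at which `φ u` does not fit
  obtain ⟨X1, hX1, hX1'⟩ := hk c _ hu1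
  obtain ⟨X2, hX2, hX2'⟩ := hk c _ hu0
  obtain ⟨X3, hX3, hX3'⟩ := hk c _ hu
  obtain ⟨Y, hY, hY'⟩ := hbig c
  -- The vertex at `v` may fail to fit between the neighbours of `u` (`X1`, `X2`), and the vertex at
  -- `u` may fail to fit next to `v - 1` or `v + 1` (`X3`, shifted both ways). This excludes at most
  -- `4 * k` positions.
  let Bd : Finset (ZMod n) := (X1.image φ.symm ∪ X2.image φ.symm) ∪
    ((X3.image fun x => φ.symm x + 1) ∪ (X3.image fun x => φ.symm x - 1))
  have hBd : Bd.card ≤ 4 * k := by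
    have h1 : (X1.image φ.symm).card ≤ k := Finset.card_image_le.trans hX1
    have h2 : (X2.image φ.symm).card ≤ k := Finset.card_image_le.trans hX2
    have h3 : (X3.image fun x => φ.symm x + 1).card ≤ k := Finset.card_image_le.trans hX3
    have h4 : (X3.image fun x => φ.symm x - 1).card ≤ k := Finset.card_image_le.trans hX3
    refine (Finset.card_union_le _ _).trans ?_
    have h5 := Finset.card_union_le (X1.image φ.symm) (X2.image φ.symm)
    have h6 := Finset.card_union_le (X3.image fun x => φ.symm x + 1)
      (X3.image fun x => φ.symm x - 1)
    omega
  obtain ⟨v, hvY, hvB⟩ := Finset.exists_mem_notMem_of_card_lt_card (hBd.trans_lt hY)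
  obtain ⟨hvF, hvc⟩ := hY' v hvY
  have hv : φ v ∈ Q c := (hcol _ _).2 hvc
  have hv1 : φ (v + 1) ∈ Q c := by
    obtain ⟨c', h1, h2⟩ := hfree v (Or.inl hvF)
    obtain rfl := huniq hvc h1
    exact (hcol _ _).2 h2
  have hv0 : φ (v - 1) ∈ Q c := by
    obtain ⟨c', h1, h2⟩ := hfree (v - 1) (Or.inr (by simpa using hvF))
    rw [sub_add_cancel] at h2
    obtain rfl := huniq hvc h2
    exact (hcol _ _).2 h1
  simp only [Bd, Finset.mem_union, Finset.mem_image, not_or, not_exists, not_and] at hvB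
  obtain ⟨⟨hvX1, hvX2⟩, hvX3, hvX4⟩ := hvB
  have a1 : ∀ s, G.SAdj s (φ (u + 1)) (φ v) := hX1' _ hv fun h => hvX1 _ h (by simp)
  have a2 : ∀ s, G.SAdj s (φ (u - 1)) (φ v) := hX2' _ hv fun h => hvX2 _ h (by simp)
  have a3 : ∀ s, G.SAdj s (φ u) (φ (v - 1)) := hX3' _ hv0 fun h => hvX3 _ h (by simp)
  have a4 : ∀ s, G.SAdj s (φ u) (φ (v + 1)) := hX3' _ hv1 fun h => hvX4 _ h (by simp)
  have hirr : ∀ {x y : V}, (∀ s, G.SAdj s x y) → x ≠ y := by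
    rintro x _ h rfl
    exact hloop x (sAdj_true.1 (h true))
  have n1 : v ≠ u + 1 := fun h => hirr a1 (by rw [h])
  have n2 : v ≠ u - 1 := fun h => hirr a2 (by rw [h])
  have n3 : v ≠ u := by
    rintro rfl
    rcases hue with rfl | rfl
    · exact hebad (a4 _)
    · rw [add_sub_cancel_right] at a2 a3
      exact hebad (sAdj_not.1 (a3 (!(w e))))
  -- If `1 = 0`, the ring is trivial and `u = v`, against `n3`.
  have one_ne : (1 : ZMod n) ≠ 0 := by
    intro h0
    have : u + 1 = u := by rw [h0, add_zero]
    exact n3 ((eq_of_sub_eq_zero (by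
      have h : ∀ z : ZMod n, z = 0 := fun z => by rw [← mul_one z, h0, mul_zero]
      exact h _)))
  let φ' : ZMod n ≃ V := (Equiv.swap u v).trans φ
  have hφ'u : φ' u = φ v := by simp [φ']
  have hφ'v : φ' v = φ u := by simp [φ']
  have hφ'o : ∀ i, i ≠ u → i ≠ v → φ' i = φ i := fun i h1 h2 => by
    simp [φ', Equiv.swap_apply_of_ne_of_ne h1 h2]
  have hgood : ∀ i, (i = u ∨ i + 1 = u ∨ i = v ∨ i + 1 = v) →
      G.SAdj (w i) (φ' i) (φ' (i + 1)) := by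
    rintro i (rfl | h | rfl | h)
    · rw [hφ'u, hφ'o (i + 1) (by simpa using one_ne) (Ne.symm n1)]
      exact sAdj_not.1 (a1 _)
    · obtain rfl : i = u - 1 := by rw [← h]; ring
      rw [sub_add_cancel, hφ'u, hφ'o (u - 1) (by simpa using one_ne) (Ne.symm n2)]
      exact a2 _
    · rw [hφ'v, hφ'o (i + 1) (fun h => n2 (by rw [← h]; ring)) (by simpa using one_ne)]
      exact a4 _
    · obtain rfl : i = v - 1 := by rw [← h]; ring
      rw [sub_add_cancel, hφ'v, hφ'o (v - 1) (fun h => n1 (by rw [← h]; ring))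
        (by simpa using one_ne)]
      exact sAdj_not.1 (a3 _)
  refine ih (bad φ').card ?_ φ' rfl ?_ ?_
  · rw [← hN]
    apply Finset.card_lt_card
    refine ⟨fun i hi => ?_, fun h => ?_⟩
    · simp only [bad, Finset.mem_filter, Finset.mem_univ, true_and] at hi ⊢
      intro hcon
      apply hi
      by_cases h : i = u ∨ i + 1 = u ∨ i = v ∨ i + 1 = v
      · exact hgood i h
      · push Not at h
        rwa [hφ'o i h.1 h.2.2.1, hφ'o (i + 1) h.2.1 h.2.2.2]
    · have := h he
      simp only [bad, Finset.mem_filter, Finset.mem_univ, true_and] at this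
      apply this
      apply hgood
      rcases hue with rfl | rfl <;> simp
  · intro i hi
    rw [hφ'o i (by rintro rfl; exact huF hi) (by rintro rfl; exact hvF hi), hfix i hi]
  · intro i d
    by_cases h1 : i = u
    · subst h1
      rw [hφ'u]
      exact ⟨fun h => by rw [← huniq hv h]; exact hc1, fun h => by rw [← huniq hc1 h]; exact hv⟩
    by_cases h2 : i = v
    · subst h2
      rw [hφ'v]
      exact ⟨fun h => by rw [← huniq hu h]; exact hvc, fun h => by rw [← huniq hvc h]; exact hu⟩
    rw [hφ'o i h1 h2, hcol]

/-- Extending a partial injection to a bijection that respects a colouring. -/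
theorem exists_equiv_extending {κ X Y : Type*} [Fintype κ] [Fintype X] [Fintype Y]
    (s : κ → X) (u : κ → Y) (hs : Function.Injective s) (hu : Function.Injective u)
    (cX : X → Bool) (cY : Y → Bool)
    (hcard : ∀ c, Nat.card {x // x ∉ Set.range s ∧ cX x = c} =
      Nat.card {y // y ∉ Set.range u ∧ cY y = c}) :
    ∃ e : X ≃ Y, (∀ k, e (s k) = u k) ∧
      ∀ x, x ∉ Set.range s → e x ∉ Set.range u ∧ cY (e x) = cX x := by
  classical
  -- Elements of the range are coloured by their index, all others by their class. Corresponding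
  -- fibres of the two colourings have equal size, so bijections between the fibres glue together.
  let f : X → κ ⊕ Bool := fun x =>
    if h : ∃ k, s k = x then Sum.inl h.choose else Sum.inr (cX x)
  let g : Y → κ ⊕ Bool := fun y =>
    if h : ∃ k, u k = y then Sum.inl h.choose else Sum.inr (cY y)
  have hfs : ∀ k, f (s k) = Sum.inl k := fun k => by
    have h : ∃ k', s k' = s k := ⟨k, rfl⟩
    simp only [f, dif_pos h]
    exact congrArg _ (hs h.choose_spec)
  have hgu : ∀ k, g (u k) = Sum.inl k := fun k => by
    have h : ∃ k', u k' = u k := ⟨k, rfl⟩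
    simp only [g, dif_pos h]
    exact congrArg _ (hu h.choose_spec)
  have hfr : ∀ x c, f x = Sum.inr c ↔ x ∉ Set.range s ∧ cX x = c := fun x c => by
    by_cases h : ∃ k, s k = x
    · simp only [f, dif_pos h]
      simp [h]
    · simp only [f, dif_neg h]
      simp [h]
  have hgr : ∀ x c, g x = Sum.inr c ↔ x ∉ Set.range u ∧ cY x = c := fun x c => by
    by_cases h : ∃ k, u k = x
    · simp only [g, dif_pos h]
      simp [h]
    · simp only [g, dif_neg h]
      simp [h]
  have hfib : ∀ l, Nonempty ({x // f x = l} ≃ {y // g y = l}) := by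
    rintro (k | c)
    · refine ⟨⟨fun _ => ⟨u k, hgu k⟩, fun _ => ⟨s k, hfs k⟩, ?_, ?_⟩⟩
      · rintro ⟨x, hx⟩
        have : ∃ k, s k = x := by
          by_contra h
          simp [f, dif_neg h] at hx
        obtain ⟨k', rfl⟩ := this
        have := (hfs k').symm.trans hx
        simp at this
        simp [this]
      · rintro ⟨x, hx⟩
        have : ∃ k, u k = x := by
          by_contra h
          simp [g, dif_neg h] at hx
        obtain ⟨k', rfl⟩ := this
        have := (hgu k').symm.trans hx
        simp at this
        simp [this]
    · have h1 : Nat.card {x // f x = Sum.inr c} = Nat.card {y // g y = Sum.inr c} := by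
        simp only [hfr, hgr]
        exact hcard c
      exact ⟨(Finite.card_eq.1 h1).some⟩
  let E := fun l => (hfib l).some
  let e : X ≃ Y := (Equiv.sigmaFiberEquiv f).symm.trans
    ((Equiv.sigmaCongrRight E).trans (Equiv.sigmaFiberEquiv g))
  have hge : ∀ x, g (e x) = f x := fun x => (E (f x) ⟨x, rfl⟩).2
  refine ⟨e, fun k => ?_, fun x hx => ?_⟩
  · have h1 : g (e (s k)) = Sum.inl k := (hge _).trans (hfs k)
    have : ∃ k', u k' = e (s k) := by
      by_contra h
      simp [g, dif_neg h] at h1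
    obtain ⟨k', hk'⟩ := this
    rw [← hk', hgu] at h1
    rw [← hk', Sum.inl.inj h1]
  · exact (hgr _ _).1 ((hge x).trans ((hfr x _).2 ⟨hx, rfl⟩))

/-! ### Numerical form of the extremal structure; paths in windows -/

/-- The numerical description of an `ST`-extremal digraph that the embedding uses. The sides are
`P false` and `P true`, with subsets `Q c` of typical vertices; a vertex of `E t` naturally sends
its edges of sign `s` to the side `s == t`. -/
structure Layout [Fintype V] (G : Digraph V) (P Q E : Bool → Finset V) (κ D : ℕ) : Prop where
  loopless : G.Loopless
  cover : ∀ x, (∃ c, x ∈ P c) ∨ ∃ t, x ∈ E t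
  disj_P : Disjoint (P false) (P true)
  disj_E : Disjoint (E false) (E true)
  disj_PE : ∀ c t, Disjoint (P c) (E t)
  sub : ∀ c, Q c ⊆ P c
  bad : ∀ c, (P c).card ≤ (Q c).card + κ
  exc : (E false).card + (E true).card ≤ κ
  size : ∀ c, Fintype.card V ≤ 2 * (P c).card + 4 * κ
  deg : ∀ c s, ∀ x ∈ P c, D ≤ G.sDeg s (Q c) x
  typical : ∀ c s, ∀ x ∈ Q c, (Q c).card ≤ G.sDeg s (Q c) x + 3 * κ
  natural : ∀ t s, ∀ x ∈ E t, Fintype.card V ≤ 3 * G.sDeg s (Q (s == t)) x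
  unnatural : ∀ t s, ∀ x ∈ E t, 100 * G.sDeg s (P (!(s == t))) x ≤ Fintype.card V
  semidegree : ∀ s x, Fintype.card V ≤ 2 * G.sDeg s Finset.univ x
  large : 1000 ≤ κ
  κ_le : 1000 * κ ≤ D
  D_le : 1000 * D ≤ Fintype.card V
  E_le : (E false).card ≤ (E true).card
  P_le : (P false).card ≤ (P true).card

/-- `u l, …, u r` is a path with signs `σ`; its vertices outside `K` are typical vertices of the
sides prescribed by `lab` and avoid `Z`. -/
structure PathOn (G : Digraph V) (P Q : Bool → Finset V) (K Z : Finset V) (σ lab : ℕ → Bool)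
    (u : ℕ → V) (l r : ℕ) : Prop where
  inj : ∀ i j, l ≤ i → i ≤ r → l ≤ j → j ≤ r → u i = u j → i = j
  adj : ∀ j, l ≤ j → j < r → G.SAdj (σ j) (u j) (u (j + 1))
  side : ∀ j, l ≤ j → j ≤ r → (u j ∈ P true ↔ lab j = true)
  mem : ∀ j, l ≤ j → j ≤ r → u j ∈ K ∨ (u j ∈ Q (lab j) ∧ u j ∉ Z)

/-- A window of twelve positions with signs `σ` can be filled by a path through `K` which joins
typical vertices of the sides `c` and `c'` and avoids a given small set. -/
def Feas (G : Digraph V) (P Q : Bool → Finset V) (σ : ℕ → Bool) (c c' : Bool) (K : Finset V)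
    (lab : ℕ → Bool) (z : ℕ) : Prop :=
  ∀ Z : Finset V, Z.card ≤ z → ∃ u : ℕ → V, G.PathOn P Q K Z σ lab u 0 11 ∧
    u 0 ∈ Q c ∧ u 11 ∈ Q c' ∧ ∀ x ∈ K, ∃ j ≤ 11, u j = x

section

variable {G : Digraph V} {P Q : Bool → Finset V} {K Z : Finset V} {σ lab : ℕ → Bool} {u : ℕ → V}
  {l r : ℕ}

/-- A window has positions `0, …, 11` and edges `0, …, 10`, hence the reflections `11 - j` and `10 -
j`. Reading an edge backwards negates its sign. -/
theorem PathOn.reverse (h : G.PathOn P Q K Z σ lab u l r) (hlr : l ≤ r) (hr : r ≤ 11) :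
    G.PathOn P Q K Z (fun j => !σ (10 - j)) (fun j => lab (11 - j)) (fun j => u (11 - j))
      (11 - r) (11 - l) where
  inj i j h1 h2 h3 h4 h5 := by
    have := h.inj _ _ (by omega) (by omega) (by omega) (by omega) h5
    omega
  adj j h1 h2 := by
    rw [sAdj_not]
    have := h.adj (10 - j) (by omega) (by omega)
    rw [show 10 - j + 1 = 11 - j by omega] at this
    rwa [show 11 - (j + 1) = 10 - j by omega]
  side j h1 h2 := h.side _ (by omega) (by omega)
  mem j h1 h2 := h.mem _ (by omega) (by omega)

theorem PathOn.congr {σ' lab' : ℕ → Bool} {u' : ℕ → V} (h : G.PathOn P Q K Z σ lab u l r)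
    (hσ : ∀ j, l ≤ j → j < r → σ' j = σ j) (hlab : ∀ j, l ≤ j → j ≤ r → lab' j = lab j)
    (hu : ∀ j, l ≤ j → j ≤ r → u' j = u j) : G.PathOn P Q K Z σ' lab' u' l r where
  inj i j h1 h2 h3 h4 h5 := by
    rw [hu i h1 h2, hu j h3 h4] at h5
    exact h.inj i j h1 h2 h3 h4 h5
  adj j h1 h2 := by
    rw [hσ j h1 h2, hu j h1 h2.le, hu (j + 1) (by omega) h2]
    exact h.adj j h1 h2
  side j h1 h2 := by
    rw [hu j h1 h2, hlab j h1 h2]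
    exact h.side j h1 h2
  mem j h1 h2 := by
    rw [hu j h1 h2, hlab j h1 h2]
    exact h.mem j h1 h2

theorem PathOn.single {v : V} {l : ℕ} (hs : v ∈ P true ↔ lab l = true)
    (hm : v ∈ K ∨ (v ∈ Q (lab l) ∧ v ∉ Z)) : G.PathOn P Q K Z σ lab (fun _ => v) l l where
  inj i j _ _ _ _ _ := by omega
  adj j _ _ := by omega
  side j h1 h2 := by
    obtain rfl : j = l := by omega
    exact hs
  mem j h1 h2 := by
    obtain rfl : j = l := by omega
    exact hm

theorem PathOn.snoc {v : V} (h : G.PathOn P Q K Z σ lab u l r) (hlr : l ≤ r)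
    (hv : ∀ j, l ≤ j → j ≤ r → u j ≠ v) (ha : G.SAdj (σ r) (u r) v)
    (hs : v ∈ P true ↔ lab (r + 1) = true) (hm : v ∈ K ∨ (v ∈ Q (lab (r + 1)) ∧ v ∉ Z)) :
    G.PathOn P Q K Z σ lab (Function.update u (r + 1) v) l (r + 1) := by
  have hu : ∀ j, j ≤ r → Function.update u (r + 1) v j = u j := fun j hj =>
    Function.update_of_ne (by omega) _ _
  have hl : Function.update u (r + 1) v (r + 1) = v := Function.update_self _ _ _
  refine ⟨fun i j h1 h2 h3 h4 h5 => ?_, fun j h1 h2 => ?_, fun j h1 h2 => ?_, fun j h1 h2 => ?_⟩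
  · rcases Nat.lt_or_ge r i with hi | hi <;> rcases Nat.lt_or_ge r j with hj | hj
    · omega
    · obtain rfl : i = r + 1 := by omega
      rw [hl, hu j hj] at h5
      exact absurd h5.symm (hv j h3 hj)
    · obtain rfl : j = r + 1 := by omega
      rw [hl, hu i hi] at h5
      exact absurd h5 (hv i h1 hi)
    · rw [hu i hi, hu j hj] at h5
      exact h.inj i j h1 hi h3 hj h5
  · rcases Nat.lt_or_ge j r with hj | hj
    · rw [hu j hj.le, hu (j + 1) hj]
      exact h.adj j h1 hj
    · obtain rfl : j = r := by omega
      rw [hl, hu j le_rfl]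
      exact ha
  · rcases Nat.lt_or_ge r j with hj | hj
    · obtain rfl : j = r + 1 := by omega
      rwa [hl]
    · rw [hu j hj]
      exact h.side j h1 hj
  · rcases Nat.lt_or_ge r j with hj | hj
    · obtain rfl : j = r + 1 := by omega
      rwa [hl]
    · rw [hu j hj]
      exact h.mem j h1 hj

theorem exists_sAdj_notMem {s : Bool} {X Y : Finset V} {x : V} (h : Y.card < G.sDeg s X x) :
    ∃ y ∈ X, y ∉ Y ∧ G.SAdj s x y := by
  classical
  obtain ⟨y, hy, hy'⟩ := Finset.exists_mem_notMem_of_card_lt_card h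
  simp only [Finset.mem_filter] at hy
  exact ⟨y, hy.1, hy', hy.2⟩

variable [Fintype V] {E : Bool → Finset V} {κ D : ℕ}

theorem Layout.eq_of_mem (L : G.Layout P Q E κ D) {x : V} {c c' : Bool} (h : x ∈ P c)
    (h' : x ∈ P c') : c = c' := by
  have := Finset.disjoint_left.1 L.disj_P
  cases c <;> cases c' <;> simp_all

theorem Layout.mem_true_iff (L : G.Layout P Q E κ D) {x : V} {c : Bool} (h : x ∈ P c) :
    x ∈ P true ↔ c = true :=
  ⟨fun h' => L.eq_of_mem h h', fun h' => h' ▸ h⟩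

theorem Layout.notMem_P (L : G.Layout P Q E κ D) {x : V} {t : Bool} (h : x ∈ E t) (c : Bool) :
    x ∉ P c := fun h' => Finset.disjoint_left.1 (L.disj_PE c t) h' h

/-- A path can be prolonged by one typical vertex. -/
theorem PathOn.exists_snoc (L : G.Layout P Q E κ D) (h : G.PathOn P Q K Z σ lab u l r)
    (hlr : l ≤ r) (hr : r ≤ 11) (hd : Z.card + 12 < G.sDeg (σ r) (Q (lab (r + 1))) (u r)) :
    ∃ v ∈ Q (lab (r + 1)), G.PathOn P Q K Z σ lab (Function.update u (r + 1) v) l (r + 1) := by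
  classical
  have hcard : (Z ∪ (Finset.range 12).image u).card < G.sDeg (σ r) (Q (lab (r + 1))) (u r) := by
    have h1 := Finset.card_union_le Z ((Finset.range 12).image u)
    have h2 : ((Finset.range 12).image u).card ≤ 12 := Finset.card_image_le.trans (by simp)
    omega
  obtain ⟨v, hvQ, hvZ, hv⟩ := exists_sAdj_notMem hcard
  simp only [Finset.mem_union, Finset.mem_image, Finset.mem_range, not_or, not_exists,
    not_and] at hvZ
  exact ⟨v, hvQ, h.snoc hlr (fun j h1 h2 => hvZ.2 j (by omega)) hv
    (L.mem_true_iff (L.sub _ hvQ)) (Or.inr ⟨hvQ, hvZ.1⟩)⟩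

/-- Greedy choice: after the first step the end is a typical vertex, with at least `D` typical
neighbours on its side, and only `Z` and the vertices of the path itself have to be avoided. -/
theorem PathOn.extend_right (L : G.Layout P Q E κ D) (h : G.PathOn P Q K Z σ lab u l r)
    (hlr : l ≤ r) {r' : ℕ} (hr : r < r') (hr' : r' ≤ 11) (hZ : Z.card + 12 < D) {c : Bool}
    (hd : Z.card + 12 < G.sDeg (σ r) (Q c) (u r)) (hc : ∀ j, r < j → j ≤ r' → lab j = c) :
    ∃ u', G.PathOn P Q K Z σ lab u' l r' ∧ (∀ j ≤ r, u' j = u j) ∧ u' r' ∈ Q c := by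
  induction r', hr using Nat.le_induction with
  | base =>
    obtain ⟨v, hv, h'⟩ := h.exists_snoc L hlr (by omega)
      (by rwa [hc (r + 1) (by omega) le_rfl])
    refine ⟨_, h', fun j hj => Function.update_of_ne (by omega) _ _, ?_⟩
    rw [hc (r + 1) (by omega) le_rfl] at hv
    simpa using hv
  | succ r' hrr ih =>
    obtain ⟨u', h1, h2, h3⟩ := ih (by omega) fun j hj hj' => hc j hj (by omega)
    have hc' := hc (r' + 1) (by omega) le_rfl
    obtain ⟨v, hv, h'⟩ := h1.exists_snoc L (by omega) (by omega) (by
      rw [hc']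
      exact hZ.trans_le (L.deg c _ _ (L.sub _ h3)))
    refine ⟨_, h', fun j hj => ?_, ?_⟩
    · rw [Function.update_of_ne (by omega), h2 j hj]
    · rw [hc'] at hv
      simpa using hv

theorem PathOn.extend_left (L : G.Layout P Q E κ D) (h : G.PathOn P Q K Z σ lab u l r)
    (hlr : l ≤ r) {l' : ℕ} (hl : l' < l) (hr' : r ≤ 11) (hZ : Z.card + 12 < D) {c : Bool}
    (hd : Z.card + 12 < G.sDeg (!σ (l - 1)) (Q c) (u l)) (hc : ∀ j, l' ≤ j → j < l → lab j = c) :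
    ∃ u', G.PathOn P Q K Z σ lab u' l' r ∧ (∀ j, l ≤ j → j ≤ r → u' j = u j) ∧ u' l' ∈ Q c := by
  obtain ⟨u', h1, h2, h3⟩ := (h.reverse hlr hr').extend_right L (by omega) (r' := 11 - l')
    (by omega) (by omega) hZ (c := c)
    (by
      rwa [show 10 - (11 - l) = l - 1 by omega, show 11 - (11 - l) = l by omega])
    fun j h1 h2 => hc _ (by omega) (by omega)
  have h4 := h1.reverse (by omega) (by omega)
  rw [show 11 - (11 - l') = l' by omega, show 11 - (11 - r) = r by omega] at h4
  refine ⟨fun j => u' (11 - j), h4.congr (fun j h5 h6 => ?_) (fun j h5 h6 => ?_)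
    (fun _ _ _ => rfl), fun j h5 h6 => ?_, h3⟩
  · rw [Bool.not_not, show 10 - (10 - j) = j by omega]
  · rw [show 11 - (11 - j) = j by omega]
  · have h7 := h2 (11 - j) (by omega)
    rwa [show 11 - (11 - j) = j by omega] at h7

/-- Only the core of a window needs care: if its two ends have many typical neighbours on the sides
`c` and `c'`, greedy prolongation fills the remaining positions. -/
theorem Feas.of_core (L : G.Layout P Q E κ D) {c c' : Bool} {z : ℕ} (hz : z + 12 < D)
    (h : ∀ Z : Finset V, Z.card ≤ z → ∃ u l r, 1 ≤ l ∧ l ≤ r ∧ r ≤ 10 ∧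
      G.PathOn P Q K Z σ lab u l r ∧ (∀ x ∈ K, ∃ j, l ≤ j ∧ j ≤ r ∧ u j = x) ∧
      z + 12 < G.sDeg (!σ (l - 1)) (Q c) (u l) ∧ z + 12 < G.sDeg (σ r) (Q c') (u r) ∧
      (∀ j < l, lab j = c) ∧ ∀ j, r < j → j ≤ 11 → lab j = c') :
    G.Feas P Q σ c c' K lab z := by
  intro Z hZ
  obtain ⟨u, l, r, h1, h2, h3, hp, hK, hdl, hdr, hl, hr⟩ := h Z hZ
  obtain ⟨u', hp', hu', hu11⟩ := hp.extend_right L h2 (r' := 11) (by omega) le_rfl (by omega)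
    (by omega) hr
  obtain ⟨u'', hp'', hu'', hu0⟩ := hp'.extend_left L (l' := 0) (c := c) (by omega) (by omega)
    le_rfl (by omega) (by rw [hu' l h2]; omega) (fun j _ hj => hl j hj)
  refine ⟨u'', hp'', hu0, ?_, fun x hx => ?_⟩
  · rwa [hu'' 11 (by omega) le_rfl]
  · obtain ⟨j, h4, h5, rfl⟩ := hK x hx
    exact ⟨j, by omega, by rw [hu'' j h4 (by omega), hu' j h5]⟩

omit [Fintype V] in
theorem Feas.reverse {c c' : Bool} {z : ℕ} {σ' lab' : ℕ → Bool} (h : G.Feas P Q σ c c' K lab z)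
    (hσ : ∀ j ≤ 10, σ' j = !σ (10 - j)) (hlab : ∀ j ≤ 11, lab' j = lab (11 - j)) :
    G.Feas P Q σ' c' c K lab' z := by
  intro Z hZ
  obtain ⟨u, h1, h2, h3, h4⟩ := h Z hZ
  refine ⟨fun j => u (11 - j),
    (h1.reverse (Nat.zero_le _) le_rfl).congr (fun j _ hj => hσ j (by omega))
    (fun j _ hj => hlab j hj) (fun _ _ _ => rfl), h3, h2, fun x hx => ?_⟩
  obtain ⟨j, hj, rfl⟩ := h4 x hx
  exact ⟨11 - j, by omega, by simp only; rw [show 11 - (11 - j) = j by omega]⟩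

end

/-! ### The kinds of windows -/

/-- `Feas` for some labelling with exactly `τ` positions of side `true`. -/
def FeasN (G : Digraph V) (P Q : Bool → Finset V) (σ : ℕ → Bool) (c c' : Bool) (K : Finset V)
    (τ z : ℕ) : Prop :=
  ∃ lab : ℕ → Bool, ((Finset.range 12).filter fun j => lab j = true).card = τ ∧
    G.Feas P Q σ c c' K lab z

section

variable {G : Digraph V} {P Q : Bool → Finset V} {K Z : Finset V} {σ lab : ℕ → Bool} {u : ℕ → V}
  {l r z : ℕ} {c c' : Bool}

theorem FeasN.reverse {τ : ℕ} {σ' : ℕ → Bool} (h : G.FeasN P Q σ c c' K τ z)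
    (hσ : ∀ j ≤ 10, σ' j = !σ (10 - j)) : G.FeasN P Q σ' c' c K τ z := by
  obtain ⟨lab, h1, h2⟩ := h
  refine ⟨fun j => lab (11 - j), ?_, h2.reverse hσ fun _ _ => rfl⟩
  rw [← h1, Finset.card_filter, Finset.card_filter, ← Finset.sum_range_reflect]
  refine Finset.sum_congr rfl fun j hj => ?_
  rw [Finset.mem_range] at hj
  simp only [show 11 - (12 - 1 - j) = j by omega]

theorem PathOn.mono {K' : Finset V} (h : G.PathOn P Q K Z σ lab u l r) (hK : K ⊆ K') :
    G.PathOn P Q K' Z σ lab u l r :=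
  ⟨h.inj, h.adj, h.side, fun j h1 h2 => (h.mem j h1 h2).imp (fun h => hK h) id⟩

theorem PathOn.cons {v : V} (h : G.PathOn P Q K Z σ lab u (l + 1) r)
    (hv : ∀ j, l + 1 ≤ j → j ≤ r → u j ≠ v) (ha : G.SAdj (σ l) v (u (l + 1)))
    (hs : v ∈ P true ↔ lab l = true) (hm : v ∈ K ∨ (v ∈ Q (lab l) ∧ v ∉ Z)) :
    G.PathOn P Q K Z σ lab (Function.update u l v) l r := by
  have hu : ∀ j, l + 1 ≤ j → Function.update u l v j = u j := fun j hj =>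
    Function.update_of_ne (by omega) _ _
  have hl : Function.update u l v l = v := Function.update_self _ _ _
  refine ⟨fun i j h1 h2 h3 h4 h5 => ?_, fun j h1 h2 => ?_, fun j h1 h2 => ?_, fun j h1 h2 => ?_⟩
  · rcases Nat.eq_or_lt_of_le h1 with rfl | hi <;> rcases Nat.eq_or_lt_of_le h3 with rfl | hj
    · rfl
    · rw [hl, hu j hj] at h5
      exact absurd h5.symm (hv j hj h4)
    · rw [hl, hu i hi] at h5
      exact absurd h5 (hv i hi h2)
    · rw [hu i hi, hu j hj] at h5
      exact h.inj i j hi h2 hj h4 h5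
  · rcases Nat.eq_or_lt_of_le h1 with rfl | hj
    · rw [hl, hu _ le_rfl]
      exact ha
    · rw [hu j hj, hu (j + 1) (by omega)]
      exact h.adj j hj h2
  · rcases Nat.eq_or_lt_of_le h1 with rfl | hj
    · rwa [hl]
    · rw [hu j hj]
      exact h.side j hj h2
  · rcases Nat.eq_or_lt_of_le h1 with rfl | hj
    · rwa [hl]
    · rw [hu j hj]
      exact h.mem j hj h2

variable [Fintype V] {E : Bool → Finset V} {κ D : ℕ}

theorem Layout.lt_sDeg_side (L : G.Layout P Q E κ D) (hz : z + 12 < D) {x : V} (hx : x ∈ P c)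
    (s : Bool) : z + 12 < G.sDeg s (Q c) x :=
  hz.trans_le (L.deg c s x hx)

theorem Layout.lt_sDeg_natural (L : G.Layout P Q E κ D) (hz : z + 12 < D) {x : V} {t s : Bool}
    (hx : x ∈ E t) (hc : (s == t) = c) : z + 12 < G.sDeg s (Q c) x := by
  have h1 := L.natural t s x hx
  have h2 := L.D_le
  rw [hc] at h1
  omega

/-- Labels count the vertices of `P true`, so an exceptional vertex is labelled `false` on whichever
arc it lies. This is why a window inside the arc of `P true` that absorbs an exceptional vertex has
11 positions labelled `true` instead of 12. -/
theorem Layout.mem_true_iff_of_exc (L : G.Layout P Q E κ D) {x : V} {t b : Bool} (hx : x ∈ E t)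
    (hb : b = false) : x ∈ P true ↔ b = true := by
  subst hb
  simp [L.notMem_P hx]

/-- A core of one vertex. -/
theorem Feas.single [DecidableEq V] (L : G.Layout P Q E κ D) (hz : z + 12 < D) {v : V}
    (h1 : 1 ≤ l) (h2 : l ≤ 10)
    (hl : z + 12 < G.sDeg (!σ (l - 1)) (Q c) v) (hr : z + 12 < G.sDeg (σ l) (Q c') v)
    (hlab : v ∈ P true ↔ lab l = true) (hlab1 : ∀ j < l, lab j = c)
    (hlab2 : ∀ j, l < j → j ≤ 11 → lab j = c') : G.Feas P Q σ c c' {v} lab z :=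
  Feas.of_core L hz fun Z _ => ⟨fun _ => v, l, l, h1, le_rfl, h2,
    PathOn.single hlab (Or.inl (by simp)), fun x hx => ⟨l, le_rfl, le_rfl, by simp_all⟩,
    hl, hr, hlab1, hlab2⟩

/-- A core of two vertices. -/
theorem Feas.pair [DecidableEq V] (L : G.Layout P Q E κ D) (hz : z + 12 < D) {v v' : V}
    (h1 : 1 ≤ l) (h2 : l ≤ 9) (hv : v ≠ v') (ha : G.SAdj (σ l) v v')
    (hl : z + 12 < G.sDeg (!σ (l - 1)) (Q c) v) (hr : z + 12 < G.sDeg (σ (l + 1)) (Q c') v')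
    (hlab : v ∈ P true ↔ lab l = true) (hlab' : v' ∈ P true ↔ lab (l + 1) = true)
    (hlab1 : ∀ j < l, lab j = c)
    (hlab2 : ∀ j, l + 1 < j → j ≤ 11 → lab j = c') : G.Feas P Q σ c c' {v, v'} lab z := by
  refine Feas.of_core L hz fun Z _ => ⟨_, l, l + 1, h1, by omega, by omega,
    (PathOn.single hlab (Or.inl (by simp))).snoc le_rfl (fun _ _ _ => hv) ha hlab'
      (Or.inl (by simp)), fun x hx => ?_, ?_, ?_, hlab1, hlab2⟩
  · simp only [Finset.mem_insert, Finset.mem_singleton] at hx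
    rcases hx with rfl | rfl
    · exact ⟨l, le_rfl, by omega, by simp⟩
    · exact ⟨l + 1, by omega, le_rfl, by simp⟩
  · simpa using hl
  · simpa using hr

theorem feasN_side [DecidableEq V] (L : G.Layout P Q E κ D) (hz : z + 12 < D) {x : V}
    (hx : x ∈ P c) (σ : ℕ → Bool) : G.FeasN P Q σ c c {x} (if c then 12 else 0) z :=
  ⟨fun _ => c, by cases c <;> simp, Feas.single L hz (l := 6) (by omega) (by omega)
    (L.lt_sDeg_side hz hx _) (L.lt_sDeg_side hz hx _) (L.mem_true_iff hx) (fun _ _ => rfl)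
    fun _ _ _ => rfl⟩

/-- At a position where the sign changes, an exceptional vertex can be inserted into a side. -/
theorem feasN_turn [DecidableEq V] (L : G.Layout P Q E κ D) (hz : z + 12 < D) {x : V} {t : Bool}
    (hx : x ∈ E t) (h5 : σ 5 = !σ 6) (hc : (σ 6 == t) = c) :
    G.FeasN P Q σ c c {x} (if c then 11 else 0) z :=
  -- Seen from `x`, both of its edges have the sign `σ 6`, so both lead naturally to the side `σ 6
  -- == t`.
  ⟨fun j => c && !(j == 6), by cases c <;> decide, Feas.single L hz (l := 6) (by omega) (by omega)
    (L.lt_sDeg_natural hz hx (by rw [h5, Bool.not_not, hc])) (L.lt_sDeg_natural hz hx hc)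
    (L.mem_true_iff_of_exc hx (by simp)) (fun j hj => by
      have : (j == 6) = false := by simp; omega
      simp [this]) fun j hj _ => by
      have : (j == 6) = false := by simp; omega
      simp [this]⟩

/-- Crossing between the sides along an edge. -/
theorem feasN_edge [DecidableEq V] (L : G.Layout P Q E κ D) (hz : z + 12 < D) {x y : V}
    (hx : x ∈ P c) (hy : y ∈ P (!c)) (ha : G.SAdj (σ 5) x y) :
    G.FeasN P Q σ c (!c) {x, y} 6 z := by
  have hne : x ≠ y := by
    rintro rfl
    have := L.eq_of_mem hx hy
    cases c <;> simp at this
  exact ⟨fun j => if j < 6 then c else !c, by cases c <;> decide,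
    Feas.pair L hz (l := 5) (by omega) (by omega) hne ha (L.lt_sDeg_side hz hx _)
      (L.lt_sDeg_side hz hy _) (by simpa using L.mem_true_iff hx)
      (by simpa using L.mem_true_iff hy)
      (fun j hj => if_pos (by omega)) fun j hj _ => if_neg (by omega)⟩

/-- Crossing between the sides through an exceptional vertex. -/
theorem feasN_through [DecidableEq V] (L : G.Layout P Q E κ D) (hz : z + 12 < D) {x : V}
    {t s : Bool} (hx : x ∈ E t) (hσ : ∀ j ≤ 10, σ j = s) :
    G.FeasN P Q σ (!(s == t)) (s == t) {x} 6 z := by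
  have h1 : ((!s) == t) = !(s == t) := by cases s <;> cases t <;> rfl
  refine ⟨fun j => if j < 6 then !(s == t) else (s == t), by cases s <;> cases t <;> decide, ?_⟩
  -- The exceptional vertex counts as `false`; it is placed at 6 or at 5 according to the direction
  -- of the crossing, so that six positions are labelled `true` in both cases.
  cases hst : (s == t)
  · exact Feas.single L hz (l := 6) (by omega) (by omega)
      (L.lt_sDeg_natural hz hx (by rw [hσ _ (by omega), h1, hst]))
      (L.lt_sDeg_natural hz hx (by rw [hσ _ (by omega), hst]))
      (L.mem_true_iff_of_exc hx (by simp)) (fun j hj => by simp [hj])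
      fun j hj _ => by simp; omega
  · exact Feas.single L hz (l := 5) (by omega) (by omega)
      (L.lt_sDeg_natural hz hx (by rw [hσ _ (by omega), h1, hst]))
      (L.lt_sDeg_natural hz hx (by rw [hσ _ (by omega), hst]))
      (L.mem_true_iff_of_exc hx (by simp)) (fun j hj => by simp; omega)
      fun j hj _ => by simp; omega

/-- Inserting an exceptional vertex into a side along an unnatural edge. -/
theorem feasN_unnatural [DecidableEq V] (L : G.Layout P Q E κ D) (hz : z + 12 < D) {b v : V}
    {t s s' : Bool} (hb : b ∈ E t) (hv : v ∈ P c) (hc : (s == t) = !c) (ha : G.SAdj s b v)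
    (hσ : ∀ j ≤ 10, σ j = s') : G.FeasN P Q σ c c {b, v} (if c then 11 else 0) z := by
  -- At `b`, the edge of sign `!s` leads naturally to the side `c`, and the unnatural edge to `v`
  -- leads to the same side. A window of the other sign is read backwards.
  have key : ∀ σ : ℕ → Bool, (∀ j ≤ 10, σ j = s) →
      G.FeasN P Q σ c c {b, v} (if c then 11 else 0) z := fun σ hσ =>
    ⟨fun j => c && !(j == 5), by cases c <;> decide, Feas.pair L hz (l := 5) (by omega) (by omega)
      (by rintro rfl; exact L.notMem_P hb _ hv) (by rwa [hσ _ (by omega)])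
      (L.lt_sDeg_natural hz hb (by
        rw [hσ _ (by omega)]; cases s <;> cases t <;> cases c <;> simp_all))
      (L.lt_sDeg_side hz hv _) (L.mem_true_iff_of_exc hb (by simp))
      (by simpa using L.mem_true_iff hv)
      (fun j hj => by
        have : (j == 5) = false := by simp; omega
        simp [this]) fun j hj _ => by
        have : (j == 5) = false := by simp; omega
        simp [this]⟩
  by_cases h : s' = s
  · exact key σ (by rwa [← h])
  · refine (key (fun _ => s) fun _ _ => rfl).reverse fun j hj => ?_
    rw [hσ j hj]
    cases s <;> cases s' <;> simp_all

/-- Crossing between the sides at an exceptional vertex which has an unnatural neighbour. -/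
theorem feasN_unnatural_crossing [DecidableEq V] (L : G.Layout P Q E κ D) (hz : z + 12 < D)
    {b v : V} {t s : Bool} (hb : b ∈ E t) (hv : v ∈ P c) (hc : (s == t) = !c) (ha : G.SAdj s b v)
    (h5 : σ 5 = s) : ∃ K : Finset V, b ∈ K ∧ K ⊆ {b, v} ∧
      G.FeasN P Q σ c (!c) K (if c then 5 else 6) z := by
  have hcard : ((Finset.range 12).filter fun j =>
      (if j < 6 then c && !(j == 5) else !c) = true).card = if c then 5 else 6 := by
    cases c <;> decide
  have h4 : ∀ j < 5, (if j < 6 then c && !(j == 5) else !c) = c := fun j hj => by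
    have : (j == 5) = false := by simp; omega
    simp [this]
    omega
  have h6 : ∀ j, 5 < j → j ≤ 11 → (if j < 6 then c && !(j == 5) else !c) = !c := fun j hj _ =>
    if_neg (by omega)
  -- If the sign does not change at `b`, both of its edges are natural and it crosses alone. If it
  -- changes, both edges at `b` have the sign `s`, whose natural side is `!c`; the unnatural edge to
  -- `v` then provides the link to the side `c`.
  by_cases h : σ 4 = s
  · refine ⟨{b}, by simp, by simp, fun j => if j < 6 then c && !(j == 5) else !c, hcard, ?_⟩
    refine Feas.single L hz (l := 5) (by omega) (by omega) (L.lt_sDeg_natural hz hb ?_)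
      (L.lt_sDeg_natural hz hb (by rw [h5, hc])) (L.mem_true_iff_of_exc hb (by simp)) h4 h6
    rw [show 5 - 1 = 4 from rfl, h]
    cases s <;> cases t <;> cases c <;> simp_all
  · refine ⟨{v, b}, by simp, by simp [Finset.pair_comm], 
      fun j => if j < 6 then c && !(j == 5) else !c, hcard, ?_⟩
    refine Feas.pair L hz (l := 4) (by omega) (by omega)
      (by rintro rfl; exact L.notMem_P hb _ hv) ?_ (L.lt_sDeg_side hz hv _)
      (L.lt_sDeg_natural hz hb (by rw [h5, hc])) (by simpa using L.mem_true_iff hv)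
      (L.mem_true_iff_of_exc hb (by simp)) (fun j hj => h4 j (by omega)) h6
    rwa [show σ 4 = !s by cases h : σ 4 <;> cases s <;> simp_all, sAdj_not]

/-- `K` is the core of a short directed path from the side `true` to the side `false`. -/
def IsCrosser (G : Digraph V) (P Q : Bool → Finset V) (K : Finset V) (z : ℕ) : Prop :=
  ∀ Z : Finset V, Z.card ≤ z → ∃ u r, 6 ≤ r ∧ r ≤ 8 ∧
    G.PathOn P Q K Z (fun _ => true) (fun j => decide (j < 6)) u 4 r ∧ u 4 ∈ Q true ∧
    (∀ x ∈ K, ∃ j, 4 ≤ j ∧ j ≤ r ∧ u j = x) ∧ z + 12 < G.sDeg true (Q false) (u r)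

theorem IsCrosser.feasN (L : G.Layout P Q E κ D) (hz : z + 12 < D) {s : Bool}
    (h : G.IsCrosser P Q K z) (hσ : ∀ j ≤ 10, σ j = s) : G.FeasN P Q σ s (!s) K 6 z := by
  have key : ∀ σ : ℕ → Bool, (∀ j ≤ 10, σ j = true) → G.FeasN P Q σ true false K 6 z := by
    refine fun σ hσ => ⟨fun j => decide (j < 6), by decide, Feas.of_core L hz fun Z hZ => ?_⟩
    obtain ⟨u, r, h1, h2, h3, h4, h5, h6⟩ := h Z hZ
    refine ⟨u, 4, r, by omega, by omega, by omega, h3.congr (fun j _ _ => hσ j (by omega))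
      (fun _ _ _ => rfl) fun _ _ _ => rfl, h5, L.lt_sDeg_side hz (L.sub _ h4) _,
      by rwa [hσ r (by omega)], fun j hj => by simp; omega, fun j hj _ => by simp; omega⟩
  cases s
  · exact (key (fun _ => true) fun _ _ => rfl).reverse fun j hj => by rw [hσ j hj]; rfl
  · exact key σ hσ

theorem isCrosser_single [DecidableEq V] (L : G.Layout P Q E κ D) (hz : z + 12 < D) {a : V}
    (ha : a ∈ E false) : G.IsCrosser P Q {a} z := by
  intro Z hZ
  obtain ⟨u, h1, h2, h3⟩ := (PathOn.single (G := G) (Q := Q) (K := {a}) (Z := Z)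
    (σ := fun _ => true) (l := 6) (lab := fun j => decide (j < 6))
    (L.mem_true_iff_of_exc ha (by simp)) (Or.inl (by simp))).extend_left L le_rfl (l' := 4)
    (c := true) (by omega) (by omega) (by omega)
    ((Nat.add_le_add_right hZ 12).trans_lt (L.lt_sDeg_natural hz ha rfl))
    (fun j _ hj => by simp; omega)
  refine ⟨u, 6, le_rfl, by omega, h1, h3, fun x hx => ⟨6, by omega, le_rfl, ?_⟩, ?_⟩
  · rw [h2 6 le_rfl le_rfl]
    simp_all
  · rw [h2 6 le_rfl le_rfl]
    exact L.lt_sDeg_natural hz ha rfl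

theorem isCrosser_pair [DecidableEq V] (L : G.Layout P Q E κ D) (hz : z + 12 < D) {y x : V}
    (hy : y ∈ P true) (hx : x ∈ P false) (hyx : G.Adj y x) : G.IsCrosser P Q {y, x} z := by
  intro Z hZ
  have hne : y ≠ x := by
    rintro rfl
    simpa using L.eq_of_mem hx hy
  have h0 := (PathOn.single (G := G) (P := P) (Q := Q) (K := {y, x}) (Z := Z)
    (σ := fun _ => true) (l := 5) (v := y) (lab := fun j => decide (j < 6))
    (by simpa using hy) (Or.inl (by simp))).snoc le_rfl (v := x)
    (fun _ _ _ => hne) (by simpa using hyx) (by simpa using L.mem_true_iff hx)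
    (Or.inl (by simp))
  obtain ⟨u, h1, h2, h3⟩ := h0.extend_left L (by omega) (l' := 4)
    (c := true) (by omega) (by omega) (by omega)
    ((Nat.add_le_add_right hZ 12).trans_lt (L.lt_sDeg_side hz (by simpa using hy) _))
    (fun j _ hj => by simp; omega)
  refine ⟨u, 6, le_rfl, by omega, h1, h3, fun v hv => ?_, ?_⟩
  · simp only [Finset.mem_insert, Finset.mem_singleton] at hv
    rcases hv with rfl | rfl
    · exact ⟨5, by omega, by omega, by simp [h2 5]⟩
    · exact ⟨6, by omega, by omega, by simp [h2 6]⟩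
  · rw [h2 6 (by omega) le_rfl]
    exact L.lt_sDeg_side hz (by simpa using hx) _

theorem isCrosser_triple [DecidableEq V] (L : G.Layout P Q E κ D) (hz : z + 12 < D) {y b x : V}
    (hy : y ∈ P true) (hb : b ∈ E true) (hx : x ∈ P false) (hyb : G.Adj y b) (hbx : G.Adj b x) :
    G.IsCrosser P Q {y, b, x} z := by
  intro Z hZ
  have hne : y ≠ x := by
    rintro rfl
    simpa using L.eq_of_mem hx hy
  have hyb' : y ≠ b := by
    rintro rfl
    exact L.notMem_P hb _ hy
  have hbx' : b ≠ x := by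
    rintro rfl
    exact L.notMem_P hb _ hx
  have h0 := (PathOn.single (G := G) (P := P) (Q := Q) (K := {y, b, x}) (Z := Z)
    (σ := fun _ => true) (l := 5) (v := y) (lab := fun j => decide (j < 6))
    (by simpa using hy) (Or.inl (by simp))).snoc le_rfl (v := b)
    (fun _ _ _ => hyb') (by simpa using hyb) (by simp [L.notMem_P hb])
    (Or.inl (by simp))
  have h0' := h0.snoc (by omega) (v := x) (fun j h1 h2 => by
    obtain rfl | rfl : j = 5 ∨ j = 6 := by omega
    · simpa using hne
    · simpa using hbx') (by simpa using hbx) (by simpa using L.mem_true_iff hx) (Or.inl (by simp))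
  obtain ⟨u, h1, h2, h3⟩ := h0'.extend_left L (by omega) (l' := 4)
    (c := true) (by omega) (by omega) (by omega)
    ((Nat.add_le_add_right hZ 12).trans_lt (L.lt_sDeg_side hz (by simpa using hy) _))
    (fun j _ hj => by simp; omega)
  refine ⟨u, 7, by omega, by omega, h1, h3, fun v hv => ?_, ?_⟩
  · simp only [Finset.mem_insert, Finset.mem_singleton] at hv
    rcases hv with rfl | rfl | rfl
    · exact ⟨5, by omega, by omega, by simp [h2 5]⟩
    · exact ⟨6, by omega, by omega, by simp [h2 6]⟩
    · exact ⟨7, by omega, by omega, by simp [h2 7]⟩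
  · rw [h2 7 (by omega) le_rfl]
    exact L.lt_sDeg_side hz (by simpa using hx) _

/-- An excursion from the side `false` to the side `true` and back. -/
theorem IsCrosser.feasN_insert [DecidableEq V] (L : G.Layout P Q E κ D) (hz : z + 12 < D)
    {b : V} {s : Bool} (h : G.IsCrosser P Q K z) (hb : b ∈ E true) (hbK : b ∉ K)
    (hσ : ∀ j ≤ 10, σ j = s) : G.FeasN P Q σ false false (insert b K) 3 z := by
  have key : G.FeasN P Q (fun _ => true) false false (insert b K) 3 z := by
    refine ⟨fun j => decide (3 ≤ j ∧ j < 6), by decide, Feas.of_core L hz fun Z hZ => ?_⟩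
    obtain ⟨u, r, h1, h2, h3, h4, h5, h6⟩ := h Z hZ
    have h3' : G.PathOn P Q (insert b K) Z (fun _ => true)
        (fun j => decide (3 ≤ j ∧ j < 6)) u (3 + 1) r :=
      (h3.mono (Finset.subset_insert b K)).congr (fun _ _ _ => rfl)
        (fun j hj _ => by simp; omega) fun _ _ _ => rfl
    -- The crosser begins at a typical vertex `u 4` of the side `true`, which few typical vertices
    -- of that side fail to reach. A natural outneighbour `v` of `b` can therefore be placed before
    -- it, and the excursion occupies exactly the positions 3, 4, 5 on the side `true`.
    obtain ⟨N, hN1, hN2⟩ : ∃ N : Finset V, N.card ≤ 3 * κ ∧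
        ∀ y ∈ Q true, y ∉ N → G.Adj y (u 4) := by
      classical
      refine ⟨(Q true).filter fun y => ¬ G.SAdj false (u 4) y, ?_, fun y hy hy' => ?_⟩
      · have e1 := L.typical true false (u 4) h4
        have e2 := Finset.card_filter_add_card_filter_not (s := Q true)
          (fun y => G.SAdj false (u 4) y)
        simp only [sDeg] at e1
        omega
      · by_contra hcon
        exact hy' (by simp [hy, hcon])
    have hcard : (Z ∪ (N ∪ (Finset.range 12).image u)).card < G.sDeg true (Q true) b := by
      have e1 := Finset.card_union_le Z (N ∪ (Finset.range 12).image u)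
      have e2 := Finset.card_union_le N ((Finset.range 12).image u)
      have e3 : ((Finset.range 12).image u).card ≤ 12 := Finset.card_image_le.trans (by simp)
      have e4 := L.natural true true b hb
      have e5 := L.D_le
      have e6 := L.κ_le
      simp only [BEq.rfl] at e4
      omega
    obtain ⟨v, hvQ, hvZ, hv⟩ := exists_sAdj_notMem hcard
    simp only [Finset.mem_union, Finset.mem_image, Finset.mem_range, not_or, not_exists,
      not_and] at hvZ
    have h7 := h3'.cons (v := v) (fun j _ _ => hvZ.2.2 j (by omega))
      (by simpa using hN2 v hvQ hvZ.2.1) (by simpa using L.sub _ hvQ)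
      (Or.inr ⟨by simpa using hvQ, hvZ.1⟩)
    have hbu : ∀ j, 3 ≤ j → j ≤ r → Function.update u 3 v j ≠ b := fun j hj hj' => by
      rcases Nat.eq_or_lt_of_le hj with rfl | hj
      · rw [Function.update_self]
        rintro rfl
        exact L.notMem_P hb _ (L.sub _ hvQ)
      · rw [Function.update_of_ne (by omega)]
        rintro rfl
        rcases h3.mem j hj hj' with h | h
        · exact hbK h
        · exact L.notMem_P hb _ (L.sub _ h.1)
    have h8 := PathOn.cons (l := 2) (v := b) h7 hbu (by simpa using hv)
      (by simp [L.notMem_P hb]) (Or.inl (by simp))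
    refine ⟨_, 2, r, by omega, by omega, by omega, h8, fun x hx => ?_, ?_, ?_, fun j hj => ?_,
      fun j hj _ => ?_⟩
    · rcases Finset.mem_insert.1 hx with rfl | hx
      · exact ⟨2, le_rfl, by omega, by simp⟩
      · obtain ⟨j, h9, h10, rfl⟩ := h5 x hx
        exact ⟨j, by omega, h10, by
          rw [Function.update_of_ne (by omega), Function.update_of_ne (by omega)]⟩
    · rw [Function.update_self]
      exact L.lt_sDeg_natural hz hb rfl
    · rw [Function.update_of_ne (by omega), Function.update_of_ne (by omega)]
      exact h6
    · simp; omega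
    · simp; omega
  cases s
  · exact key.reverse fun j hj => by rw [hσ j hj]; rfl
  -- Two reversals replace the constant pattern by `σ`, which is known only up to position 10.
  · obtain ⟨lab, hl, hF⟩ := key.reverse (σ' := fun _ => false) fun j hj => rfl
    exact FeasN.reverse ⟨lab, hl, hF⟩ fun j hj => by rw [hσ j hj]; rfl

end

/-! ### From windows to the whole cycle -/

theorem card_notMem_range_add {κ X : Type*} [Fintype κ] [Fintype X] {s : κ → X}
    (hs : Function.Injective s) (p : X → Prop) :
    Nat.card {x // x ∉ Set.range s ∧ p x} + Nat.card {k // p (s k)} = Nat.card {x // p x} := by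
  classical
  rw [Nat.card_eq_fintype_card, Nat.card_eq_fintype_card, Nat.card_eq_fintype_card,
    Fintype.card_subtype, Fintype.card_subtype, Fintype.card_subtype,
    ← Finset.card_image_of_injective _ hs, add_comm, ← Finset.card_union_of_disjoint]
  · congr 1
    ext x
    simp only [Finset.mem_union, Finset.mem_image, Finset.mem_filter, Finset.mem_univ, true_and,
      Set.mem_range]
    constructor
    · rintro (⟨k, h, rfl⟩ | h)
      · exact h
      · exact h.2
    · intro h
      by_cases hx : ∃ k, s k = x
      · obtain ⟨k, rfl⟩ := hx
        exact Or.inl ⟨k, h, rfl⟩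
      · exact Or.inr ⟨hx, h⟩
  · rw [Finset.disjoint_left]
    rintro x hx hx'
    simp only [Finset.mem_image, Finset.mem_filter, Finset.mem_univ, true_and] at hx hx'
    obtain ⟨k, _, rfl⟩ := hx
    exact hx'.1 ⟨k, rfl⟩

/-- Compatible choice of pairwise disjoint paths for a family of windows. -/
theorem exists_disjoint_fillings {G : Digraph V} {P Q : Bool → Finset V} {ι : Type*} [Fintype ι]
    [DecidableEq ι]
    {σ : ι → ℕ → Bool} {c c' : ι → Bool} {K : ι → Finset V} {lab : ι → ℕ → Bool} {z : ℕ}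
    (hz : 24 * Fintype.card ι ≤ z) (hF : ∀ i, G.Feas P Q (σ i) (c i) (c' i) (K i) (lab i) z)
    (hK : ∀ i j, i ≠ j → Disjoint (K i) (K j)) (hK12 : ∀ i, (K i).card ≤ 12) :
    ∃ u : ι → ℕ → V, (∀ i, G.PathOn P Q (K i) ∅ (σ i) (lab i) (u i) 0 11 ∧ u i 0 ∈ Q (c i) ∧
      u i 11 ∈ Q (c' i) ∧ ∀ x ∈ K i, ∃ j ≤ 11, u i j = x) ∧
      ∀ i i' j j', j ≤ 11 → j' ≤ 11 → u i j = u i' j' → i = i' := by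
  classical
  -- The paths are chosen one by one, avoiding all prescribed vertices and all earlier paths. Each
  -- window contributes at most twelve of either kind, which explains the factor 24.
  let KA : Finset V := Finset.univ.biUnion K
  have hKA : KA.card ≤ 12 * Fintype.card ι := by
    have : KA.card ≤ Finset.univ.card * 12 :=
      Finset.card_biUnion_le_card_mul (Finset.univ : Finset ι) K 12 fun i _ => hK12 i
    rw [Finset.card_univ] at this
    omega
  have main : ∀ s : Finset ι, ∃ u : ι → ℕ → V,
      (∀ i ∈ s, G.PathOn P Q (K i) KA (σ i) (lab i) (u i) 0 11 ∧ u i 0 ∈ Q (c i) ∧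
        u i 11 ∈ Q (c' i) ∧ ∀ x ∈ K i, ∃ j ≤ 11, u i j = x) ∧
      ∀ i ∈ s, ∀ i' ∈ s, ∀ j j', j ≤ 11 → j' ≤ 11 → u i j = u i' j' → i = i' := by
    intro s
    induction s using Finset.induction_on with
    | empty =>
      by_cases hV : Nonempty V
      · exact ⟨fun _ _ => hV.some, by simp, by simp⟩
      · by_cases hι : Nonempty ι
        · obtain ⟨u, -⟩ := hF hι.some ∅ (by simp)
          exact absurd ⟨u 0⟩ hV
        · exact ⟨fun i => (hι ⟨i⟩).elim, by simp, by simp⟩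
    | insert a s ha ih =>
      obtain ⟨u, h1, h2⟩ := ih
      let U : Finset V := s.biUnion fun i => (Finset.range 12).image (u i)
      have hU : U.card ≤ 12 * Fintype.card ι := by
        have h3 := Finset.card_biUnion_le_card_mul s
          (fun i => (Finset.range 12).image (u i)) 12 fun i _ =>
            Finset.card_image_le.trans (by simp)
        have h4 := Finset.card_le_univ s
        have h5 : U.card ≤ s.card * 12 := h3
        omega
      obtain ⟨v, hv1, hv2, hv3, hv4⟩ := hF a (KA ∪ U) (by
        have := Finset.card_union_le KA U
        omega)
      have hcross : ∀ i ∈ s, ∀ j j', j ≤ 11 → j' ≤ 11 → u i j ≠ v j' := by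
        intro i hi j j' hj hj' heq
        have hne : i ≠ a := by
          rintro rfl
          exact ha hi
        have hKsub : ∀ k, ∀ x ∈ K k, x ∈ KA := fun k x hx =>
          Finset.mem_biUnion.2 ⟨k, Finset.mem_univ _, hx⟩
        rcases hv1.mem j' (Nat.zero_le _) hj' with h | h
        · rcases (h1 i hi).1.mem j (Nat.zero_le _) hj with h' | h'
          · rw [heq] at h'
            exact Finset.disjoint_left.1 (hK i a hne) h' h
          · rw [heq] at h'
            exact h'.2 (hKsub a _ h)
        · apply h.2
          rw [← heq]
          exact Finset.mem_union_right _ (Finset.mem_biUnion.2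
            ⟨i, hi, Finset.mem_image.2 ⟨j, by simp; omega, rfl⟩⟩)
      refine ⟨Function.update u a v, fun i hi => ?_, fun i hi i' hi' j j' hj hj' heq => ?_⟩
      · by_cases hia : i = a
        · subst hia
          rw [Function.update_self]
          exact ⟨⟨hv1.inj, hv1.adj, hv1.side, fun j h3 h4 => (hv1.mem j h3 h4).imp id fun h =>
            ⟨h.1, fun h' => h.2 (Finset.mem_union_left _ h')⟩⟩, hv2, hv3, hv4⟩
        · rw [Function.update_of_ne hia]
          exact h1 i ((Finset.mem_insert.1 hi).resolve_left hia)
      · by_cases hia : i = a <;> by_cases hia' : i' = a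
        · rw [hia, hia']
        · subst hia
          rw [Function.update_self, Function.update_of_ne hia'] at heq
          exact absurd heq.symm
            (hcross i' ((Finset.mem_insert.1 hi').resolve_left hia') _ _ hj' hj)
        · subst hia'
          rw [Function.update_self, Function.update_of_ne hia] at heq
          exact absurd heq (hcross i ((Finset.mem_insert.1 hi).resolve_left hia) _ _ hj hj')
        · rw [Function.update_of_ne hia, Function.update_of_ne hia'] at heq
          exact h2 i ((Finset.mem_insert.1 hi).resolve_left hia) i'
            ((Finset.mem_insert.1 hi').resolve_left hia') _ _ hj hj' heq
  obtain ⟨u, h1, h2⟩ := main Finset.univ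
  refine ⟨u, fun i => ?_, fun i i' j j' => h2 i (Finset.mem_univ _) i' (Finset.mem_univ _) j j'⟩
  obtain ⟨h3, h4⟩ := h1 i (Finset.mem_univ _)
  exact ⟨⟨h3.inj, h3.adj, h3.side, fun j h5 h6 => (h3.mem j h5 h6).imp id fun h =>
    ⟨h.1, by simp⟩⟩, h4⟩

theorem Layout.exists_nonadjacent [Fintype V] {G : Digraph V} {P Q E : Bool → Finset V} {κ D : ℕ}
    (L : G.Layout P Q E κ D) {c : Bool} {x : V} (hx : x ∈ Q c) :
    ∃ X : Finset V, X.card ≤ 6 * κ ∧ ∀ y ∈ Q c, y ∉ X → ∀ s, G.SAdj s x y := by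
  classical
  refine ⟨((Q c).filter fun y => ¬ G.SAdj true x y) ∪ (Q c).filter fun y => ¬ G.SAdj false x y,
    ?_, fun y hy hyX s => ?_⟩
  · have h1 := Finset.card_union_le ((Q c).filter fun y => ¬ G.SAdj true x y)
      ((Q c).filter fun y => ¬ G.SAdj false x y)
    have h2 := L.typical c true x hx
    have h3 := L.typical c false x hx
    have h4 := Finset.card_filter_add_card_filter_not (s := Q c) (fun y => G.SAdj true x y)
    have h5 := Finset.card_filter_add_card_filter_not (s := Q c) (fun y => G.SAdj false x y)
    simp only [sDeg] at h2 h3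
    omega
  · by_contra h
    apply hyX
    cases s
    · exact Finset.mem_union_right _ (Finset.mem_filter.2 ⟨hy, h⟩)
    · exact Finset.mem_union_left _ (Finset.mem_filter.2 ⟨hy, h⟩)

/-- The positions outside the windows are filled by an arbitrary bijection onto the unused vertices
that respects the sides, and exchanges correct the result. `hcount` says that the positions of
colour `true` outside the windows are as many as the unused vertices of `P true`; the other colour
follows since the totals agree. By `hcov` every unused vertex is typical. -/
theorem Layout.hasSignedCycle_of_windows [Fintype V] {G : Digraph V} {P Q E : Bool → Finset V}
    {κ D : ℕ} (L : G.Layout P Q E κ D) {n : ℕ} (hn : Fintype.card V = n) (w : ZMod n → Bool)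
    {ι : Type*} [Fintype ι] (q : ι → ℕ) (c c' : ι → Bool) (K : ι → Finset V) (τ : ι → ℕ) {z : ℕ}
    (hz : 24 * Fintype.card ι ≤ z) (hqn : ∀ i, q i + 13 ≤ n)
    (hsep : ∀ i j, i ≠ j → q i + 13 ≤ q j ∨ q j + 13 ≤ q i)
    (hF : ∀ i, G.FeasN P Q (fun j => w ((q i + j : ℕ) : ZMod n)) (c i) (c' i) (K i) (τ i) z)
    (hK : ∀ i j, i ≠ j → Disjoint (K i) (K j)) (hK12 : ∀ i, (K i).card ≤ 12)
    (hcov : ∀ x, (∃ c, x ∈ Q c) ∨ ∃ i, x ∈ K i) (col : ℕ → Bool)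
    (hcol : ∀ i, col (q i) = c i) (hcol' : ∀ i, col (q i + 11) = c' i)
    (hcol1 : ∀ j, j + 1 < n → (∀ i, ¬ (q i ≤ j ∧ j + 1 ≤ q i + 11)) → col j = col (j + 1))
    (hcol0 : col (n - 1) = col 0)
    (hbig : ∀ c, 24 * κ + 12 * Fintype.card ι < ((Finset.range n).filter fun j => col j = c).card)
    (hcount : ((Finset.range n).filter fun j => col j = true).card + ∑ i, τ i =
      (P true).card + ∑ i, ((Finset.range 12).filter fun j => col (q i + j) = true).card) :
    G.HasSignedCycle w := by
  classical
  have hn0 : NeZero n := ⟨by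
    rintro rfl
    simpa using hbig true⟩
  choose lab hlab hF using hF
  obtain ⟨u, hu, hu'⟩ := exists_disjoint_fillings hz hF hK hK12
  have hval : ∀ i j, j ≤ 11 → ((q i + j : ℕ) : ZMod n).val = q i + j := fun i j hj => by
    rw [ZMod.val_natCast, Nat.mod_eq_of_lt]
    have := hqn i
    omega
  let s : ι × Fin 12 → ZMod n := fun k => ((q k.1 + k.2 : ℕ) : ZMod n)
  let t : ι × Fin 12 → V := fun k => u k.1 k.2
  have hs : Function.Injective s := by
    rintro ⟨i, j⟩ ⟨i', j'⟩ h
    have h1 := congrArg ZMod.val h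
    simp only [s] at h1
    rw [hval _ _ (by omega), hval _ _ (by omega)] at h1
    have : i = i' := by
      by_contra hne
      have := hsep i i' hne
      omega
    subst this
    ext
    · rfl
    · simp; omega
  have ht : Function.Injective t := by
    rintro ⟨i, j⟩ ⟨i', j'⟩ h
    obtain rfl := hu' i i' j j' (by omega) (by omega) h
    have := (hu i).1.inj j j' (by omega) (by omega) (by omega) (by omega) h
    ext
    · rfl
    · simpa using this
  have hcardX : Nat.card {x : ZMod n // col x.val = true} =
      ((Finset.range n).filter fun j => col j = true).card := by
    rw [Nat.card_eq_fintype_card, Fintype.card_subtype]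
    refine Finset.card_bij (fun x _ => x.val) (fun x hx => ?_) (fun x _ y _ h =>
      ZMod.val_injective n h) fun j hj => ?_
    · simp only [Finset.mem_filter, Finset.mem_univ, true_and] at hx
      simp [hx, ZMod.val_lt]
    · simp only [Finset.mem_filter, Finset.mem_range] at hj
      refine ⟨(j : ZMod n), ?_, ?_⟩
      · simp [ZMod.val_natCast, Nat.mod_eq_of_lt hj.1, hj.2]
      · simp [ZMod.val_natCast, Nat.mod_eq_of_lt hj.1]
  have hfin : ∀ p : ℕ → Bool, Nat.card {j : Fin 12 // p j = true} =
      ((Finset.range 12).filter fun j => p j = true).card := fun p => by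
    rw [Nat.card_eq_fintype_card, Fintype.card_subtype, Finset.card_filter, Finset.card_filter,
      Finset.sum_range]
  have hsig : ∀ p : ι → ℕ → Bool, Nat.card {k : ι × Fin 12 // p k.1 k.2 = true} =
      ∑ i, ((Finset.range 12).filter fun j => p i j = true).card := fun p => by
    rw [Nat.card_eq_fintype_card, Fintype.card_subtype, Finset.card_filter,
      Fintype.sum_prod_type]
    refine Finset.sum_congr rfl fun i _ => ?_
    rw [Finset.card_filter, Finset.sum_range]
  have hsX : Nat.card {k : ι × Fin 12 // col (s k).val = true} =
      ∑ i, ((Finset.range 12).filter fun j => col (q i + j) = true).card := by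
    rw [← hsig fun i j => col (q i + j)]
    refine Nat.card_congr (Equiv.subtypeEquivRight fun k => ?_)
    simp only [s]
    rw [hval _ _ (by omega)]
  have hsY : Nat.card {k : ι × Fin 12 // decide (t k ∈ P true) = true} = ∑ i, τ i := by
    rw [← Finset.sum_congr rfl fun i _ => hlab i, ← hsig lab]
    refine Nat.card_congr (Equiv.subtypeEquivRight fun k => ?_)
    simp only [t, decide_eq_true_eq]
    exact (hu k.1).1.side k.2 (by omega) (by omega)
  have hcardY : Nat.card {y : V // decide (y ∈ P true) = true} = (P true).card := by
    rw [Nat.card_eq_fintype_card, Fintype.card_subtype]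
    congr 1
    ext
    simp
  have htot : Nat.card (ZMod n) = Nat.card V := by simp [hn]
  have hfreeCard : ∀ c, Nat.card {x // x ∉ Set.range s ∧ col x.val = c} =
      Nat.card {y // y ∉ Set.range t ∧ decide (y ∈ P true) = c} := by
    have e1 := card_notMem_range_add hs fun x => col x.val = true
    have e2 := card_notMem_range_add ht fun y => decide (y ∈ P true) = true
    have e3 := card_notMem_range_add hs fun x => col x.val = false
    have e4 := card_notMem_range_add ht fun y => decide (y ∈ P true) = false
    have hX := Fintype.card_subtype_compl fun x : ZMod n => col x.val = true
    have hY := Fintype.card_subtype_compl fun y : V => decide (y ∈ P true) = true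
    have hkX := Fintype.card_subtype_compl fun k => col (s k).val = true
    have hkY := Fintype.card_subtype_compl fun k => decide (t k ∈ P true) = true
    have lX := Fintype.card_subtype_le fun x : ZMod n => col x.val = true
    have lY := Fintype.card_subtype_le fun y : V => decide (y ∈ P true) = true
    have lkX := Fintype.card_subtype_le fun k => col (s k).val = true
    have lkY := Fintype.card_subtype_le fun k => decide (t k ∈ P true) = true
    simp only [Bool.not_eq_true, ← Nat.card_eq_fintype_card] at hX hY hkX hkY lX lY lkX lkY
    rintro (_ | _) <;> omega
  obtain ⟨e, he1, he2⟩ := exists_equiv_extending s t hs ht (fun x => col x.val)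
    (fun y => decide (y ∈ P true)) hfreeCard
  have hQcol : ∀ x, x ∉ Set.range s → e x ∈ Q (col x.val) := fun x hx => by
    obtain ⟨h1, h2⟩ := he2 x hx
    have h3 : ∃ c, e x ∈ Q c := by
      refine (hcov (e x)).resolve_right ?_
      rintro ⟨i, hi⟩
      obtain ⟨j, hj, hj'⟩ := (hu i).2.2.2 _ hi
      exact h1 ⟨(i, ⟨j, by omega⟩), hj'⟩
    obtain ⟨c, hc⟩ := h3
    rw [← h2, show decide (e x ∈ P true) = c by
      rw [Bool.eq_iff_iff, decide_eq_true_eq]; exact L.mem_true_iff (L.sub c hc)]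
    exact hc
  let F : Finset (ZMod n) := Finset.univ.image s
  have hmemF : ∀ x, x ∈ F ↔ x ∈ Set.range s := fun x => by simp [F]
  have hsucc : ∀ x : ZMod n, (x + 1).val = x.val + 1 ∧ x.val + 1 < n ∨
      (x + 1).val = 0 ∧ x.val + 1 = n := fun x => by
    have h1 := ZMod.val_lt x
    have h2 : (x + 1).val = (x.val + 1) % n := by
      rw [← ZMod.val_natCast, Nat.cast_add, ZMod.natCast_zmod_val, Nat.cast_one]
    rcases Nat.lt_or_ge (x.val + 1) n with h | h
    · exact Or.inl ⟨by rw [h2, Nat.mod_eq_of_lt h], h⟩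
    · have h3 : x.val + 1 = n := by omega
      exact Or.inr ⟨by rw [h2, h3, Nat.mod_self], h3⟩
  have hsmem : ∀ x i j, j ≤ 11 → x.val = q i + j → x ∈ Set.range s ∧ e x = u i j :=
    fun x i j hj hx => by
      have h1 : s (i, ⟨j, by omega⟩) = x := ZMod.val_injective n (by
        rw [hx]; exact hval i j hj)
      exact ⟨⟨_, h1⟩, by rw [← h1, he1]⟩
  have hsval : ∀ x ∈ Set.range s, ∃ i j, j ≤ 11 ∧ x.val = q i + j := by
    rintro _ ⟨⟨i, j⟩, rfl⟩
    exact ⟨i, j, by omega, hval i j (by omega)⟩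
  refine hasSignedCycle_of_arrangement w Q
    (Finset.disjoint_of_subset_left (L.sub _) (Finset.disjoint_of_subset_right (L.sub _) L.disj_P))
    (6 * κ) L.loopless (fun c x hx => L.exists_nonadjacent hx) F e ?_ ?_ ?_
  · intro x hx hx1
    obtain ⟨i, j, hj, hxv⟩ := hsval x ((hmemF x).1 hx)
    obtain ⟨i', j', hj', hxv'⟩ := hsval _ ((hmemF _).1 hx1)
    have hq := hqn i
    obtain ⟨h1, h2⟩ | ⟨h1, h2⟩ := hsucc x
    · have : i = i' := by
        by_contra hne
        have := hsep i i' hne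
        omega
      subst this
      have h3 : j' = j + 1 := by omega
      subst h3
      rw [(hsmem x i j hj hxv).2, (hsmem (x + 1) i (j + 1) hj' hxv').2]
      have h4 := (hu i).1.adj j (by omega) (by omega)
      rwa [← hxv, ZMod.natCast_zmod_val] at h4
    · omega
  · intro x hx
    have hcolx : col x.val = col (x + 1).val := by
      obtain ⟨h1, h2⟩ | ⟨h1, h2⟩ := hsucc x
      · rw [h1]
        refine hcol1 _ h2 fun i hi => ?_
        have h3 := (hsmem x i (x.val - q i) (by omega) (by omega)).1
        have h4 := (hsmem (x + 1) i (x.val + 1 - q i) (by omega) (by omega)).1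
        rw [hmemF, hmemF] at hx
        exact hx.elim (fun h => h h3) fun h => h h4
      · rw [h1, ← hcol0]
        congr 1
        omega
    refine ⟨col x.val, ?_, ?_⟩
    · by_cases hxF : x ∈ Set.range s
      · obtain ⟨i, j, hj, hxv⟩ := hsval x hxF
        have hx1 : x + 1 ∉ Set.range s := by
          rw [hmemF, hmemF] at hx
          exact hx.resolve_left fun h => h hxF
        have hj11 : j = 11 := by
          by_contra hne
          have := hqn i
          obtain ⟨h1, h2⟩ | ⟨h1, h2⟩ := hsucc x
          · exact hx1 (hsmem _ i (j + 1) (by omega) (by omega)).1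
          · omega
        subst hj11
        rw [(hsmem x i 11 hj hxv).2, hxv, hcol' i]
        exact (hu i).2.2.1
      · exact hQcol x hxF
    · rw [hcolx]
      by_cases hxF : x + 1 ∈ Set.range s
      · obtain ⟨i, j, hj, hxv⟩ := hsval _ hxF
        have hx1 : x ∉ Set.range s := by
          rw [hmemF, hmemF] at hx
          exact hx.resolve_right fun h => h hxF
        have hj0 : j = 0 := by
          by_contra hne
          obtain ⟨h1, h2⟩ | ⟨h1, h2⟩ := hsucc x
          · exact hx1 (hsmem _ i (j - 1) (by omega) (by omega)).1
          · omega
        subst hj0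
        rw [(hsmem _ i 0 hj hxv).2, hxv, Nat.add_zero, hcol i]
        exact (hu i).2.1
      · exact hQcol _ hxF
  -- The exchanges require more than `4 * (6 * κ)` free positions on each side, and each window
  -- occupies twelve.
  · intro c
    let Y : Finset (ZMod n) := (((Finset.range n).filter fun j => col j = c).image
      fun j : ℕ => (j : ZMod n)) \ F
    refine ⟨Y, ?_, fun x hx => ?_⟩
    · have h1 : F.card ≤ 12 * Fintype.card ι :=
        Finset.card_image_le.trans (by simp [mul_comm])
      have h2 : (((Finset.range n).filter fun j => col j = c).image
          fun j : ℕ => (j : ZMod n)).card = ((Finset.range n).filter fun j => col j = c).card := by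
        refine Finset.card_image_of_injOn fun a ha b hb h => ?_
        have := congrArg ZMod.val h
        simp only [Finset.coe_filter, Finset.mem_range, Set.mem_ofPred_eq] at ha hb
        rwa [ZMod.val_natCast, ZMod.val_natCast, Nat.mod_eq_of_lt ha.1, Nat.mod_eq_of_lt hb.1]
          at this
      have h3 := Finset.le_card_sdiff F (((Finset.range n).filter fun j => col j = c).image
          fun j : ℕ => (j : ZMod n))
      have h4 := hbig c
      have h5 : Y.card = ((((Finset.range n).filter fun j => col j = c).image
          fun j : ℕ => (j : ZMod n)) \ F).card := rfl
      omega
    · simp only [Y, Finset.mem_sdiff, Finset.mem_image, Finset.mem_filter, Finset.mem_range] at hx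
      obtain ⟨⟨j, ⟨hj, hjc⟩, rfl⟩, hxF⟩ := hx
      refine ⟨hxF, ?_⟩
      have := hQcol _ fun h => hxF ((hmemF _).2 h)
      rwa [ZMod.val_natCast, Nat.mod_eq_of_lt hj, hjc] at this

/-- Choice of pairwise separated windows from large sets of candidates. -/
theorem exists_separated_windows {ι : Type*} [Fintype ι] [DecidableEq ι] (Cand : ι → Finset ℕ)
    (h : ∀ i, 25 * Fintype.card ι ≤ (Cand i).card) :
    ∃ q : ι → ℕ, (∀ i, q i ∈ Cand i) ∧ ∀ i j, i ≠ j → q i + 13 ≤ q j ∨ q j + 13 ≤ q i := by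
  have main : ∀ s : Finset ι, ∃ q : ι → ℕ, (∀ i ∈ s, q i ∈ Cand i) ∧
      ∀ i ∈ s, ∀ j ∈ s, i ≠ j → q i + 13 ≤ q j ∨ q j + 13 ≤ q i := by
    intro s
    induction s using Finset.induction_on with
    | empty => exact ⟨fun _ => 0, by simp, by simp⟩
    | insert a s ha ih =>
      obtain ⟨q, h1, h2⟩ := ih
      -- A chosen window excludes at most 25 starting points, those at distance at most twelve from
      -- its own.
      let U : Finset ℕ := s.biUnion fun i => Finset.Ico (q i - 12) (q i + 13)
      have hU : U.card ≤ s.card * 25 := Finset.card_biUnion_le_card_mul _ _ _ fun i _ => by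
        rw [Nat.card_Ico]
        omega
      have hs : s.card < Fintype.card ι := by
        have := Finset.card_le_univ (insert a s)
        rw [Finset.card_insert_of_notMem ha] at this
        omega
      obtain ⟨v, hv, hvU⟩ := Finset.exists_mem_notMem_of_card_lt_card
        (show U.card < (Cand a).card by have := h a; omega)
      have hfar : ∀ i ∈ s, q i + 13 ≤ v ∨ v + 13 ≤ q i := fun i hi => by
        by_contra hcon
        refine hvU (Finset.mem_biUnion.2 ⟨i, hi, ?_⟩)
        rw [Finset.mem_Ico]
        omega
      refine ⟨Function.update q a v, fun i hi => ?_, fun i hi j hj hij => ?_⟩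
      · by_cases hia : i = a
        · subst hia
          rwa [Function.update_self]
        · rw [Function.update_of_ne hia]
          exact h1 i ((Finset.mem_insert.1 hi).resolve_left hia)
      · by_cases hia : i = a
        · subst hia
          rw [Function.update_self, Function.update_of_ne (Ne.symm hij)]
          exact (hfar j ((Finset.mem_insert.1 hj).resolve_left (Ne.symm hij))).symm
        · by_cases hja : j = a
          · subst hja
            rw [Function.update_self, Function.update_of_ne hia]
            exact hfar i ((Finset.mem_insert.1 hi).resolve_left hia)
          · rw [Function.update_of_ne hia, Function.update_of_ne hja]
            exact h2 i ((Finset.mem_insert.1 hi).resolve_left hia) j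
              ((Finset.mem_insert.1 hj).resolve_left hja) hij
  obtain ⟨q, h1, h2⟩ := main Finset.univ
  exact ⟨q, fun i => h1 i (Finset.mem_univ _), fun i j => h2 i (Finset.mem_univ _) j
    (Finset.mem_univ _)⟩

/-- Embedding with two large arcs: the positions `20, …, 19 + m` form the arc of the side `true`. -/
theorem Layout.hasSignedCycle_of_arcs [Fintype V] {G : Digraph V} {P Q E : Bool → Finset V}
    {κ D : ℕ} (L : G.Layout P Q E κ D) {n : ℕ} (hn : Fintype.card V = n) (w : ZMod n → Bool)
    (m : ℕ) {ι : Type*} [Fintype ι] (side : ι → Bool) (K : ι → Finset V) (τ : ι → ℕ) {z : ℕ}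
    (Cand : ι → Finset ℕ) (hz : 24 * (Fintype.card ι + 2) ≤ z)
    (hCand : ∀ i, 25 * Fintype.card ι ≤ (Cand i).card)
    (hF : ∀ i, ∀ q ∈ Cand i, (side i = true → 27 ≤ q ∧ q + 13 ≤ 14 + m) ∧
      (side i = false → 27 + m ≤ q ∧ q + 13 ≤ n) ∧
      G.FeasN P Q (fun j => w ((q + j : ℕ) : ZMod n)) (side i) (side i) (K i) (τ i) z)
    (K₁ K₂ : Finset V) (τ₁ τ₂ : ℕ)
    (hF₁ : G.FeasN P Q (fun j => w ((14 + j : ℕ) : ZMod n)) false true K₁ τ₁ z)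
    (hF₂ : G.FeasN P Q (fun j => w ((14 + m + j : ℕ) : ZMod n)) true false K₂ τ₂ z)
    (hK : ∀ i j, i ≠ j → Disjoint (K i) (K j)) (hK₁ : ∀ i, Disjoint (K i) K₁)
    (hK₂ : ∀ i, Disjoint (K i) K₂) (hK₁₂ : Disjoint K₁ K₂)
    (hK12 : ∀ i, (K i).card ≤ 12) (hK₁12 : K₁.card ≤ 12) (hK₂12 : K₂.card ≤ 12)
    (hcov : ∀ x, (∃ c, x ∈ Q c) ∨ x ∈ K₁ ∨ x ∈ K₂ ∨ ∃ i, x ∈ K i)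
    (hm : 24 * κ + 12 * (Fintype.card ι + 2) + 27 < m)
    (hmn : m + 24 * κ + 12 * (Fintype.card ι + 2) + 27 < n)
    (hcount : m + ∑ i, τ i + τ₁ + τ₂ = (P true).card + ∑ i, (if side i then 12 else 0) + 12) :
    G.HasSignedCycle w := by
  classical
  obtain ⟨q, hq, hsep⟩ := exists_separated_windows Cand hCand
  have hq' := fun i => hF i (q i) (hq i)
  have hT : ∀ i, side i = true → 27 ≤ q i ∧ q i + 13 ≤ 14 + m := fun i => (hq' i).1
  have hS : ∀ i, side i = false → 27 + m ≤ q i ∧ q i + 13 ≤ n := fun i => (hq' i).2.1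
  have hpos : ∀ i, 27 ≤ q i ∧ q i + 13 ≤ n ∧ (q i + 13 ≤ 14 + m ∨ 27 + m ≤ q i) := fun i => by
    cases h : side i
    · have := hS i h
      omega
    · have := hT i h
      omega
  -- The crossing windows start at `14` and `14 + m`, so the side changes exactly in their middle.
  -- Each contains six positions of colour `true`, which together make the 12 in `hcount`.
  let col : ℕ → Bool := fun j => decide (20 ≤ j ∧ j < 20 + m)
  have hcolT : ∀ j, 20 ≤ j → j < 20 + m → col j = true := fun j h1 h2 => by simp [col, h1, h2]
  have hcolS : ∀ j, (j < 20 ∨ 20 + m ≤ j) → col j = false := fun j h => by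
    simp [col]
    omega
  have hcount12 : ∀ r : ℕ, ∀ k : ℕ, (∀ j < 12, (col (r + j) = true ↔ (k ≤ j))) →
      ((Finset.range 12).filter fun j => col (r + j) = true).card = 12 - k := by
    intro r k h
    rw [Finset.filter_congr (q := fun j => k ≤ j) fun j hj => h j (Finset.mem_range.1 hj),
      show (Finset.range 12).filter (fun j => k ≤ j) = Finset.Ico k 12 by
        ext; simp; omega, Nat.card_Ico]
  have hcard2 : Fintype.card (Option (Option ι)) = Fintype.card ι + 2 := by
    simp
  refine L.hasSignedCycle_of_windows hn w
    (fun o : Option (Option ι) => o.elim 14 fun o => o.elim (14 + m) q)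
    (fun o => o.elim false fun o => o.elim true side)
    (fun o => o.elim true fun o => o.elim false side)
    (fun o => o.elim K₁ fun o => o.elim K₂ K)
    (fun o => o.elim τ₁ fun o => o.elim τ₂ τ) (z := z) (by rwa [hcard2]) ?_ ?_ ?_ ?_ ?_ ?_ col
    ?_ ?_ ?_ ?_ ?_ ?_
  · rintro (_ | _ | i)
    · simp; omega
    · simp; omega
    · exact (hpos i).2.1
  · rintro (_ | _ | i) (_ | _ | j) hij
    · exact absurd rfl hij
    · simp; omega
    · have := hpos j
      simp; omega
    · simp; omega
    · exact absurd rfl hij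
    · have := hpos j
      simp; omega
    · have := hpos i
      simp; omega
    · have := hpos i
      simp; omega
    · exact hsep i j fun h => hij (by rw [h])
  · rintro (_ | _ | i)
    · exact hF₁
    · exact hF₂
    · exact (hq' i).2.2
  · rintro (_ | _ | i) (_ | _ | j) hij
    · exact absurd rfl hij
    · exact hK₁₂
    · exact (hK₁ j).symm
    · exact hK₁₂.symm
    · exact absurd rfl hij
    · exact (hK₂ j).symm
    · exact hK₁ i
    · exact hK₂ i
    · exact hK i j fun h => hij (by rw [h])
  · rintro (_ | _ | i)
    · exact hK₁12
    · exact hK₂12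
    · exact hK12 i
  · intro x
    rcases hcov x with h | h | h | ⟨i, h⟩
    · exact Or.inl h
    · exact Or.inr ⟨none, h⟩
    · exact Or.inr ⟨some none, h⟩
    · exact Or.inr ⟨some (some i), h⟩
  · rintro (_ | _ | i)
    · exact hcolS _ (Or.inl (by simp))
    · exact hcolT _ (by simp; omega) (by simp)
    · change col (q i) = side i
      cases h : side i
      · exact hcolS _ (Or.inr (by have := hS i h; omega))
      · exact hcolT _ (by have := hT i h; omega) (by have := hT i h; omega)
  · rintro (_ | _ | i)
    · exact hcolT _ (by simp) (by simp; omega)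
    · exact hcolS _ (Or.inr (by simp; omega))
    · change col (q i + 11) = side i
      cases h : side i
      · exact hcolS _ (Or.inr (by have := hS i h; omega))
      · exact hcolT _ (by have := hT i h; omega) (by have := hT i h; omega)
  · intro j hj hwin
    have h1 := hwin none
    have h2 := hwin (some none)
    simp only [Option.elim_none, Option.elim_some] at h1 h2
    simp only [col, decide_eq_decide]
    omega
  · rw [hcolS _ (Or.inr (by omega)), hcolS _ (Or.inl (by omega))]
  · rintro (_ | _)
    · have : Finset.Ico (20 + m) n ∪ Finset.range 20 ⊆
          (Finset.range n).filter fun j => col j = false := fun j hj => by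
        simp only [Finset.mem_union, Finset.mem_Ico, Finset.mem_range] at hj
        exact Finset.mem_filter.2 ⟨Finset.mem_range.2 (by omega), hcolS _ (by omega)⟩
      have h1 := Finset.card_le_card this
      rw [Finset.card_union_of_disjoint (by
        rw [Finset.disjoint_left]
        intro j h1 h2
        simp only [Finset.mem_Ico, Finset.mem_range] at h1 h2
        omega), Nat.card_Ico, Finset.card_range] at h1
      rw [hcard2]
      omega
    · have : Finset.Ico 20 (20 + m) ⊆
          (Finset.range n).filter fun j => col j = true := fun j hj => by
        simp only [Finset.mem_Ico] at hj
        exact Finset.mem_filter.2 ⟨Finset.mem_range.2 (by omega), hcolT _ hj.1 hj.2⟩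
      have h1 := Finset.card_le_card this
      rw [Nat.card_Ico] at h1
      rw [hcard2]
      omega
  · have e1 : ((Finset.range n).filter fun j => col j = true) = Finset.Ico 20 (20 + m) := by
      ext j
      simp only [col, Finset.mem_filter, Finset.mem_range, decide_eq_true_eq, Finset.mem_Ico]
      omega
    rw [e1, Nat.card_Ico, Fintype.sum_option, Fintype.sum_option, Fintype.sum_option,
      Fintype.sum_option]
    simp only [Option.elim_none, Option.elim_some]
    have e2 := hcount12 14 6 fun j hj => by simp only [col, decide_eq_true_eq]; omega
    have e3 : ((Finset.range 12).filter fun j => col (14 + m + j) = true).card = 6 := by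
      rw [Finset.filter_congr (q := fun j => j < 6) fun j hj => by
        simp only [col, decide_eq_true_eq]; omega]
      decide
    have e4 : ∀ i, ((Finset.range 12).filter fun j => col (q i + j) = true).card =
        if side i then 12 else 0 := fun i => by
      cases h : side i
      · exact hcount12 _ 12 fun j hj => by
          have := hS i h
          simp only [col, decide_eq_true_eq]
          omega
      · exact hcount12 _ 0 fun j hj => by
          have := hT i h
          simp only [col, decide_eq_true_eq]
          omega
    have key : 20 + m - 20 + (τ₁ + (τ₂ + ∑ i, τ i)) = (P true).card +
        (((Finset.range 12).filter fun j => col (14 + j) = true).card +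
          (((Finset.range 12).filter fun j => col (14 + m + j) = true).card +
            ∑ i, ((Finset.range 12).filter fun j => col (q i + j) = true).card)) := by
      rw [e2, e3, Finset.sum_congr rfl fun i _ => e4 i]
      omega
    exact key

theorem Layout.card_bad_le [Fintype V] [DecidableEq V] {G : Digraph V} {P Q E : Bool → Finset V}
    {κ D : ℕ} (L : G.Layout P Q E κ D) :
    (Finset.univ.filter fun x => x ∉ Q false ∧ x ∉ Q true).card ≤ 3 * κ := by
  have hsub : (Finset.univ.filter fun x => x ∉ Q false ∧ x ∉ Q true) ⊆
      ((P false \ Q false) ∪ (P true \ Q true)) ∪ (E false ∪ E true) := by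
    intro x hx
    simp only [Finset.mem_filter, Finset.mem_univ, true_and] at hx
    simp only [Finset.mem_union, Finset.mem_sdiff]
    rcases L.cover x with ⟨c, hc⟩ | ⟨t, ht⟩
    · cases c
      · exact Or.inl (Or.inl ⟨hc, hx.1⟩)
      · exact Or.inl (Or.inr ⟨hc, hx.2⟩)
    · cases t
      · exact Or.inr (Or.inl ht)
      · exact Or.inr (Or.inr ht)
  have h0 := Finset.card_le_card hsub
  have h1 := Finset.card_union_le ((P false \ Q false) ∪ (P true \ Q true)) (E false ∪ E true)
  have h2 := Finset.card_union_le (P false \ Q false) (P true \ Q true)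
  have h3 := Finset.card_union_le (E false) (E true)
  have h4 := Finset.card_sdiff_of_subset (L.sub false)
  have h5 := Finset.card_sdiff_of_subset (L.sub true)
  have h6 := L.bad false
  have h7 := L.bad true
  have h8 := L.exc
  omega

theorem Layout.card_eq [Fintype V] {G : Digraph V} {P Q E : Bool → Finset V} {κ D : ℕ}
    (L : G.Layout P Q E κ D) : Fintype.card V =
      (P false).card + (P true).card + ((E false).card + (E true).card) := by
  classical
  rw [← Finset.card_univ, ← Finset.card_union_of_disjoint L.disj_P,
    ← Finset.card_union_of_disjoint L.disj_E, ← Finset.card_union_of_disjoint]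
  · congr 1
    ext x
    simp only [Finset.mem_univ, Finset.mem_union, true_iff]
    rcases L.cover x with ⟨c, hc⟩ | ⟨t, ht⟩
    · cases c
      · exact Or.inl (Or.inl hc)
      · exact Or.inl (Or.inr hc)
    · cases t
      · exact Or.inr (Or.inl ht)
      · exact Or.inr (Or.inr ht)
  · simp only [Finset.disjoint_union_left, Finset.disjoint_union_right]
    exact ⟨⟨L.disj_PE _ _, L.disj_PE _ _⟩, L.disj_PE _ _, L.disj_PE _ _⟩

/-! ### Sign changes of the pattern -/

/-- The number of `j` in `[x, y)` such that the sign changes to `s` after position `j`. -/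
def turns (W : ℕ → Bool) (s : Bool) (x y : ℕ) : ℕ :=
  ((Finset.Ico x y).filter fun j => W j = (!s) ∧ W (j + 1) = s).card

section turns

variable {W : ℕ → Bool} {s : Bool} {x y v : ℕ}

theorem turns_mono {x' y' : ℕ} (h1 : x' ≤ x) (h2 : y ≤ y') : turns W s x y ≤ turns W s x' y' :=
  Finset.card_le_card (Finset.filter_subset_filter _ (Finset.Ico_subset_Ico h1 h2))

theorem turns_add (h1 : x ≤ y) (h2 : y ≤ v) : turns W s x y + turns W s y v = turns W s x v := by
  unfold turns
  rw [← Finset.card_union_of_disjoint (Finset.disjoint_filter_filter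
    (Finset.Ico_disjoint_Ico_consecutive x y v)), ← Finset.filter_union,
    Finset.Ico_union_Ico_eq_Ico h1 h2]

theorem turns_le : turns W s x y ≤ y - x :=
  (Finset.card_filter_le _ _).trans (by rw [Nat.card_Ico])

theorem turns_succ (h : x ≤ y) : turns W s x (y + 1) =
    turns W s x y + if W y = (!s) ∧ W (y + 1) = s then 1 else 0 := by
  rw [← turns_add h (Nat.le_succ y)]
  congr 1
  unfold turns
  rw [Nat.Ico_succ_singleton, Finset.filter_singleton]
  split <;> simp

/-- Changes to `true` and changes to `false` alternate, so their numbers differ only through the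
signs at the two ends. -/
theorem turns_true_add (h : x ≤ y) : turns W true x y + (if W x then 1 else 0) =
    turns W false x y + if W y then 1 else 0 := by
  induction y, h using Nat.le_induction with
  | base => simp [turns]
  | succ y h ih =>
    rw [turns_succ h, turns_succ h]
    cases h1 : W y <;> cases h2 : W (y + 1) <;> simp [h1] at ih ⊢ <;> omega

theorem turns_le_turns (h : x ≤ y) (s s' : Bool) : turns W s x y ≤ turns W s' x y + 1 := by
  have := turns_true_add (W := W) h
  cases s <;> cases s' <;> split at this <;> split at this <;> omega

theorem turns_period {n : ℕ} (hW : ∀ j, W (j + n) = W j) (x : ℕ) :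
    turns W s x (x + n) = turns W s 0 n := by
  have hp : Function.Periodic (fun j => W j = (!s) ∧ W (j + 1) = s) n := fun j => by
    simp only [hW, add_right_comm j n 1]
  unfold turns
  rw [Nat.filter_Ico_card_eq_of_periodic _ _ _ hp]
  have := Nat.filter_Ico_card_eq_of_periodic 0 _ _ hp
  rw [zero_add] at this
  exact this.symm

end turns

/-! ### Embeddings for patterns with many sign changes -/

/-- Embedding when the exceptional vertices are placed at positions where the sign changes. -/
theorem Layout.hasSignedCycle_of_turns [Fintype V] [DecidableEq V] {G : Digraph V}
    {P Q E : Bool → Finset V}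
    {κ D : ℕ} (L : G.Layout P Q E κ D) {n : ℕ} (hn : Fintype.card V = n) (w : ZMod n → Bool)
    (m : ℕ) (K₁ K₂ : Finset V) (τ₁ τ₂ : ℕ)
    (hF₁ : G.FeasN P Q (fun j => w ((14 + j : ℕ) : ZMod n)) false true K₁ τ₁ (100 * κ))
    (hF₂ : G.FeasN P Q (fun j => w ((14 + m + j : ℕ) : ZMod n)) true false K₂ τ₂ (100 * κ))
    (hK₁₂ : Disjoint K₁ K₂) (hK₁12 : K₁.card ≤ 12) (hK₂12 : K₂.card ≤ 12) (Y : Finset V)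
    (hY : ∀ x ∈ Y, (∃ t, x ∈ E t) ∧ x ∉ K₁ ∧ x ∉ K₂)
    (hT : Y.Nonempty → ∀ s, 75 * κ ≤ turns (fun j => w (j : ZMod n)) s 32 (m + 7))
    (hS : (∃ t, ∃ x ∈ E t, x ∉ K₁ ∧ x ∉ K₂ ∧ x ∉ Y) →
      ∀ s, 75 * κ ≤ turns (fun j => w (j : ZMod n)) s (32 + m) (n - 7))
    (hm : n ≤ 3 * m) (hmn : 3 * m ≤ 2 * n)
    (hcount : m + τ₁ + τ₂ = (P true).card + Y.card + 12) : G.HasSignedCycle w := by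
  have hκ := L.large
  have hκD := L.κ_le
  have hDn := L.D_le
  rw [hn] at hDn
  have hz : 100 * κ + 12 < D := by omega
  -- Every vertex that is neither typical nor used by a crossing gets a window of its own: an
  -- atypical vertex on its own side, an exceptional vertex of `Y` on the side `true`, any other
  -- exceptional vertex on the side `false`.
  let B := Finset.univ.filter fun x => (x ∉ Q false ∧ x ∉ Q true) ∧ x ∉ K₁ ∧ x ∉ K₂
  have hB : B.card ≤ 3 * κ := (Finset.card_le_card fun x hx => by
    simp only [B, Finset.mem_filter, Finset.mem_univ, true_and] at hx ⊢
    exact hx.1).trans L.card_bad_le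
  have hYB : Y ⊆ B := fun x hx => by
    obtain ⟨⟨t, ht⟩, h⟩ := hY x hx
    simp only [B, Finset.mem_filter, Finset.mem_univ, true_and]
    exact ⟨⟨fun h' => L.notMem_P ht _ (L.sub _ h'), fun h' => L.notMem_P ht _ (L.sub _ h')⟩, h⟩
  have hYP : ∀ x ∈ Y, ∀ c, x ∉ P c := fun x hx c => by
    obtain ⟨⟨t, ht⟩, -⟩ := hY x hx
    exact L.notMem_P ht c
  let side : B → Bool := fun x => decide (x.1 ∈ P true ∨ x.1 ∈ Y)
  let win : Bool → Finset ℕ := fun c =>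
    if c then Finset.Ico 27 (m + 2) else Finset.Ico (27 + m) (n - 12)
  let turn : ℕ → Bool → Prop := fun q s =>
    w ((q + 5 : ℕ) : ZMod n) = (!s) ∧ w ((q + 6 : ℕ) : ZMod n) = s
  have hturn : ∀ c s, (turns (fun j => w (j : ZMod n)) s (if c then 32 else 32 + m)
      (if c then m + 7 else n - 7)) ≤ ((win c).filter fun q => turn q s).card := by
    intro c s
    refine Finset.card_le_card_of_injOn (fun j => j - 5) (fun j hj => ?_) fun j hj j' hj' h => ?_
    · simp only [Finset.coe_filter, Finset.mem_Ico, Set.mem_ofPred_eq] at hj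
      have h5 : 5 ≤ j := by cases c <;> simp at hj <;> omega
      simp only [Finset.coe_filter, Set.mem_ofPred_eq, turn, win]
      rw [show j - 5 + 5 = j by omega, show j - 5 + 6 = j + 1 by omega]
      refine ⟨?_, hj.2⟩
      cases c <;> simp at hj ⊢ <;> omega
    · simp only [Finset.coe_filter, Finset.mem_Ico, Set.mem_ofPred_eq] at hj hj'
      cases c <;> simp at hj hj' h <;> omega
  have hexc : ∀ x : B, (∃ c, x.1 ∈ P c) ∨ ∃ t, x.1 ∈ E t := fun x => L.cover x.1
  -- For `x` in `E t` the sign after the turn is chosen as `side x == t`, which makes `side x` the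
  -- natural side of both edges at `x`.
  refine L.hasSignedCycle_of_arcs hn w m (ι := B) side (fun x => {x.1})
    (fun x => if x.1 ∈ P true then 12 else if x.1 ∈ Y then 11 else 0) (z := 100 * κ)
    (fun x => if ∃ c, x.1 ∈ P c then win (side x)
      else (win (side x)).filter fun q => turn q (side x == decide (x.1 ∈ E true)))
    ?_ ?_ ?_ K₁ K₂ τ₁ τ₂ hF₁ hF₂ ?_ ?_ ?_ hK₁₂ ?_ hK₁12 hK₂12 ?_ ?_ ?_ ?_
  · rw [Fintype.card_coe]
    omega
  · intro x
    rw [Fintype.card_coe]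
    have hwin : 75 * κ ≤ (win (side x)).card := by
      cases h : side x
      · simp only [win, Bool.false_eq_true, if_false, Nat.card_Ico]
        omega
      · simp only [win, if_true, Nat.card_Ico]
        omega
    split_ifs with hc
    · omega
    · obtain ⟨t, ht⟩ := (hexc x).resolve_left hc
      have hxB := x.2
      simp only [B, Finset.mem_filter, Finset.mem_univ, true_and] at hxB
      refine le_trans ?_ (hturn _ _)
      by_cases hxY : x.1 ∈ Y
      · have : side x = true := by simp [side, hxY]
        simp only [this, if_true]
        have := hT ⟨_, hxY⟩ (true == decide (x.1 ∈ E true))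
        omega
      · have : side x = false := by
          simp only [side, hxY, or_false, decide_eq_false_iff_not]
          exact L.notMem_P ht _
        simp only [this, Bool.false_eq_true, if_false]
        have := hS ⟨t, x, ht, hxB.2.1, hxB.2.2, hxY⟩ (false == decide (x.1 ∈ E true))
        omega
  · intro x q hq
    have hqw : q ∈ win (side x) := by
      split_ifs at hq with hc
      · exact hq
      · exact Finset.mem_of_mem_filter _ hq
    refine ⟨fun h => ?_, fun h => ?_, ?_⟩
    · simp only [win, h, if_true, Finset.mem_Ico] at hqw
      omega
    · simp only [win, h, Bool.false_eq_true, if_false, Finset.mem_Ico] at hqw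
      omega
    · split_ifs at hq with hc
      · obtain ⟨c, hc⟩ := hc
        have hs : side x = c := by
          have hxY : x.1 ∉ Y := fun h => hYP _ h _ hc
          simp only [side, hxY, or_false]
          rw [Bool.eq_iff_iff, decide_eq_true_eq]
          exact L.mem_true_iff hc
        rw [hs]
        have := feasN_side L hz hc (fun j => w ((q + j : ℕ) : ZMod n))
        have hxY : x.1 ∉ Y := fun h => hYP _ h _ hc
        simp only [L.mem_true_iff hc, hxY, if_false]
        exact this
      · obtain ⟨t, ht⟩ := (hexc x).resolve_left hc
        have htd : decide (x.1 ∈ E true) = t := by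
          cases t
          · simpa using fun h => Finset.disjoint_left.1 L.disj_E ht h
          · simpa using ht
        obtain ⟨-, h5, h6⟩ := Finset.mem_filter.1 hq
        rw [htd] at h5 h6
        have := feasN_turn L hz ht (σ := fun j => w ((q + j : ℕ) : ZMod n)) (c := side x)
          (by simp only [h5, h6]) (by rw [h6]; cases side x <;> cases t <;> rfl)
        have hnP := L.notMem_P ht true
        simp only [hnP, if_false]
        convert this using 2
        simp [side, hnP]
  · intro x y hxy
    rw [Finset.disjoint_singleton]
    exact fun h => hxy (Subtype.ext h)
  · intro x
    have := x.2
    simp only [B, Finset.mem_filter, Finset.mem_univ, true_and] at this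
    rw [Finset.disjoint_singleton_left]
    exact this.2.1
  · intro x
    have := x.2
    simp only [B, Finset.mem_filter, Finset.mem_univ, true_and] at this
    rw [Finset.disjoint_singleton_left]
    exact this.2.2
  · intro x
    simp
  · intro x
    by_cases h1 : x ∈ K₁
    · exact Or.inr (Or.inl h1)
    by_cases h2 : x ∈ K₂
    · exact Or.inr (Or.inr (Or.inl h2))
    by_cases h3 : ∃ c, x ∈ Q c
    · exact Or.inl h3
    · refine Or.inr (Or.inr (Or.inr ⟨⟨x, ?_⟩, by simp⟩))
      simp only [B, Finset.mem_filter, Finset.mem_univ, true_and]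
      push Not at h3
      exact ⟨⟨h3 _, h3 _⟩, h1, h2⟩
  · rw [Fintype.card_coe]
    omega
  · rw [Fintype.card_coe]
    omega
  · have hsum : ∑ x : B, (if x.1 ∈ P true then 12 else if x.1 ∈ Y then 11 else 0) + Y.card =
        ∑ x : B, (if side x then 12 else 0) := by
      have h1 : Y.card = ∑ x : B, if x.1 ∈ Y then 1 else 0 := by
        rw [Finset.sum_coe_sort B fun x => if x ∈ Y then 1 else 0, ← Finset.card_filter,
          Finset.filter_mem_eq_inter, Finset.inter_eq_right.2 hYB]
      rw [h1, ← Finset.sum_add_distrib]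
      refine Finset.sum_congr rfl fun x _ => ?_
      simp only [side]
      by_cases hP : x.1 ∈ P true
      · have : x.1 ∉ Y := fun h => hYP _ h _ hP
        simp [hP, this]
      · by_cases hxY : x.1 ∈ Y <;> simp [hP, hxY]
    omega

section turns

variable {W : ℕ → Bool} {s : Bool}

theorem turns_shift (r x y : ℕ) :
    turns (fun j => W (j + r)) s x y = turns W s (x + r) (y + r) := by
  unfold turns
  rw [← Finset.map_add_right_Ico, Finset.filter_map, Finset.card_map]
  congr 1
  refine Finset.filter_congr fun j _ => ?_
  simp [add_right_comm j r 1]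

theorem turns_add_period {n : ℕ} (hW : ∀ j, W (j + n) = W j) (x y : ℕ) :
    turns W s (x + n) (y + n) = turns W s x y := by
  rw [← turns_shift]
  simp only [hW]

/-- There is a pair of positions with opposite signs, at nearly half the length of the cycle, such
that the signs change often on both arcs between them. -/
theorem exists_balanced_gap {n m κ : ℕ} (hW : ∀ j, W (j + n) = W j) (hκ : 1 ≤ κ)
    (hσ : 400 * κ ≤ turns W true 0 n) (h1 : n ≤ 2 * m + 10 * κ) (h2 : 2 * m ≤ n + 10 * κ)
    (hn : 100 * κ ≤ n) (ε : Bool) :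
    ∃ r d, (d = m ∨ d = m + 1 ∨ d = n - m ∨ d = n - m - 1) ∧ d ≤ n ∧ W r = ε ∧
      W (r + d) = (!ε) ∧
      99 * κ ≤ turns W true r (r + d) ∧ 99 * κ ≤ turns W true (r + d) (r + n) := by
  set T := turns W true 0 n with hT
  have hper : ∀ x, turns W true x (x + n) = T := turns_period hW
  -- a pair of opposite signs with rich arcs suffices
  have key : ∀ g d, (d = m ∨ d = m + 1) → W g ≠ W (g + d) → 99 * κ ≤ turns W true g (g + d) →
      99 * κ ≤ turns W true (g + d) (g + n) → ∃ r d, (d = m ∨ d = m + 1 ∨ d = n - m ∨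
      d = n - m - 1) ∧ d ≤ n ∧ W r = ε ∧ W (r + d) = (!ε) ∧
      99 * κ ≤ turns W true r (r + d) ∧ 99 * κ ≤ turns W true (r + d) (r + n) := by
    intro g d hd hne ha hb
    by_cases hg : W g = ε
    · refine ⟨g, d, by omega, by omega, hg, ?_, ha, hb⟩
      cases h : W (g + d) <;> cases ε <;> simp_all
    · refine ⟨g + d, n - d, by omega, by omega, ?_, ?_, ?_, ?_⟩
      · cases h : W (g + d) <;> cases ε <;> simp_all
      · rw [show g + d + (n - d) = g + n by omega, hW]
        cases h : W g <;> cases ε <;> simp_all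
      · rwa [show g + d + (n - d) = g + n by omega]
      · rw [show g + d + (n - d) = g + n by omega, turns_add_period hW]
        exact ha
  by_contra hcon
  -- Comparing `i` with `i + m` and with `i + m + 1`, and `i + 1` with `i + m + 1`, forces the four
  -- signs to agree, as otherwise a good pair appears. Moving one end of an arc by one costs at most
  -- one turn, which is absorbed by the difference between `100 * κ` and `99 * κ`.
  have hconst : ∀ i, 100 * κ ≤ turns W true i (i + m) → turns W true i (i + m) + 100 * κ ≤ T →
      W (i + 1) = W i ∧ W (i + m) = W i ∧ W (i + m + 1) = W i := by
    intro i hlo hhi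
    have e1 := turns_add (W := W) (s := true) (Nat.le_add_right i m)
      (show i + m ≤ i + n by omega)
    have e2 := turns_add (W := W) (s := true) (show i ≤ i + m by omega)
      (show i + m ≤ i + m + 1 by omega)
    have e3 := turns_add (W := W) (s := true) (show i ≤ i + (m + 1) by omega)
      (show i + (m + 1) ≤ i + n by omega)
    have e4 : turns W true (i + m) (i + m + 1) ≤ i + m + 1 - (i + m) := turns_le
    have e5 : turns W true i (i + 1) ≤ i + 1 - i := turns_le
    have e6 := turns_add (W := W) (s := true) (show i ≤ i + 1 by omega)
      (show i + 1 ≤ i + 1 + m by omega)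
    have e7 := turns_add (W := W) (s := true) (show i + 1 ≤ i + 1 + m by omega)
      (show i + 1 + m ≤ i + 1 + n by omega)
    have e8 := hper i
    have e9 := hper (i + 1)
    rw [← add_assoc] at e3
    rw [show i + 1 + m = i + m + 1 by omega] at e6 e7
    refine ⟨?_, ?_, ?_⟩
    · by_contra hne
      by_cases hA : W i = W (i + m + 1)
      · refine hcon (key (i + 1) m (Or.inl rfl) ?_ ?_ ?_)
        · rw [show i + 1 + m = i + m + 1 by omega, ← hA]
          exact hne
        · rw [show i + 1 + m = i + m + 1 by omega]
          omega
        · rw [show i + 1 + m = i + m + 1 by omega]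
          omega
      · refine hcon (key i (m + 1) (Or.inr rfl) (by rwa [← add_assoc]) ?_ ?_)
        · rw [← add_assoc]
          omega
        · rw [← add_assoc]
          omega
    · by_contra hne
      exact hcon (key i m (Or.inl rfl) (Ne.symm hne) (by omega) (by omega))
    · by_contra hne
      refine hcon (key i (m + 1) (Or.inr rfl) (by rw [← add_assoc]; exact Ne.symm hne) ?_ ?_)
      · rw [← add_assoc]
        omega
      · rw [← add_assoc]
        omega
  have hstep : ∀ i, turns W true (i + 1) (i + 1 + m) ≤ turns W true i (i + m) + 1 ∧
      turns W true i (i + m) ≤ turns W true (i + 1) (i + 1 + m) + 1 := by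
    intro i
    have e2 := turns_add (W := W) (s := true) (show i ≤ i + m by omega)
      (show i + m ≤ i + 1 + m by omega)
    have e4 : turns W true (i + m) (i + 1 + m) ≤ i + 1 + m - (i + m) := turns_le
    have e5 : turns W true i (i + 1) ≤ i + 1 - i := turns_le
    have e6 := turns_add (W := W) (s := true) (show i ≤ i + 1 by omega)
      (show i + 1 ≤ i + 1 + m by omega)
    omega
  -- If one arc of length `m` is balanced, the agreement propagates: shifting the arc by one leaves
  -- its count unchanged, so the pattern is constant from `i` on, although the arc contains turns.
  by_cases hbal : ∃ i, 100 * κ ≤ turns W true i (i + m) ∧ turns W true i (i + m) + 100 * κ ≤ T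
  · obtain ⟨i, hlo, hhi⟩ := hbal
    have hall : ∀ k, turns W true (i + k) (i + k + m) = turns W true i (i + m) ∧
        W (i + k) = W i := by
      intro k
      induction k with
      | zero => exact ⟨rfl, rfl⟩
      | succ k ih =>
        obtain ⟨h3, h4⟩ := ih
        obtain ⟨h5, h6, h7⟩ := hconst (i + k) (by omega) (by omega)
        refine ⟨?_, by rw [← add_assoc, h5, h4]⟩
        have e2 := turns_add (W := W) (s := true) (show i + k ≤ i + k + m by omega)
          (show i + k + m ≤ i + k + m + 1 by omega)
        have e6 := turns_add (W := W) (s := true) (show i + k ≤ i + k + 1 by omega)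
          (show i + k + 1 ≤ i + k + m + 1 by omega)
        have e7 := turns_succ (W := W) (s := true) (le_refl (i + k))
        have e8 := turns_succ (W := W) (s := true) (le_refl (i + k + m))
        rw [h5] at e7
        rw [h6, h7] at e8
        have e9 : turns W true (i + k) (i + k) = 0 := by simp [turns]
        have e10 : turns W true (i + k + m) (i + k + m) = 0 := by simp [turns]
        have e11 : ¬ (W (i + k) = (!true) ∧ W (i + k) = true) := by
          rintro ⟨a, b⟩
          simp [a] at b
        rw [if_neg e11] at e7 e8
        rw [show i + (k + 1) + m = i + k + m + 1 by omega, ← add_assoc]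
        omega
    have h0 : turns W true i (i + m) = 0 := by
      unfold turns
      rw [Finset.card_eq_zero, Finset.filter_eq_empty_iff]
      rintro j hj ⟨h3, h4⟩
      rw [Finset.mem_Ico] at hj
      obtain ⟨k, rfl⟩ := Nat.exists_eq_add_of_le hj.1
      rw [(hall k).2] at h3
      rw [add_assoc, (hall (k + 1)).2, h3] at h4
      simp at h4
    omega
  -- Otherwise the count, which changes by at most one under a shift, is small for all arcs or large
  -- for all arcs. Two consecutive arcs make up a period up to `10 * κ` positions, so the total
  -- number of turns is contradicted.
  · push Not at hbal
    have e1 := turns_add (W := W) (s := true) (Nat.zero_le m) (show m ≤ m + m by omega)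
    rcases Nat.lt_or_ge (turns W true 0 (0 + m)) (100 * κ) with h | h
    · have hall : ∀ i, turns W true i (i + m) < 100 * κ := by
        intro i
        induction i with
        | zero => exact h
        | succ i ih =>
          by_contra hc
          have := hbal (i + 1) (by omega)
          have := hstep i
          omega
      have h3 := hall 0
      have h4 := hall m
      rw [zero_add] at h3
      rcases Nat.le_total n (m + m) with h5 | h5
      · have := turns_mono (W := W) (s := true) (le_refl 0) h5
        omega
      · have e2 := turns_add (W := W) (s := true) (Nat.zero_le (m + m)) h5
        have e3 : turns W true (m + m) n ≤ n - (m + m) := turns_le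
        omega
    · have hall : ∀ i, T < turns W true i (i + m) + 100 * κ := by
        intro i
        induction i with
        | zero => exact hbal 0 h
        | succ i ih =>
          have := hstep i
          exact hbal (i + 1) (by omega)
      have h3 := hall 0
      have h4 := hall m
      rw [zero_add] at h3
      rcases Nat.le_total (m + m) n with h5 | h5
      · have := turns_mono (W := W) (s := true) (le_refl 0) h5
        omega
      · have e2 := turns_add (W := W) (s := true) (Nat.zero_le n) h5
        have e3 : turns W true n (m + m) ≤ m + m - n := turns_le
        omega

end turns

theorem natCast_periodic {n : ℕ} (w : ZMod n → Bool) (j : ℕ) :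
    w ((j + n : ℕ) : ZMod n) = w (j : ZMod n) := by
  simp

section

variable [Fintype V] [DecidableEq V] {G : Digraph V} {P Q E : Bool → Finset V} {κ D : ℕ}

/-- Embedding when crossings are available that take opposite signs at the two ends of the arc. -/
theorem Layout.hasSignedCycle_of_crossings (L : G.Layout P Q E κ D) {n : ℕ}
    (hn : Fintype.card V = n) (w : ZMod n → Bool)
    (hσ : 400 * κ ≤ turns (fun j => w (j : ZMod n)) true 0 n) (ε : Bool) (τ m : ℕ)
    (X : Finset V) (hX : ∀ x ∈ X, ∃ t, x ∈ E t)
    (hcross : ∀ σ₁ σ₂ : ℕ → Bool, σ₁ 5 = ε → σ₂ 5 = (!ε) → ∃ K₁ K₂ : Finset V,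
      G.FeasN P Q σ₁ false true K₁ τ (100 * κ) ∧ G.FeasN P Q σ₂ true false K₂ τ (100 * κ) ∧
      Disjoint K₁ K₂ ∧ K₁.card ≤ 12 ∧ K₂.card ≤ 12 ∧ ∀ t, ∀ x ∈ E t,
        (x ∈ X ↔ x ∉ K₁ ∧ x ∉ K₂))
    (h1 : (P true).card + 12 ≤ m + 2 * τ) (h2 : m + 1 + 2 * τ ≤ (P true).card + 12 + X.card)
    (h3 : (P true).card + 12 + m + 1 ≤ n + 2 * τ)
    (h4 : n + 2 * τ ≤ (P true).card + 12 + X.card + m)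
    (h5 : n ≤ 2 * m + 10 * κ) (h6 : 2 * m ≤ n + 10 * κ) : G.HasSignedCycle w := by
  have hκ := L.large
  have hκD := L.κ_le
  have hDn := L.D_le
  rw [hn] at hDn
  obtain ⟨r₀, d, hd, hdn, hr, hrd, hT, hS⟩ := exists_balanced_gap
    (W := fun j => w (j : ZMod n)) (natCast_periodic w) (by omega) hσ h5 h6 (by omega) ε
  -- shift by a period to make room to the left
  obtain ⟨r, hr', hrd', hT', hS'⟩ : ∃ r : ℕ, w ((19 + r : ℕ) : ZMod n) = ε ∧
      w ((19 + d + r : ℕ) : ZMod n) = (!ε) ∧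
      99 * κ ≤ turns (fun j => w (j : ZMod n)) true (19 + r) (19 + d + r) ∧
      99 * κ ≤ turns (fun j => w (j : ZMod n)) true (19 + d + r) (19 + n + r) := by
    refine ⟨r₀ + n - 19, ?_, ?_, ?_, ?_⟩
    · rw [show 19 + (r₀ + n - 19) = r₀ + n by omega, natCast_periodic w, hr]
    · rw [show 19 + d + (r₀ + n - 19) = r₀ + d + n by omega, natCast_periodic w, hrd]
    · rw [show 19 + (r₀ + n - 19) = r₀ + n by omega,
        show 19 + d + (r₀ + n - 19) = r₀ + d + n by omega, turns_add_period (natCast_periodic w)]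
      exact hT
    · rw [show 19 + d + (r₀ + n - 19) = r₀ + d + n by omega,
        show 19 + n + (r₀ + n - 19) = r₀ + n + n by omega, turns_add_period (natCast_periodic w)]
      exact hS
  refine HasSignedCycle.of_rotate (r : ZMod n) ?_
  have hcast : ∀ j : ℕ, w ((j : ZMod n) + (r : ZMod n)) = w ((j + r : ℕ) : ZMod n) := fun j => by
    rw [Nat.cast_add]
  have hturns : ∀ s x y, turns (fun j => w ((j : ZMod n) + (r : ZMod n))) s x y =
      turns (fun j => w (j : ZMod n)) s (x + r) (y + r) := fun s x y => by
    rw [← turns_shift]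
    simp only [hcast]
  -- The edge 5 of the two crossing windows lies at the positions `19` and `19 + d`, where the signs
  -- are known.
  obtain ⟨K₁, K₂, hF₁, hF₂, hK, hK₁, hK₂, hKX⟩ := hcross
    (fun j => w (((14 + j : ℕ) : ZMod n) + (r : ZMod n)))
    (fun j => w (((14 + d + j : ℕ) : ZMod n) + (r : ZMod n)))
    (by simp only [hcast]; exact hr')
    (by simp only [hcast]; rw [show 14 + d + 5 + r = 19 + d + r by omega]; exact hrd')
  -- Each exceptional vertex placed on the arc of `P true` lengthens it by one. By `h1` to `h4`, all
  -- four possible values of `d` are attained by some `Y ⊆ X`.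
  obtain ⟨Y, hYX, hYcard⟩ := Finset.exists_subset_card_eq
    (show d + 2 * τ - (P true).card - 12 ≤ X.card by omega)
  refine L.hasSignedCycle_of_turns hn _ d K₁ K₂ τ τ hF₁ hF₂ hK hK₁ hK₂ Y (fun x hx => ?_)
    (fun _ s => ?_) (fun _ s => ?_) (by omega) (by omega) (by omega)
  · obtain ⟨t, ht⟩ := hX x (hYX hx)
    exact ⟨⟨t, ht⟩, (hKX t x ht).1 (hYX hx)⟩
  · rw [hturns]
    have e1 := turns_le_turns (W := fun j => w (j : ZMod n))
      (show 32 + r ≤ d + 7 + r by omega) true s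
    have e2 := turns_add (W := fun j => w (j : ZMod n)) (s := true)
      (show 19 + r ≤ 32 + r by omega) (show 32 + r ≤ 19 + d + r by omega)
    have e3 := turns_add (W := fun j => w (j : ZMod n)) (s := true)
      (show 32 + r ≤ d + 7 + r by omega) (show d + 7 + r ≤ 19 + d + r by omega)
    have e4 : turns (fun j => w (j : ZMod n)) true (19 + r) (32 + r) ≤ _ := turns_le
    have e5 : turns (fun j => w (j : ZMod n)) true (d + 7 + r) (19 + d + r) ≤ _ := turns_le
    omega
  · rw [hturns]
    have e1 := turns_le_turns (W := fun j => w (j : ZMod n))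
      (show 32 + d + r ≤ n - 7 + r by omega) true s
    have e2 := turns_add (W := fun j => w (j : ZMod n)) (s := true)
      (show 19 + d + r ≤ 32 + d + r by omega) (show 32 + d + r ≤ 19 + n + r by omega)
    have e3 := turns_add (W := fun j => w (j : ZMod n)) (s := true)
      (show 32 + d + r ≤ n - 7 + r by omega) (show n - 7 + r ≤ 19 + n + r by omega)
    have e4 : turns (fun j => w (j : ZMod n)) true (19 + d + r) (32 + d + r) ≤ _ := turns_le
    have e5 : turns (fun j => w (j : ZMod n)) true (n - 7 + r) (19 + n + r) ≤ _ := turns_le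
    omega

/-- Embedding when edges between the sides are available in enough combinations of directions. -/
theorem Layout.hasSignedCycle_of_edges (L : G.Layout P Q E κ D) {n : ℕ}
    (hn : Fintype.card V = n) (w : ZMod n → Bool)
    (hσ : ∀ t, ∀ x ∈ E t, 400 * κ ≤ turns (fun j => w (j : ZMod n)) true 0 n)
    {x₁ y₁ x₂ y₂ x₃ y₃ x₄ y₄ : V}
    (hx₁ : x₁ ∈ P false) (hx₂ : x₂ ∈ P false) (hx₃ : x₃ ∈ P false) (hx₄ : x₄ ∈ P false)
    (hy₁ : y₁ ∈ P true) (hy₂ : y₂ ∈ P true) (hy₃ : y₃ ∈ P true) (hy₄ : y₄ ∈ P true)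
    (hx₁₂ : x₁ ≠ x₂) (hy₁₂ : y₁ ≠ y₂) (hx₃₄ : x₃ ≠ x₄) (hy₃₄ : y₃ ≠ y₄)
    (h₁ : G.Adj y₁ x₁) (h₂ : G.Adj y₂ x₂) (h₃ : G.Adj x₃ y₃) (h₄ : G.Adj y₄ x₄) :
    G.HasSignedCycle w := by
  have hκ := L.large
  have hκD := L.κ_le
  have hDn := L.D_le
  have hs0 := L.size false
  have hs1 := L.size true
  have hce := L.card_eq
  have hexc := L.exc
  rw [hn] at hDn hs0 hs1 hce
  have hz : 100 * κ + 12 < D := by omega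
  -- it is enough to treat a rotation for which the crossing is possible
  suffices H : ∀ w : ZMod n → Bool,
      (∀ t, ∀ x ∈ E t, 400 * κ ≤ turns (fun j => w (j : ZMod n)) true 0 n) →
      (w ((19 : ℕ) : ZMod n) = false ∨ ∀ i, w i = true) → G.HasSignedCycle w by
    by_cases hall : ∃ i, w i = false
    · obtain ⟨i, hi⟩ := hall
      refine HasSignedCycle.of_rotate (i - ((19 : ℕ) : ZMod n)) (H _ (fun t x hx => ?_) (Or.inl ?_))
      · have hn0 : NeZero n := ⟨by omega⟩
        obtain ⟨r, hr⟩ : ∃ r : ℕ, (r : ZMod n) = i - ((19 : ℕ) : ZMod n) :=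
          ⟨_, ZMod.natCast_zmod_val _⟩
        have hcast : ∀ j : ℕ, w ((j : ZMod n) + (i - ((19 : ℕ) : ZMod n))) =
            w ((j + r : ℕ) : ZMod n) := fun j => by
          rw [Nat.cast_add, hr]
        simp only [hcast]
        rw [turns_shift (W := fun j => w (j : ZMod n)), zero_add, add_comm,
          turns_period (natCast_periodic w)]
        exact hσ t x hx
      · simpa using hi
    · push Not at hall
      exact H w hσ (Or.inr fun i => by simpa using hall i)
  clear hσ w
  intro w hσ hw
  have hne : ∀ {x y : V}, x ∈ P false → y ∈ P true → x ≠ y := by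
    rintro x _ hx hy rfl
    simpa using L.eq_of_mem hx hy
  have hcross : ∀ m : ℕ, ∃ K₁ K₂ : Finset V,
      G.FeasN P Q (fun j => w ((14 + j : ℕ) : ZMod n)) false true K₁ 6 (100 * κ) ∧
      G.FeasN P Q (fun j => w ((14 + m + j : ℕ) : ZMod n)) true false K₂ 6 (100 * κ) ∧
      Disjoint K₁ K₂ ∧ K₁.card ≤ 12 ∧ K₂.card ≤ 12 ∧ ∀ t, ∀ x ∈ E t, x ∉ K₁ ∧ x ∉ K₂ := by
    intro m
    have main : ∀ {x y x' y' : V}, x ∈ P false → y ∈ P true → x' ∈ P false → y' ∈ P true →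
        x ≠ x' → y ≠ y' → G.SAdj (w ((14 + 5 : ℕ) : ZMod n)) x y →
        G.SAdj (w ((14 + m + 5 : ℕ) : ZMod n)) y' x' → ∃ K₁ K₂ : Finset V,
        G.FeasN P Q (fun j => w ((14 + j : ℕ) : ZMod n)) false true K₁ 6 (100 * κ) ∧
        G.FeasN P Q (fun j => w ((14 + m + j : ℕ) : ZMod n)) true false K₂ 6 (100 * κ) ∧
        Disjoint K₁ K₂ ∧ K₁.card ≤ 12 ∧ K₂.card ≤ 12 ∧ ∀ t, ∀ x ∈ E t, x ∉ K₁ ∧ x ∉ K₂ := by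
      intro x y x' y' hx hy hx' hy' hxx hyy ha ha'
      have h12 : ∀ a b : V, ({a, b} : Finset V).card ≤ 12 := fun a b =>
        Finset.card_le_two.trans (by omega)
      refine ⟨{x, y}, {y', x'}, feasN_edge (c := false) L hz hx hy ha,
        feasN_edge (c := true) L hz hy' hx' ha', ?_, h12 _ _, h12 _ _, fun t v hv => ?_⟩
      · simp only [Finset.disjoint_insert_left, Finset.disjoint_singleton_left,
          Finset.mem_insert, Finset.mem_singleton, not_or]
        exact ⟨⟨hne hx hy', hxx⟩, hyy, (hne hx' hy).symm⟩
      · have hnv := L.notMem_P hv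
        simp only [Finset.mem_insert, Finset.mem_singleton, not_or]
        refine ⟨⟨?_, ?_⟩, ?_, ?_⟩ <;> rintro rfl
        exacts [hnv _ hx, hnv _ hy, hnv _ hy', hnv _ hx']
    -- Signs `false`, `true` call for two disjoint edges from `P true` to `P false`; equal signs
    -- call for one edge in each direction. The rotation has excluded the pattern `true`, `false`.
    rcases hw with hw | hw
    · cases h : w ((14 + m + 5 : ℕ) : ZMod n)
      · exact main hx₄ hy₄ hx₃ hy₃ hx₃₄.symm hy₃₄.symm (by rw [hw]; simpa using h₄)
          (by rw [h]; simpa using h₃)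
      · exact main hx₁ hy₁ hx₂ hy₂ hx₁₂ hy₁₂ (by rw [hw]; simpa using h₁)
          (by rw [h]; simpa using h₂)
    · exact main hx₃ hy₃ hx₄ hy₄ hx₃₄ hy₃₄ (by rw [hw]; simpa using h₃) (by rw [hw]; simpa using h₄)
  -- All exceptional vertices go to one arc: to that of `P false` if it is rich in turns, and
  -- otherwise to that of `P true`, which then is rich because of `hσ`.
  by_cases hrich : (∃ t, ∃ x, x ∈ E t) →
      ∀ s, 75 * κ ≤ turns (fun j => w (j : ZMod n)) s (32 + (P true).card) (n - 7)
  · obtain ⟨K₁, K₂, hF₁, hF₂, hK, hK₁, hK₂, -⟩ := hcross (P true).card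
    exact L.hasSignedCycle_of_turns hn w _ K₁ K₂ 6 6 hF₁ hF₂ hK hK₁ hK₂ ∅ (by simp) (by simp)
      (fun ⟨t, x, hx, _⟩ => hrich ⟨t, x, hx⟩) (by omega) (by omega) (by simp)
  · push Not at hrich
    obtain ⟨⟨t, x, hx⟩, s₀, hs₀⟩ := hrich
    have hσ := hσ t x hx
    obtain ⟨K₁, K₂, hF₁, hF₂, hK, hK₁, hK₂, hKE⟩ :=
      hcross ((P true).card + ((E false).card + (E true).card))
    have hEcard := Finset.card_union_of_disjoint L.disj_E
    refine L.hasSignedCycle_of_turns hn w _ K₁ K₂ 6 6 hF₁ hF₂ hK hK₁ hK₂ (E false ∪ E true)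
      (fun v hv => ?_) (fun _ s => ?_) (fun ⟨t, v, hv, _, _, h⟩ => absurd ?_ h)
      (by omega) (by omega) (by rw [hEcard])
    · rcases Finset.mem_union.1 hv with h | h
      · exact ⟨⟨_, h⟩, hKE _ _ h⟩
      · exact ⟨⟨_, h⟩, hKE _ _ h⟩
    · set T := (P true).card
      have e0 := turns_le_turns (W := fun j => w (j : ZMod n))
        (show 32 + T ≤ n - 7 by omega) true s₀
      have e1 := turns_le_turns (W := fun j => w (j : ZMod n))
        (show 32 ≤ T + ((E false).card + (E true).card) + 7 by omega) true s
      have e2 := turns_add (W := fun j => w (j : ZMod n)) (s := true)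
        (show 0 ≤ 32 by omega) (show 32 ≤ T + ((E false).card + (E true).card) + 7 by omega)
      have e3 := turns_add (W := fun j => w (j : ZMod n)) (s := true) (Nat.zero_le (T + 7))
        (show T + 7 ≤ 32 + T by omega)
      have e4 := turns_add (W := fun j => w (j : ZMod n)) (s := true) (Nat.zero_le (32 + T))
        (show 32 + T ≤ n - 7 by omega)
      have e5 := turns_add (W := fun j => w (j : ZMod n)) (s := true) (Nat.zero_le (n - 7))
        (show n - 7 ≤ n by omega)
      have e6 : turns (fun j => w (j : ZMod n)) true 0 32 ≤ _ := turns_le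
      have e7 : turns (fun j => w (j : ZMod n)) true (T + 7) (32 + T) ≤ _ := turns_le
      have e8 : turns (fun j => w (j : ZMod n)) true (n - 7) n ≤ _ := turns_le
      have e9 := turns_mono (W := fun j => w (j : ZMod n)) (s := true) (le_refl 0)
        (show T + 7 ≤ T + ((E false).card + (E true).card) + 7 by omega)
      omega
    · cases t
      · exact Finset.mem_union_left _ hv
      · exact Finset.mem_union_right _ hv

end

/-! ### Edges between the sides and at exceptional vertices -/

theorem sum_sDeg_comm {G : Digraph V} (s : Bool) (X Y : Finset V) :
    ∑ x ∈ X, G.sDeg s Y x = ∑ y ∈ Y, G.sDeg (!s) X y := by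
  classical
  have := Finset.sum_card_bipartiteAbove_eq_sum_card_bipartiteBelow (s := X) (t := Y)
    fun x y => G.SAdj s x y
  simp only [Finset.bipartiteAbove, Finset.bipartiteBelow] at this
  simp only [sDeg, sAdj_not]
  exact this

theorem sDeg_pos_iff {G : Digraph V} {s : Bool} {X : Finset V} {x : V} :
    1 ≤ G.sDeg s X x ↔ ∃ y ∈ X, G.SAdj s x y := by
  classical
  rw [sDeg, Nat.succ_le_iff, Finset.card_pos]
  constructor
  · rintro ⟨y, hy⟩
    exact ⟨y, (Finset.mem_filter.1 hy).1, (Finset.mem_filter.1 hy).2⟩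
  · rintro ⟨y, hy, h⟩
    exact ⟨y, Finset.mem_filter.2 ⟨hy, h⟩⟩

theorem sDeg_le_card {G : Digraph V} {s : Bool} {X : Finset V} {x : V} :
    G.sDeg s X x ≤ X.card := by
  classical
  exact Finset.card_filter_le _ _

theorem sDeg_le_one {G : Digraph V} {s : Bool} {X : Finset V} {x z : V}
    (h : ∀ y ∈ X, G.SAdj s x y → y = z) : G.sDeg s X x ≤ 1 := by
  classical
  refine (Finset.card_le_card (t := {z}) fun y hy => ?_).trans (Finset.card_singleton z).le
  rw [Finset.mem_filter] at hy
  exact Finset.mem_singleton.2 (h y hy.1 hy.2)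

/-- A bipartite relation without two disjoint pairs is a star. -/
theorem exists_disjoint_pairs_or_star {X Y : Finset V} (R : V → V → Prop) :
    (∃ x ∈ X, ∃ y ∈ Y, ∃ x' ∈ X, ∃ y' ∈ Y, x ≠ x' ∧ y ≠ y' ∧ R x y ∧ R x' y') ∨
    (∃ z ∈ X, ∀ x ∈ X, ∀ y ∈ Y, R x y → x = z) ∨
    (∃ z ∈ Y, ∀ x ∈ X, ∀ y ∈ Y, R x y → y = z) ∨ ∀ x ∈ X, ∀ y ∈ Y, ¬ R x y := by
  by_cases h0 : ∃ x ∈ X, ∃ y ∈ Y, R x y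
  · obtain ⟨x₀, hx₀, y₀, hy₀, h₀⟩ := h0
    by_cases h1 : ∃ x ∈ X, ∃ y ∈ Y, R x y ∧ x ≠ x₀
    · obtain ⟨x₁, hx₁, y₁, hy₁, h₁, hne⟩ := h1
      by_cases hy : y₁ = y₀
      · subst hy
        by_cases h2 : ∃ x ∈ X, ∃ y ∈ Y, R x y ∧ y ≠ y₁
        · obtain ⟨x₂, hx₂, y₂, hy₂, h₂, hne₂⟩ := h2
          by_cases hx : x₂ = x₀
          · subst hx
            exact Or.inl ⟨x₁, hx₁, y₁, hy₁, x₂, hx₂, y₂, hy₂, hne, hne₂.symm, h₁, h₂⟩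
          · exact Or.inl ⟨x₀, hx₀, y₁, hy₁, x₂, hx₂, y₂, hy₂, Ne.symm hx, hne₂.symm, h₀, h₂⟩
        · push Not at h2
          exact Or.inr (Or.inr (Or.inl ⟨y₁, hy₁, h2⟩))
      · exact Or.inl ⟨x₁, hx₁, y₁, hy₁, x₀, hx₀, y₀, hy₀, hne, hy, h₁, h₀⟩
    · push Not at h1
      exact Or.inr (Or.inl ⟨x₀, hx₀, h1⟩)
  · push Not at h0
    exact Or.inr (Or.inr (Or.inr h0))

section

variable [Fintype V] {G : Digraph V} {P Q E : Bool → Finset V} {κ D : ℕ}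

/-- Without loops a vertex has at most `(P c).card - 1` neighbours on its own side; this is the
source of the `+ 2`, on which the tight cases depend. -/
theorem Layout.card_add_two_le (L : G.Layout P Q E κ D) {c : Bool} (s : Bool) {x : V}
    (hx : x ∈ P c) : Fintype.card V + 2 ≤ 2 * ((P c).card + G.sDeg s (P (!c)) x +
      (G.sDeg s (E false) x + G.sDeg s (E true) x)) := by
  classical
  have h1 := L.semidegree s x
  have hirr : ¬ G.SAdj s x x := by
    cases s <;> simpa using L.loopless x
  have hsub : (Finset.univ.filter fun y => G.SAdj s x y) ⊆
      (((P c).erase x) ∪ ((P (!c)).filter fun y => G.SAdj s x y)) ∪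
        (((E false).filter fun y => G.SAdj s x y) ∪ ((E true).filter fun y => G.SAdj s x y)) := by
    intro y hy
    simp only [Finset.mem_filter, Finset.mem_univ, true_and] at hy
    simp only [Finset.mem_union, Finset.mem_filter, Finset.mem_erase]
    rcases L.cover y with ⟨c', hc'⟩ | ⟨t, ht⟩
    · by_cases h : c' = c
      · subst h
        exact Or.inl (Or.inl ⟨by rintro rfl; exact hirr hy, hc'⟩)
      · have : c' = !c := by cases c <;> cases c' <;> simp_all
        subst this
        exact Or.inl (Or.inr ⟨hc', hy⟩)
    · cases t
      · exact Or.inr (Or.inl ⟨ht, hy⟩)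
      · exact Or.inr (Or.inr ⟨ht, hy⟩)
  have h2 := Finset.card_le_card hsub
  have h3 := Finset.card_union_le (((P c).erase x) ∪ ((P (!c)).filter fun y => G.SAdj s x y))
    (((E false).filter fun y => G.SAdj s x y) ∪ ((E true).filter fun y => G.SAdj s x y))
  have h4 := Finset.card_union_le ((P c).erase x) ((P (!c)).filter fun y => G.SAdj s x y)
  have h5 := Finset.card_union_le ((E false).filter fun y => G.SAdj s x y)
    ((E true).filter fun y => G.SAdj s x y)
  have h6 := Finset.card_erase_add_one hx
  simp only [sDeg] at h1 ⊢
  omega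

/-- Seen from a vertex of `E true` these edges have the sign `!c`, whose natural side is `!c`. They
are unnatural, so each such vertex has at most one hundredth of all vertices as neighbours here. -/
theorem Layout.sum_unnatural_le (L : G.Layout P Q E κ D) (c : Bool) :
    100 * ∑ x ∈ P c, G.sDeg c (E true) x ≤ (E true).card * Fintype.card V := by
  rw [sum_sDeg_comm, Finset.mul_sum, ← smul_eq_mul (E true).card]
  refine Finset.sum_le_card_nsmul _ _ _ fun b hb => ?_
  have := L.unnatural true (!c) b hb
  cases c <;> exact this

/-- If almost all vertices of a side have an unnatural neighbour, there are two disjoint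
unnatural edges. -/
theorem Layout.exists_unnatural_pairs (L : G.Layout P Q E κ D) (c : Bool) (z : V)
    (h : ∀ x ∈ P c, x ≠ z → 1 ≤ G.sDeg c (E true) x) : 10 ≤ (E true).card ∧
      ∃ v ∈ P c, ∃ b ∈ E true, ∃ v' ∈ P c, ∃ b' ∈ E true, v ≠ v' ∧ b ≠ b' ∧
        G.SAdj (!c) b v ∧ G.SAdj (!c) b' v' := by
  classical
  have hκ := L.large
  have hκD := L.κ_le
  have hDn := L.D_le
  have hs := L.size c
  have herase : (P c).card ≤ ((P c).erase z).card + 1 := by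
    have := Finset.pred_card_le_card_erase (s := P c) (a := z)
    omega
  -- The number of unnatural edges is at least `|P c| - 1`, nearly half of all vertices, but few of
  -- them meet the same vertex of `E true`. A star cannot contain them all: a centre in `P c` misses
  -- other vertices of `P c`, and a centre in `E true` would have too large an unnatural degree.
  constructor
  · have h1 := L.sum_unnatural_le c
    have h2 : ((P c).erase z).card ≤ ∑ x ∈ P c, G.sDeg c (E true) x := by
      refine le_trans ?_ (Finset.sum_le_sum_of_subset (Finset.erase_subset z (P c)))
      rw [Finset.card_eq_sum_ones]
      exact Finset.sum_le_sum fun x hx => h x (Finset.mem_of_mem_erase hx)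
        (Finset.ne_of_mem_erase hx)
    by_contra hcon
    have : (E true).card * Fintype.card V ≤ 9 * Fintype.card V :=
      Nat.mul_le_mul_right _ (by omega)
    omega
  · simp only [sAdj_not]
    rcases exists_disjoint_pairs_or_star (X := P c) (Y := E true) fun x y => G.SAdj c x y with
      ⟨x, hx, y, hy, x', hx', y', hy', h1, h2, h3, h4⟩ | ⟨z', -, hz'⟩ | ⟨b, hb, hb'⟩ | h0
    · exact ⟨x, hx, y, hy, x', hx', y', hy', h1, h2, h3, h4⟩
    · exfalso
      obtain ⟨x, hx, hxz⟩ := Finset.exists_mem_notMem_of_card_lt_card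
        (show ({z, z'} : Finset V).card < (P c).card from
          Finset.card_le_two.trans_lt (by omega))
      simp only [Finset.mem_insert, Finset.mem_singleton, not_or] at hxz
      obtain ⟨y, hy, hxy⟩ := sDeg_pos_iff.1 (h x hx hxz.1)
      exact hxz.2 (hz' x hx y hy hxy)
    · exfalso
      have h1 := L.unnatural true (!c) b hb
      have h2 : ((P c).erase z).card ≤ G.sDeg (!c) (P c) b := by
        refine Finset.card_le_card fun x hx => ?_
        obtain ⟨hxz, hx⟩ := Finset.mem_erase.1 hx
        obtain ⟨y, hy, hxy⟩ := sDeg_pos_iff.1 (h x hx hxz)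
        obtain rfl := hb' x hx y hy hxy
        exact Finset.mem_filter.2 ⟨hx, sAdj_not.2 hxy⟩
      have h3 : (!((!c) == true)) = c := by cases c <;> rfl
      rw [h3] at h1
      omega
    · exfalso
      obtain ⟨x, hx, hxz⟩ := Finset.exists_mem_notMem_of_card_lt_card
        (show ({z} : Finset V).card < (P c).card by rw [Finset.card_singleton]; omega)
      rw [Finset.mem_singleton] at hxz
      obtain ⟨y, hy, hxy⟩ := sDeg_pos_iff.1 (h x hx hxz)
      exact h0 x hx y hy hxy

/-- With `P true` this large, every vertex of `P false` has both inneighbours and outneighbours in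
`P true`. The point is to find two disjoint edges from `P true` to `P false`; an edge leaving a
third vertex of `P false` is then disjoint from one of them. -/
theorem Layout.hasSignedCycle_of_le_card [DecidableEq V] (L : G.Layout P Q E κ D) {n : ℕ}
    (hn : Fintype.card V = n) (w : ZMod n → Bool)
    (hσ : ∀ t, ∀ x ∈ E t, 400 * κ ≤ turns (fun j => w (j : ZMod n)) true 0 n)
    (hle : (P false).card + ((E false).card + (E true).card) ≤ (P true).card) :
    G.HasSignedCycle w := by
  classical
  have hκ := L.large
  have hκD := L.κ_le
  have hDn := L.D_le
  have hs0 := L.size false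
  have hs1 := L.size true
  have hce := L.card_eq
  have hE := L.E_le
  have hdeg : ∀ s, ∀ x ∈ P false, ∃ y ∈ P true, G.SAdj s x y := fun s x hx => by
    have h1 := L.card_add_two_le s hx
    have h2 : G.sDeg s (E false) x ≤ _ := sDeg_le_card
    have h3 : G.sDeg s (E true) x ≤ _ := sDeg_le_card
    exact sDeg_pos_iff.1 (by simp only [Bool.not_false] at h1; omega)
  obtain ⟨x, hx⟩ : (P false).Nonempty := Finset.card_pos.1 (by omega)
  rcases exists_disjoint_pairs_or_star (X := P false) (Y := P true) fun x y => G.Adj y x with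
    ⟨x₁, hx₁, y₁, hy₁, x₂, hx₂, y₂, hy₂, hx₁₂, hy₁₂, h₁, h₂⟩ | ⟨z, -, hz⟩ | ⟨z, hz, hz'⟩ | h0
  · obtain ⟨x₃, hx₃, hx₃'⟩ := Finset.exists_mem_notMem_of_card_lt_card
      (show ({x₁, x₂} : Finset V).card < (P false).card from
        Finset.card_le_two.trans_lt (by omega))
    simp only [Finset.mem_insert, Finset.mem_singleton, not_or] at hx₃'
    obtain ⟨y₃, hy₃, h₃⟩ := hdeg true x₃ hx₃
    by_cases hy : y₃ = y₁
    · exact L.hasSignedCycle_of_edges hn w hσ hx₁ hx₂ hx₃ hx₂ hy₁ hy₂ hy₃ hy₂ hx₁₂ hy₁₂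
        hx₃'.2 (by rw [hy]; exact hy₁₂) h₁ h₂ (by simpa using h₃) h₂
    · exact L.hasSignedCycle_of_edges hn w hσ hx₁ hx₂ hx₃ hx₁ hy₁ hy₂ hy₃ hy₁ hx₁₂ hy₁₂
        hx₃'.1 hy h₁ h₂ (by simpa using h₃) h₁
  · exfalso
    obtain ⟨x', hx', hx''⟩ := Finset.exists_mem_notMem_of_card_lt_card
      (show ({z} : Finset V).card < (P false).card by rw [Finset.card_singleton]; omega)
    obtain ⟨y, hy, hxy⟩ := hdeg false x' hx'
    exact hx'' (Finset.mem_singleton.2 (hz x' hx' y hy (by simpa using hxy)))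
  -- If all edges back start at `z`, the degree inequalities are tight and every vertex of `P false`
  -- receives edges from all of `E true`. Small unnatural degrees then make `E true`, and with it `E
  -- false`, empty. Now a vertex of `P true` other than `z` still needs an outneighbour in `P
  -- false`.
  · exfalso
    have hbound : ∀ x ∈ P false, Fintype.card V ≤
        2 * ((P false).card + (G.sDeg false (E false) x + G.sDeg false (E true) x)) := by
      intro x hx
      have h1 := L.card_add_two_le false hx
      have h2 : G.sDeg false (P true) x ≤ 1 :=
        sDeg_le_one fun y hy hxy => hz' x hx y hy (by simpa using hxy)
      simp only [Bool.not_false] at h1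
      omega
    have hE0 : (E true).card = 0 := by
      by_contra hne
      obtain ⟨b, hb⟩ := Finset.card_pos.1 (Nat.pos_of_ne_zero hne)
      have h1 := L.unnatural true true b hb
      have h2 : (P false).card ≤ G.sDeg true (P false) b := by
        refine Finset.card_le_card fun x hx => Finset.mem_filter.2 ⟨hx, ?_⟩
        have h3 := hbound x hx
        have h4 : G.sDeg false (E false) x ≤ _ := sDeg_le_card
        have h5 : G.sDeg false (E true) x ≤ _ := sDeg_le_card
        have h6 : G.sDeg false (E true) x = (E true).card := by omega
        have h7 := Finset.card_filter_eq_iff.1 h6 b hb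
        simpa using h7
      simp only [BEq.rfl, Bool.not_true] at h1
      omega
    have h1 := hbound x hx
    have h4 : G.sDeg false (E false) x ≤ _ := sDeg_le_card
    have h5 : G.sDeg false (E true) x ≤ _ := sDeg_le_card
    obtain ⟨y, hy, hyz⟩ := Finset.exists_mem_notMem_of_card_lt_card
      (show ({z} : Finset V).card < (P true).card by rw [Finset.card_singleton]; omega)
    have h6 := L.card_add_two_le true hy
    have h7 : G.sDeg true (E false) y ≤ _ := sDeg_le_card
    have h8 : G.sDeg true (E true) y ≤ _ := sDeg_le_card
    simp only [Bool.not_true] at h6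
    obtain ⟨v, hv, hyv⟩ := sDeg_pos_iff.1
      (show 1 ≤ G.sDeg true (P false) y by omega)
    exact hyz (Finset.mem_singleton.2 (hz' v hv y hy (by simpa using hyv)))
  · obtain ⟨y, hy, hxy⟩ := hdeg false x hx
    exact absurd (by simpa using hxy) (h0 x hx y hy)

/-- If there are no two disjoint edges from the side `true` to the side `false`, then there are
many exceptional vertices with unnatural neighbours. -/
theorem Layout.exists_edges_or_unnatural (L : G.Layout P Q E κ D)
    (hlt : (P true).card < (P false).card + ((E false).card + (E true).card)) :
    (∃ x ∈ P false, ∃ y ∈ P true, ∃ x' ∈ P false, ∃ y' ∈ P true, x ≠ x' ∧ y ≠ y' ∧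
      G.Adj y x ∧ G.Adj y' x') ∨
    (20 * (P true).card ≤ 20 * (P false).card + (E true).card ∧ 10 ≤ (E true).card ∧
      ∃ c, ∃ v ∈ P c, ∃ b ∈ E true, ∃ v' ∈ P c, ∃ b' ∈ E true, v ≠ v' ∧ b ≠ b' ∧
        G.SAdj (!c) b v ∧ G.SAdj (!c) b' v') := by
  classical
  have hκ := L.large
  have hκD := L.κ_le
  have hDn := L.D_le
  have hs0 := L.size false
  have hs1 := L.size true
  have hce := L.card_eq
  have hE := L.E_le
  have hP := L.P_le
  obtain ⟨x₀, hx₀⟩ : (P false).Nonempty := Finset.card_pos.1 (by omega)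
  have hstar := exists_disjoint_pairs_or_star (X := P false) (Y := P true) fun x y => G.Adj y x
  rw [or_iff_not_imp_left]
  intro hno
  replace hstar := hstar.resolve_left hno
  -- a vertex `z` that meets all edges
  obtain ⟨z, hz⟩ : ∃ z, (∀ x ∈ P false, ∀ y ∈ P true, G.Adj y x → x = z) ∨
      (z ∈ P true ∧ ∀ x ∈ P false, ∀ y ∈ P true, G.Adj y x → y = z) := by
    rcases hstar with ⟨z, -, h⟩ | ⟨z, hz, h⟩ | h
    · exact ⟨z, Or.inl h⟩
    · exact ⟨z, Or.inr ⟨hz, h⟩⟩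
    · exact ⟨x₀, Or.inl fun x hx y hy hxy => absurd hxy (h x hx y hy)⟩
  have hdeg : ∀ x ∈ P false, x ≠ z → Fintype.card V ≤
      2 * ((P false).card + ((E false).card + G.sDeg false (E true) x)) := by
    intro x hx hxz
    have h1 := L.card_add_two_le false hx
    have h2 : G.sDeg false (P true) x ≤ 1 := sDeg_le_one (z := z) fun y hy hxy => by
      rcases hz with h | h
      · exact absurd (h x hx y hy (by simpa using hxy)) hxz
      · exact h.2 x hx y hy (by simpa using hxy)
    have h3 : G.sDeg false (E false) x ≤ _ := sDeg_le_card
    simp only [Bool.not_false] at h1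
    omega
  -- A vertex of `P false` other than `z` has at most one inneighbour in `P true`, hence at least
  -- `(|P true| - |P false|) / 2` inneighbours in `E true`. If this exceeded `|E true| / 40`, double
  -- counting would contradict the small unnatural degrees.
  have hsmall : 20 * (P true).card ≤ 20 * (P false).card + (E true).card := by
    by_contra hcon
    have h1 := L.sum_unnatural_le false
    have h2 : ((P false).erase z).card * ((E true).card) ≤
        40 * ∑ x ∈ P false, G.sDeg false (E true) x := by
      refine le_trans ?_ (Nat.mul_le_mul_left 40
        (Finset.sum_le_sum_of_subset (Finset.erase_subset z (P false))))
      rw [Finset.mul_sum, ← smul_eq_mul]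
      refine Finset.card_nsmul_le_sum _ _ _ fun x hx => ?_
      have := hdeg x (Finset.mem_of_mem_erase hx) (Finset.ne_of_mem_erase hx)
      omega
    have h3 := Finset.pred_card_le_card_erase (s := P false) (a := z)
    have h4 : (2 * Fintype.card V + 1) * (E true).card ≤
        5 * (((P false).erase z).card * (E true).card) := by
      rw [← mul_assoc]
      exact Nat.mul_le_mul_right _ (by omega)
    have h5 : (2 * Fintype.card V + 1) * (E true).card =
        2 * ((E true).card * Fintype.card V) + (E true).card := by ring
    omega
  refine ⟨hsmall, ?_⟩
  by_cases hα : ∀ x ∈ P false, x ≠ z → 1 ≤ G.sDeg false (E true) x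
  · obtain ⟨h1, h2⟩ := L.exists_unnatural_pairs false z hα
    exact ⟨h1, false, h2⟩
  -- A vertex without inneighbours in `E true` forces equality: the two sides have the same size,
  -- and so have `E false` and `E true`. It then needs an inneighbour in `P true`, so the centre `z`
  -- lies in `P true`, and all other vertices of `P true` must send edges to `E true`.
  · push Not at hα
    obtain ⟨x, hx, hxz, hx0⟩ := hα
    have h1 := hdeg x hx hxz
    have hz' : z ∈ P true ∧ ∀ x ∈ P false, ∀ y ∈ P true, G.Adj y x → y = z := by
      refine hz.resolve_left fun h => ?_
      have h2 := L.card_add_two_le false hx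
      have h3 : ¬ 1 ≤ G.sDeg false (P true) x := fun h3 => by
        obtain ⟨y, hy, hxy⟩ := sDeg_pos_iff.1 h3
        exact hxz (h x hx y hy (by simpa using hxy))
      have h4 : G.sDeg false (E false) x ≤ _ := sDeg_le_card
      simp only [Bool.not_false] at h2
      omega
    obtain ⟨h2, h3⟩ := L.exists_unnatural_pairs true z fun y hy hyz => by
      have h4 := L.card_add_two_le true hy
      have h5 : ¬ 1 ≤ G.sDeg true (P false) y := fun h5 => by
        obtain ⟨v, hv, hyv⟩ := sDeg_pos_iff.1 h5
        exact hyz (hz'.2 v hv y hy (by simpa using hyv))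
      have h6 : G.sDeg true (E false) y ≤ _ := sDeg_le_card
      simp only [Bool.not_true] at h4
      omega
    exact ⟨h2, true, h3⟩

/-- Both outcomes of `exists_edges_or_unnatural` give crossings for opposite signs at the two ends.
In the second outcome `b` and `b'` are used up by the crossings; the two size bounds ensure that the
other exceptional vertices still suffice to reach all four arc lengths. -/
theorem Layout.hasSignedCycle_of_card_lt [DecidableEq V] (L : G.Layout P Q E κ D) {n : ℕ}
    (hn : Fintype.card V = n) (w : ZMod n → Bool)
    (hσ : 400 * κ ≤ turns (fun j => w (j : ZMod n)) true 0 n)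
    (hlt : (P true).card < (P false).card + ((E false).card + (E true).card)) :
    G.HasSignedCycle w := by
  have hκ := L.large
  have hκD := L.κ_le
  have hDn := L.D_le
  have hs0 := L.size false
  have hs1 := L.size true
  have hce := L.card_eq
  have hE := L.E_le
  have hP := L.P_le
  have hexc := L.exc
  rw [hn] at hDn hs0 hs1 hce
  have hz : 100 * κ + 12 < D := by omega
  have hEcard := Finset.card_union_of_disjoint L.disj_E
  have hEmem : ∀ x ∈ E false ∪ E true, ∃ t, x ∈ E t := fun x hx => by
    rcases Finset.mem_union.1 hx with h | h
    exacts [⟨_, h⟩, ⟨_, h⟩]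
  have hmemE : ∀ t, ∀ x ∈ E t, x ∈ E false ∪ E true := fun t x hx => by
    cases t
    exacts [Finset.mem_union_left _ hx, Finset.mem_union_right _ hx]
  have h12 : ∀ a b : V, ({a, b} : Finset V).card ≤ 12 := fun a b =>
    Finset.card_le_two.trans (by omega)
  rcases L.exists_edges_or_unnatural hlt with
    ⟨x, hx, y, hy, x', hx', y', hy', hxx, hyy, h, h'⟩ |
    ⟨hst, hb10, c, v, hv, b, hb, v', hv', b', hb', hvv, hbb, h, h'⟩
  · have hne : ∀ {x y : V}, x ∈ P false → y ∈ P true → x ≠ y := by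
      rintro x _ hx hy rfl
      simpa using L.eq_of_mem hx hy
    refine L.hasSignedCycle_of_crossings hn w hσ false 6 (P true).card (E false ∪ E true) hEmem
      (fun σ₁ σ₂ h₁ h₂ => ⟨{x, y}, {y', x'}, feasN_edge (c := false) L hz hx hy
        (by rw [h₁]; simpa using h), feasN_edge (c := true) L hz hy' hx'
        (by rw [h₂]; simpa using h'), ?_, h12 _ _, h12 _ _, fun t u hu => ?_⟩) (by omega)
      (by omega) (by omega) (by omega) (by omega) (by omega)
    · simp only [Finset.disjoint_insert_left, Finset.disjoint_singleton_left,
        Finset.mem_insert, Finset.mem_singleton, not_or]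
      exact ⟨⟨hne hx hy', hxx⟩, hyy, (hne hx' hy).symm⟩
    · have hnv := L.notMem_P hu
      simp only [hmemE t u hu, true_iff, Finset.mem_insert, Finset.mem_singleton, not_or]
      refine ⟨⟨?_, ?_⟩, ?_, ?_⟩ <;> rintro rfl
      exacts [hnv _ hx, hnv _ hy, hnv _ hy', hnv _ hx']
  · have hXcard : ((E false ∪ E true) \ {b, b'}).card + 2 = (E false).card + (E true).card := by
      rw [← hEcard, ← Finset.card_pair hbb]
      refine Finset.card_sdiff_add_card_eq_card fun u hu => ?_
      simp only [Finset.mem_insert, Finset.mem_singleton] at hu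
      rcases hu with rfl | rfl
      exacts [hmemE _ _ hb, hmemE _ _ hb']
    have hbv : ∀ {t c u u'}, u ∈ E t → u' ∈ P c → u ≠ u' := by
      rintro t c u _ hu hu' rfl
      exact L.notMem_P hu _ hu'
    have hcross : ∀ σ : ℕ → Bool, σ 5 = (!c) → ∀ b v, b ∈ E true → v ∈ P c →
        G.SAdj (!c) b v → ∃ K : Finset V, b ∈ K ∧ K ⊆ {b, v} ∧
          G.FeasN P Q σ c (!c) K (if c then 5 else 6) (100 * κ) := fun σ hσ b v hb hv h =>
      feasN_unnatural_crossing L hz hb hv (by cases c <;> rfl) h hσ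
    have hcross' : ∀ σ : ℕ → Bool, σ 5 = c → ∀ b v, b ∈ E true → v ∈ P c →
        G.SAdj (!c) b v → ∃ K : Finset V, b ∈ K ∧ K ⊆ {b, v} ∧
          G.FeasN P Q σ (!c) c K (if c then 5 else 6) (100 * κ) := fun σ hσ b v hb hv h => by
      obtain ⟨K, h1, h2, h3⟩ := hcross (fun j => !σ (10 - j)) (by simp [hσ]) b v hb hv h
      exact ⟨K, h1, h2, h3.reverse fun j hj => by
        rw [Bool.not_not, show 10 - (10 - j) = j by omega]⟩
    have hfin : ∀ K₁ K₂ : Finset V, b ∈ K₁ → b' ∈ K₂ → K₁ ⊆ {b, v} → K₂ ⊆ {b', v'} →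
        Disjoint K₁ K₂ ∧ K₁.card ≤ 12 ∧ K₂.card ≤ 12 ∧ ∀ t, ∀ x ∈ E t,
          (x ∈ (E false ∪ E true) \ {b, b'} ↔ x ∉ K₁ ∧ x ∉ K₂) := by
      intro K₁ K₂ hb₁ hb₂ hK₁ hK₂
      refine ⟨?_, (Finset.card_le_card hK₁).trans (h12 _ _),
        (Finset.card_le_card hK₂).trans (h12 _ _), fun t x hx => ?_⟩
      · refine Finset.disjoint_of_subset_left hK₁ (Finset.disjoint_of_subset_right hK₂ ?_)
        simp only [Finset.disjoint_insert_left, Finset.disjoint_singleton_left,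
          Finset.mem_insert, Finset.mem_singleton, not_or]
        exact ⟨⟨hbb, hbv hb hv'⟩, (hbv hb' hv).symm, hvv⟩
      · simp only [Finset.mem_sdiff, hmemE t x hx, true_and, Finset.mem_insert,
          Finset.mem_singleton, not_or]
        constructor
        · rintro ⟨h1, h2⟩
          refine ⟨fun h3 => ?_, fun h3 => ?_⟩
          · have := hK₁ h3
            simp only [Finset.mem_insert, Finset.mem_singleton] at this
            exact this.elim h1 (hbv hx hv)
          · have := hK₂ h3
            simp only [Finset.mem_insert, Finset.mem_singleton] at this
            exact this.elim h2 (hbv hx hv')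
        · rintro ⟨h1, h2⟩
          exact ⟨by rintro rfl; exact h1 hb₁, by rintro rfl; exact h2 hb₂⟩
    refine L.hasSignedCycle_of_crossings hn w hσ true (if c then 5 else 6) ((P true).card + 2)
      ((E false ∪ E true) \ {b, b'}) (fun x hx => hEmem x (Finset.mem_sdiff.1 hx).1)
      (fun σ₁ σ₂ h₁ h₂ => ?_) ?_ ?_ ?_ ?_ (by omega) (by omega)
    · cases c
      · obtain ⟨K₁, a1, a2, a3⟩ := hcross σ₁ h₁ b v hb hv h
        obtain ⟨K₂, b1, b2, b3⟩ := hcross' σ₂ h₂ b' v' hb' hv' h'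
        exact ⟨K₁, K₂, a3, b3, hfin K₁ K₂ a1 b1 a2 b2⟩
      · obtain ⟨K₁, a1, a2, a3⟩ := hcross' σ₁ h₁ b v hb hv h
        obtain ⟨K₂, b1, b2, b3⟩ := hcross σ₂ h₂ b' v' hb' hv' h'
        exact ⟨K₁, K₂, a3, b3, hfin K₁ K₂ a1 b1 a2 b2⟩
    all_goals cases c <;> simp <;> omega

end

/-! ### König's theorem and link matchings -/

/-- König's theorem: if all vertex covers of a bipartite relation have at least `N` elements, it
contains a matching with `N` elements. -/
theorem exists_matching_of_covers {X Y : Finset V} (R : V → V → Prop) (N : ℕ)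
    (h : ∀ A B : Finset V, (∀ x ∈ X, ∀ y ∈ Y, R x y → x ∈ A ∨ y ∈ B) → N ≤ A.card + B.card) :
    ∃ M : Finset (V × V), M.card = N ∧ (∀ e ∈ M, e.1 ∈ X ∧ e.2 ∈ Y ∧ R e.1 e.2) ∧
      (∀ e ∈ M, ∀ e' ∈ M, e.1 = e'.1 → e = e') ∧ ∀ e ∈ M, ∀ e' ∈ M, e.2 = e'.2 → e = e' := by
  classical
  let cov : Finset (Finset V × Finset V) := (X.powerset ×ˢ Y.powerset).filter fun p =>
    ∀ x ∈ X, ∀ y ∈ Y, R x y → x ∈ p.1 ∨ y ∈ p.2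
  have hne : cov.Nonempty := ⟨(X, Y), by simp +contextual [cov]⟩
  -- In a minimum cover, replacing a violator of Hall's condition by its neighbourhood would give a
  -- smaller cover. Hence `A` can be matched into `Y \ B` and `B` into `X \ A`, and the two
  -- matchings have no common end.
  obtain ⟨⟨A, B⟩, hAB, hmin⟩ := Finset.exists_min_image cov (fun p => p.1.card + p.2.card) hne
  simp only [cov, Finset.mem_filter, Finset.mem_product, Finset.mem_powerset] at hAB
  obtain ⟨⟨hAX, hBY⟩, hAB⟩ := hAB
  have hN := h A B hAB
  have hallA : ∀ S : Finset A,
      S.card ≤ (S.biUnion fun a => (Y \ B).filter fun y => R a y).card := by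
    intro S
    by_contra hlt
    push Not at hlt
    set U := S.biUnion fun a => (Y \ B).filter fun y => R a y with hU
    have hS : (S.image Subtype.val).card = S.card :=
      Finset.card_image_of_injective _ Subtype.val_injective
    have hSA : S.image Subtype.val ⊆ A := fun x hx => by
      obtain ⟨a, -, rfl⟩ := Finset.mem_image.1 hx
      exact a.2
    have hcov : (A \ S.image Subtype.val, B ∪ U) ∈ cov := by
      simp only [cov, Finset.mem_filter, Finset.mem_product, Finset.mem_powerset]
      refine ⟨⟨Finset.sdiff_subset.trans hAX, Finset.union_subset hBY fun y hy => ?_⟩,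
        fun x hx y hy hxy => ?_⟩
      · obtain ⟨a, -, ha⟩ := Finset.mem_biUnion.1 hy
        exact (Finset.mem_sdiff.1 (Finset.mem_filter.1 ha).1).1
      · by_cases hyB : y ∈ B
        · exact Or.inr (Finset.mem_union_left _ hyB)
        · have hxA := (hAB x hx y hy hxy).resolve_right hyB
          by_cases hxS : x ∈ S.image Subtype.val
          · obtain ⟨a, ha, rfl⟩ := Finset.mem_image.1 hxS
            exact Or.inr (Finset.mem_union_right _ (Finset.mem_biUnion.2 ⟨a, ha,
              Finset.mem_filter.2 ⟨Finset.mem_sdiff.2 ⟨hy, hyB⟩, hxy⟩⟩))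
          · exact Or.inl (Finset.mem_sdiff.2 ⟨hxA, hxS⟩)
    have h1 := hmin _ hcov
    have h2 := Finset.card_sdiff_of_subset hSA
    have h3 := Finset.card_le_card hSA
    have h4 := Finset.card_union_le B U
    simp only at h1
    omega
  have hallB : ∀ S : Finset B,
      S.card ≤ (S.biUnion fun b => (X \ A).filter fun x => R x b).card := by
    intro S
    by_contra hlt
    push Not at hlt
    set U := S.biUnion fun b => (X \ A).filter fun x => R x b with hU
    have hS : (S.image Subtype.val).card = S.card :=
      Finset.card_image_of_injective _ Subtype.val_injective
    have hSB : S.image Subtype.val ⊆ B := fun x hx => by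
      obtain ⟨a, -, rfl⟩ := Finset.mem_image.1 hx
      exact a.2
    have hcov : (A ∪ U, B \ S.image Subtype.val) ∈ cov := by
      simp only [cov, Finset.mem_filter, Finset.mem_product, Finset.mem_powerset]
      refine ⟨⟨Finset.union_subset hAX fun y hy => ?_, Finset.sdiff_subset.trans hBY⟩,
        fun x hx y hy hxy => ?_⟩
      · obtain ⟨a, -, ha⟩ := Finset.mem_biUnion.1 hy
        exact (Finset.mem_sdiff.1 (Finset.mem_filter.1 ha).1).1
      · by_cases hxA : x ∈ A
        · exact Or.inl (Finset.mem_union_left _ hxA)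
        · have hyB := (hAB x hx y hy hxy).resolve_left hxA
          by_cases hyS : y ∈ S.image Subtype.val
          · obtain ⟨b, hb, rfl⟩ := Finset.mem_image.1 hyS
            exact Or.inl (Finset.mem_union_right _ (Finset.mem_biUnion.2 ⟨b, hb,
              Finset.mem_filter.2 ⟨Finset.mem_sdiff.2 ⟨hx, hxA⟩, hxy⟩⟩))
          · exact Or.inr (Finset.mem_sdiff.2 ⟨hyB, hyS⟩)
    have h1 := hmin _ hcov
    have h2 := Finset.card_sdiff_of_subset hSB
    have h3 := Finset.card_le_card hSB
    have h4 := Finset.card_union_le A U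
    simp only at h1
    omega
  obtain ⟨f, hf, hf'⟩ := (Finset.all_card_le_biUnion_card_iff_exists_injective _).1 hallA
  obtain ⟨g, hg, hg'⟩ := (Finset.all_card_le_biUnion_card_iff_exists_injective _).1 hallB
  simp only [Finset.mem_filter, Finset.mem_sdiff] at hf' hg'
  let M₁ : Finset (V × V) := Finset.univ.image fun a : A => (a.1, f a)
  let M₂ : Finset (V × V) := Finset.univ.image fun b : B => (g b, b.1)
  have hM₁ : M₁.card = A.card := by
    rw [Finset.card_image_of_injective _ fun a b hab => Subtype.ext (congrArg Prod.fst hab)]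
    simp
  have hM₂ : M₂.card = B.card := by
    rw [Finset.card_image_of_injective _ fun a b hab => Subtype.ext (congrArg Prod.snd hab)]
    simp
  have hdisj : Disjoint M₁ M₂ := by
    rw [Finset.disjoint_left]
    intro e he he'
    obtain ⟨a, -, rfl⟩ := Finset.mem_image.1 he
    obtain ⟨b, -, hb⟩ := Finset.mem_image.1 he'
    have := congrArg Prod.fst hb
    simp only at this
    exact (hg' b).1.2 (this ▸ a.2)
  obtain ⟨M, hM, hMcard⟩ := Finset.exists_subset_card_eq
    (show N ≤ (M₁ ∪ M₂).card by rw [Finset.card_union_of_disjoint hdisj]; omega)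
  refine ⟨M, hMcard, fun e he => ?_, fun e he e' he' hee => ?_, fun e he e' he' hee => ?_⟩
  · rcases Finset.mem_union.1 (hM he) with h | h
    · obtain ⟨a, -, rfl⟩ := Finset.mem_image.1 h
      exact ⟨hAX a.2, (hf' a).1.1, (hf' a).2⟩
    · obtain ⟨b, -, rfl⟩ := Finset.mem_image.1 h
      exact ⟨(hg' b).1.1, hBY b.2, (hg' b).2⟩
  · rcases Finset.mem_union.1 (hM he) with h | h <;>
      rcases Finset.mem_union.1 (hM he') with h' | h' <;>
      obtain ⟨a, -, rfl⟩ := Finset.mem_image.1 h <;>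
      obtain ⟨a', -, rfl⟩ := Finset.mem_image.1 h' <;>
      simp only at hee
    · rw [Subtype.ext hee]
    · exact absurd (hee ▸ a.2) (hg' a').1.2
    · exact absurd (hee ▸ a'.2) (hg' a).1.2
    · rw [hg hee]
  · rcases Finset.mem_union.1 (hM he) with h | h <;>
      rcases Finset.mem_union.1 (hM he') with h' | h' <;>
      obtain ⟨a, -, rfl⟩ := Finset.mem_image.1 h <;>
      obtain ⟨a', -, rfl⟩ := Finset.mem_image.1 h' <;>
      simp only at hee
    · rw [hf hee]
    · exact absurd (hee ▸ a'.2) (hf' a).1.2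
    · exact absurd (hee ▸ a.2) (hf' a').1.2
    · rw [Subtype.ext hee]

/-- A matching of edges that lead from the side `true` to the side `false`, where an end may also
be a vertex of `E true`, but not both ends of the same edge. -/
structure IsLinkMatching (G : Digraph V) (P E : Bool → Finset V) (M : Finset (V × V)) : Prop where
  adj : ∀ e ∈ M, G.Adj e.1 e.2
  fst_mem : ∀ e ∈ M, e.1 ∈ P true ∨ e.1 ∈ E true
  snd_mem : ∀ e ∈ M, e.2 ∈ P false ∨ e.2 ∈ E true
  not_both : ∀ e ∈ M, e.1 ∈ E true → e.2 ∉ E true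
  fst_inj : ∀ e ∈ M, ∀ e' ∈ M, e.1 = e'.1 → e = e'
  snd_inj : ∀ e ∈ M, ∀ e' ∈ M, e.2 = e'.2 → e = e'

theorem IsLinkMatching.mono {G : Digraph V} {P E : Bool → Finset V} {M M' : Finset (V × V)}
    (h : G.IsLinkMatching P E M) (hM : M' ⊆ M) : G.IsLinkMatching P E M' :=
  ⟨fun e he => h.adj e (hM he), fun e he => h.fst_mem e (hM he), fun e he => h.snd_mem e (hM he),
    fun e he => h.not_both e (hM he), fun e he e' he' => h.fst_inj e (hM he) e' (hM he'),
    fun e he e' he' => h.snd_inj e (hM he) e' (hM he')⟩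

/-- By König's theorem it is enough to bound covers. A cover that is too small misses some `x` in `P
false` and some `y` in `P true`. It then contains all inneighbours of `x` in `P true ∪ E true` and
all outneighbours of `y` in `P false ∪ E true`, and adding the semidegree conditions at `x` and `y`
gives at least `|E true| - |E false| + 2` of them. -/
theorem Layout.exists_linkMatching [Fintype V] {G : Digraph V} {P Q E : Bool → Finset V} {κ D : ℕ}
    (L : G.Layout P Q E κ D) : ∃ M : Finset (V × V), G.IsLinkMatching P E M ∧
      M.card + (E false).card = (E true).card + 2 := by
  classical
  have hκ := L.large
  have hκD := L.κ_le
  have hDn := L.D_le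
  have hs0 := L.size false
  have hs1 := L.size true
  have hce := L.card_eq
  have hE := L.E_le
  have hexc := L.exc
  have hadd : ∀ s x c, G.sDeg s (P c ∪ E true) x = G.sDeg s (P c) x + G.sDeg s (E true) x := by
    intro s x c
    simp only [sDeg]
    rw [Finset.filter_union, Finset.card_union_of_disjoint
      (Finset.disjoint_filter_filter (L.disj_PE _ _))]
  obtain ⟨M, hM, h1, h2, h3⟩ := exists_matching_of_covers (X := P true ∪ E true)
    (Y := P false ∪ E true) (fun y x => G.Adj y x ∧ ¬ (y ∈ E true ∧ x ∈ E true))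
    ((E true).card + 2 - (E false).card) (by
      intro A B hAB
      by_contra hlt
      obtain ⟨x, hx, hxB⟩ := Finset.exists_mem_notMem_of_card_lt_card
        (show B.card < (P false).card by omega)
      obtain ⟨y, hy, hyA⟩ := Finset.exists_mem_notMem_of_card_lt_card
        (show A.card < (P true).card by omega)
      have a1 : G.sDeg false (P true ∪ E true) x ≤ A.card := by
        refine Finset.card_le_card fun v hv => ?_
        rw [Finset.mem_filter, sAdj_false] at hv
        exact (hAB v hv.1 x (Finset.mem_union_left _ hx) ⟨hv.2, fun h => L.notMem_P h.2 _ hx⟩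
          ).resolve_right hxB
      have a2 : G.sDeg true (P false ∪ E true) y ≤ B.card := by
        refine Finset.card_le_card fun v hv => ?_
        rw [Finset.mem_filter, sAdj_true] at hv
        exact (hAB y (Finset.mem_union_left _ hy) v hv.1 ⟨hv.2, fun h => L.notMem_P h.1 _ hy⟩
          ).resolve_left hyA
      rw [hadd] at a1 a2
      have a3 := L.card_add_two_le false hx
      have a4 := L.card_add_two_le true hy
      have a5 : G.sDeg false (E false) x ≤ _ := sDeg_le_card
      have a6 : G.sDeg true (E false) y ≤ _ := sDeg_le_card
      simp only [Bool.not_false, Bool.not_true] at a3 a4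
      omega)
  refine ⟨M, ⟨fun e he => (h1 e he).2.2.1, fun e he => Finset.mem_union.1 (h1 e he).1,
    fun e he => Finset.mem_union.1 (h1 e he).2.1, fun e he h h' => (h1 e he).2.2.2 ⟨h, h'⟩, h2, h3⟩,
    by omega⟩

open Classical in
/-- The vertex `v` together with its partner behind it, and, for a vertex of `E true`, also the
partner in front of it. -/
noncomputable def piece (E : Bool → Finset V) (M : Finset (V × V)) (v : V) : Finset V :=
  insert v (((M.filter fun e => e.1 = v).image Prod.snd) ∪
    ((M.filter fun e => e.2 = v ∧ v ∈ E true).image Prod.fst))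

open Classical in
/-- The vertices of `E true` that are the end of an edge of `M`. -/
noncomputable def linkHeads (E : Bool → Finset V) (M : Finset (V × V)) : Finset V :=
  (E true).filter fun v => ∃ y, (y, v) ∈ M

open Classical in
/-- The vertices of `E true` that are the start of an edge of `M`. -/
noncomputable def linkTails (E : Bool → Finset V) (M : Finset (V × V)) : Finset V :=
  (E true).filter fun v => ∃ x, (v, x) ∈ M

open Classical in
/-- The vertices of the side `true` that are joined by `M` to the side `false`. -/
noncomputable def linkStarts (P : Bool → Finset V) (M : Finset (V × V)) : Finset V :=
  (P true).filter fun v => ∃ x ∈ P false, (v, x) ∈ M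

section

variable {P E : Bool → Finset V} {M : Finset (V × V)} {u v : V}

theorem mem_piece : u ∈ piece E M v ↔ u = v ∨ (v, u) ∈ M ∨ ((u, v) ∈ M ∧ v ∈ E true) := by
  classical
  simp only [piece, Finset.mem_insert, Finset.mem_union, Finset.mem_image, Finset.mem_filter,
    Prod.exists]
  constructor
  · rintro (h | ⟨a, b, ⟨h1, rfl⟩, rfl⟩ | ⟨a, b, ⟨h1, rfl, h2⟩, rfl⟩)
    · exact Or.inl h
    · exact Or.inr (Or.inl h1)
    · exact Or.inr (Or.inr ⟨h1, h2⟩)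
  · rintro (h | h | ⟨h1, h2⟩)
    · exact Or.inl h
    · exact Or.inr (Or.inl ⟨v, u, ⟨h, rfl⟩, rfl⟩)
    · exact Or.inr (Or.inr ⟨u, v, ⟨h1, rfl, h2⟩, rfl⟩)

theorem mem_linkHeads : v ∈ linkHeads E M ↔ v ∈ E true ∧ ∃ y, (y, v) ∈ M := by
  classical
  exact Finset.mem_filter

theorem mem_linkTails : v ∈ linkTails E M ↔ v ∈ E true ∧ ∃ x, (v, x) ∈ M := by
  classical
  exact Finset.mem_filter

theorem mem_linkStarts : v ∈ linkStarts P M ↔ v ∈ P true ∧ ∃ x ∈ P false, (v, x) ∈ M := by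
  classical
  exact Finset.mem_filter

variable [Fintype V] {G : Digraph V} {Q : Bool → Finset V} {κ D z : ℕ}

/-- No edge has both ends in `E true`, so each edge is of exactly one of three kinds: ending in `E
true`, starting in `E true`, or joining the sides. -/
theorem Layout.card_linkMatching (L : G.Layout P Q E κ D)
    (hM : G.IsLinkMatching P E M) :
    M.card = (linkStarts P M).card + (linkHeads E M).card + (linkTails E M).card := by
  classical
  let M₁ := M.filter fun e => e.2 ∈ E true
  let M₂ := M.filter fun e => e.1 ∈ E true
  let M₃ := M.filter fun e => e.1 ∈ P true ∧ e.2 ∈ P false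
  have h1 : M₁.card = (linkHeads E M).card := by
    refine Finset.card_bij (fun e _ => e.2) (fun e he => ?_) (fun e he e' he' h => ?_)
      fun v hv => ?_
    · rw [Finset.mem_filter] at he
      exact mem_linkHeads.2 ⟨he.2, e.1, he.1⟩
    · exact hM.snd_inj e (Finset.mem_filter.1 he).1 e' (Finset.mem_filter.1 he').1 h
    · obtain ⟨h1, y, h2⟩ := mem_linkHeads.1 hv
      exact ⟨(y, v), Finset.mem_filter.2 ⟨h2, h1⟩, rfl⟩
  have h2 : M₂.card = (linkTails E M).card := by
    refine Finset.card_bij (fun e _ => e.1) (fun e he => ?_) (fun e he e' he' h => ?_)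
      fun v hv => ?_
    · rw [Finset.mem_filter] at he
      exact mem_linkTails.2 ⟨he.2, e.2, he.1⟩
    · exact hM.fst_inj e (Finset.mem_filter.1 he).1 e' (Finset.mem_filter.1 he').1 h
    · obtain ⟨h1, y, h2⟩ := mem_linkTails.1 hv
      exact ⟨(v, y), Finset.mem_filter.2 ⟨h2, h1⟩, rfl⟩
  have h3 : M₃.card = (linkStarts P M).card := by
    refine Finset.card_bij (fun e _ => e.1) (fun e he => ?_) (fun e he e' he' h => ?_)
      fun v hv => ?_
    · rw [Finset.mem_filter] at he
      exact mem_linkStarts.2 ⟨he.2.1, e.2, he.2.2, he.1⟩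
    · exact hM.fst_inj e (Finset.mem_filter.1 he).1 e' (Finset.mem_filter.1 he').1 h
    · obtain ⟨h1, y, h2, h3⟩ := mem_linkStarts.1 hv
      exact ⟨(v, y), Finset.mem_filter.2 ⟨h3, h1, h2⟩, rfl⟩
  have h4 : M = M₃ ∪ (M₁ ∪ M₂) := by
    ext e
    simp only [M₁, M₂, M₃, Finset.mem_union, Finset.mem_filter]
    constructor
    · intro he
      rcases hM.fst_mem e he with h | h <;> rcases hM.snd_mem e he with h' | h' <;> tauto
    · tauto
  have h5 : Disjoint M₁ M₂ := by
    rw [Finset.disjoint_left]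
    intro e he he'
    exact hM.not_both e (Finset.mem_filter.1 he).1 (Finset.mem_filter.1 he').2
      (Finset.mem_filter.1 he).2
  have h6 : Disjoint M₃ (M₁ ∪ M₂) := by
    rw [Finset.disjoint_left]
    intro e he he'
    have h7 := (Finset.mem_filter.1 he).2
    rcases Finset.mem_union.1 he' with h | h
    · exact L.notMem_P (Finset.mem_filter.1 h).2 _ h7.2
    · exact L.notMem_P (Finset.mem_filter.1 h).2 _ h7.1
  have h7 := congrArg Finset.card h4
  rw [Finset.card_union_of_disjoint h6, Finset.card_union_of_disjoint h5] at h7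
  omega

/-- The representatives of the pieces of a matching. -/
def IsPieceRep (P E : Bool → Finset V) (M : Finset (V × V)) (v : V) : Prop :=
  v ∈ E false ∨ v ∈ E true ∨ v ∈ linkStarts P M

/-- The components of the matching are single edges and paths of two edges whose middle vertex lies
in `E true`. Each contains exactly one representative: its vertex of `E true` if there is one, and
otherwise its start on the side `true`. -/
theorem Layout.disjoint_piece (L : G.Layout P Q E κ D) (hM : G.IsLinkMatching P E M) {v v' : V}
    (hv : IsPieceRep P E M v) (hv' : IsPieceRep P E M v') (hne : v ≠ v') :
    Disjoint (piece E M v) (piece E M v') := by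
  have key : ∀ {v v' : V}, IsPieceRep P E M v → v ≠ v' → (v, v') ∈ M → IsPieceRep P E M v' →
      v ∈ E true := by
    intro v v' hv hne h hv'
    rcases hM.fst_mem _ h with h1 | h1
    · exfalso
      have h2 : v ∈ linkStarts P M := by
        rcases hv with h3 | h3 | h3
        · exact absurd h1 (L.notMem_P h3 _)
        · exact absurd h1 (L.notMem_P h3 _)
        · exact h3
      obtain ⟨-, x, hx, hvx⟩ := mem_linkStarts.1 h2
      have h4 := hM.fst_inj _ h _ hvx rfl
      simp only [Prod.mk.injEq, true_and] at h4
      subst h4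
      rcases hv' with h3 | h3 | h3
      · exact L.notMem_P h3 _ hx
      · exact L.notMem_P h3 _ hx
      · simpa using L.eq_of_mem hx (mem_linkStarts.1 h3).1
    · exact h1
  have no : ∀ {v v' : V}, IsPieceRep P E M v → IsPieceRep P E M v' → v ≠ v' → (v, v') ∉ M := by
    intro v v' hv hv' hne h
    have h1 := key hv hne h hv'
    have h2 := hM.not_both _ h h1
    have h3 := (hM.snd_mem _ h).resolve_right h2
    rcases hv' with h4 | h4 | h4
    · exact L.notMem_P h4 _ h3
    · exact h2 h4
    · simpa using L.eq_of_mem h3 (mem_linkStarts.1 h4).1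
  have no2 : ∀ {u v v' : V}, (v, u) ∈ M → (u, v') ∈ M → v' ∈ E true → False := by
    intro u v v' h h' hv'
    have h1 : u ∈ P true := (hM.fst_mem _ h').resolve_right fun h2 => hM.not_both _ h' h2 hv'
    rcases hM.snd_mem _ h with h2 | h2
    · simpa using L.eq_of_mem h1 h2
    · exact L.notMem_P h2 _ h1
  rw [Finset.disjoint_left]
  intro u hu hu'
  rw [mem_piece] at hu hu'
  rcases hu with rfl | h | ⟨h, hE⟩ <;> rcases hu' with rfl | h' | ⟨h', hE'⟩
  · exact hne rfl
  · exact no hv' hv (Ne.symm hne) h'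
  · exact no hv hv' hne h'
  · exact no hv hv' hne h
  · exact hne (congrArg Prod.fst (hM.snd_inj _ h _ h' rfl))
  · exact no2 h h' hE'
  · exact no hv' hv (Ne.symm hne) h
  · exact no2 h' h hE
  · exact hne (congrArg Prod.snd (hM.fst_inj _ h _ h' rfl))

omit [Fintype V] in
theorem piece_card_le (hM : G.IsLinkMatching P E M) (v : V) : (piece E M v).card ≤ 3 := by
  classical
  have h1 : ((M.filter fun e => e.1 = v).image Prod.snd).card ≤ 1 := by
    refine Finset.card_image_le.trans (Finset.card_le_one.2 fun e he e' he' => ?_)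
    rw [Finset.mem_filter] at he he'
    exact hM.fst_inj _ he.1 _ he'.1 (he.2.trans he'.2.symm)
  have h2 : ((M.filter fun e => e.2 = v ∧ v ∈ E true).image Prod.fst).card ≤ 1 := by
    refine Finset.card_image_le.trans (Finset.card_le_one.2 fun e he e' he' => ?_)
    rw [Finset.mem_filter] at he he'
    exact hM.snd_inj _ he.1 _ he'.1 (he.2.1.trans he'.2.1.symm)
  refine (Finset.card_insert_le _ _).trans ?_
  have h3 := Finset.card_union_le ((M.filter fun e => e.1 = v).image Prod.snd)
    ((M.filter fun e => e.2 = v ∧ v ∈ E true).image Prod.fst)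
  omega

open Classical in
/-- The representatives of the pieces that lead from the side `true` to the side `false`. -/
noncomputable def crossers (P E : Bool → Finset V) (M : Finset (V × V)) : Finset V :=
  E false ∪ (linkStarts P M ∪ (linkHeads E M ∩ linkTails E M))

open Classical in
/-- The vertices of `E true` outside the matching. -/
noncomputable def unlinked (E : Bool → Finset V) (M : Finset (V × V)) : Finset V :=
  E true \ (linkHeads E M ∪ linkTails E M)

theorem Layout.piece_eq_of_mem_false (L : G.Layout P Q E κ D) (hM : G.IsLinkMatching P E M)
    (hv : v ∈ E false) : piece E M v = {v} := by
  ext u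
  rw [mem_piece, Finset.mem_singleton]
  refine ⟨?_, Or.inl⟩
  rintro (h | h | ⟨-, h⟩)
  · exact h
  · rcases hM.fst_mem _ h with h1 | h1
    · exact absurd h1 (L.notMem_P hv _)
    · exact absurd h1 (Finset.disjoint_left.1 L.disj_E hv)
  · exact absurd h (Finset.disjoint_left.1 L.disj_E hv)

omit [Fintype V] in
theorem piece_eq_of_unlinked (hv : v ∈ unlinked E M) : piece E M v = {v} := by
  classical
  simp only [unlinked, Finset.mem_sdiff, Finset.mem_union, not_or, mem_linkHeads,
    mem_linkTails] at hv
  obtain ⟨hE, h1, h2⟩ := hv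
  ext u
  rw [mem_piece, Finset.mem_singleton]
  refine ⟨?_, Or.inl⟩
  rintro (h | h | ⟨h, -⟩)
  · exact h
  · exact absurd ⟨hE, u, h⟩ h2
  · exact absurd ⟨hE, u, h⟩ h1

theorem Layout.isCrosser_piece [DecidableEq V] (L : G.Layout P Q E κ D)
    (hM : G.IsLinkMatching P E M) (hz : z + 12 < D) (hv : v ∈ crossers P E M) :
    G.IsCrosser P Q (piece E M v) z := by
  classical
  simp only [crossers, Finset.mem_union, Finset.mem_inter] at hv
  rcases hv with hv | hv | ⟨hv, hv'⟩
  · rw [L.piece_eq_of_mem_false hM hv]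
    exact isCrosser_single L hz hv
  · obtain ⟨h1, x, hx, hvx⟩ := mem_linkStarts.1 hv
    have : piece E M v = {v, x} := by
      ext u
      rw [mem_piece, Finset.mem_insert, Finset.mem_singleton]
      refine or_congr_right ⟨?_, fun h => Or.inl (h ▸ hvx)⟩
      rintro (h | ⟨-, h⟩)
      · exact congrArg Prod.snd (hM.fst_inj _ h _ hvx rfl)
      · exact absurd h1 (L.notMem_P h _)
    rw [this]
    exact isCrosser_pair L hz h1 hx (hM.adj _ hvx)
  · obtain ⟨hE, y, hy⟩ := mem_linkHeads.1 hv
    obtain ⟨-, x, hx⟩ := mem_linkTails.1 hv'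
    have : piece E M v = {y, v, x} := by
      ext u
      rw [mem_piece, Finset.mem_insert, Finset.mem_insert, Finset.mem_singleton]
      constructor
      · rintro (h | h | ⟨h, -⟩)
        · exact Or.inr (Or.inl h)
        · exact Or.inr (Or.inr (congrArg Prod.snd (hM.fst_inj _ h _ hx rfl)))
        · exact Or.inl (congrArg Prod.fst (hM.snd_inj _ h _ hy rfl))
      · rintro (h | h | h)
        · exact Or.inr (Or.inr ⟨h ▸ hy, hE⟩)
        · exact Or.inl h
        · exact Or.inr (Or.inl (h ▸ hx))
    rw [this]
    exact isCrosser_triple L hz ((hM.fst_mem _ hy).resolve_right fun h => hM.not_both _ hy h hE) hE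
      ((hM.snd_mem _ hx).resolve_right (hM.not_both _ hx hE)) (hM.adj _ hy) (hM.adj _ hx)

theorem Layout.feasN_piece_head [DecidableEq V] (L : G.Layout P Q E κ D)
    (hM : G.IsLinkMatching P E M) (hz : z + 12 < D) (hv : v ∈ linkHeads E M)
    (hv' : v ∉ linkTails E M) {σ : ℕ → Bool} {s : Bool} (hσ : ∀ j ≤ 10, σ j = s) :
    G.FeasN P Q σ true true (piece E M v) 11 z := by
  obtain ⟨hE, y, hy⟩ := mem_linkHeads.1 hv
  have : piece E M v = {v, y} := by
    ext u
    rw [mem_piece, Finset.mem_insert, Finset.mem_singleton]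
    refine or_congr_right ⟨?_, fun h => Or.inr ⟨h ▸ hy, hE⟩⟩
    rintro (h | ⟨h, -⟩)
    · exact absurd (mem_linkTails.2 ⟨hE, u, h⟩) hv'
    · exact congrArg Prod.fst (hM.snd_inj _ h _ hy rfl)
  rw [this]
  exact feasN_unnatural (c := true) (s := false) L hz hE
    ((hM.fst_mem _ hy).resolve_right fun h => hM.not_both _ hy h hE) rfl
    (by simpa using hM.adj _ hy) hσ

theorem Layout.feasN_piece_tail [DecidableEq V] (L : G.Layout P Q E κ D)
    (hM : G.IsLinkMatching P E M) (hz : z + 12 < D) (hv : v ∈ linkTails E M)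
    (hv' : v ∉ linkHeads E M) {σ : ℕ → Bool} {s : Bool} (hσ : ∀ j ≤ 10, σ j = s) :
    G.FeasN P Q σ false false (piece E M v) 0 z := by
  obtain ⟨hE, y, hy⟩ := mem_linkTails.1 hv
  have : piece E M v = {v, y} := by
    ext u
    rw [mem_piece, Finset.mem_insert, Finset.mem_singleton]
    refine or_congr_right ⟨?_, fun h => Or.inl (h ▸ hy)⟩
    rintro (h | ⟨h, -⟩)
    · exact congrArg Prod.snd (hM.fst_inj _ h _ hy rfl)
    · exact absurd (mem_linkHeads.2 ⟨hE, u, h⟩) hv'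
  rw [this]
  exact feasN_unnatural (c := false) (s := true) L hz hE
    ((hM.snd_mem _ hy).resolve_right (hM.not_both _ hy hE)) rfl
    (by simpa using hM.adj _ hy) hσ

/-- Every matching edge contributes one to the surplus of crossers over unlinked vertices: an edge
between the sides is a crosser, the first edge at a vertex of `E true` makes it linked, and a second
one makes it a crosser. -/
theorem Layout.card_crossers (L : G.Layout P Q E κ D)
    (hM : G.IsLinkMatching P E M) : (crossers P E M).card + (E true).card =
      (unlinked E M).card + M.card + (E false).card := by
  classical
  have h1 := L.card_linkMatching hM
  have hI : linkHeads E M ⊆ E true := fun v hv => (mem_linkHeads.1 hv).1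
  have hO : linkTails E M ⊆ E true := fun v hv => (mem_linkTails.1 hv).1
  have h2 : (unlinked E M).card = (E true).card - (linkHeads E M ∪ linkTails E M).card :=
    Finset.card_sdiff_of_subset (Finset.union_subset hI hO)
  have h3 := Finset.card_le_card (Finset.union_subset hI hO)
  have h4 := Finset.card_union_add_card_inter (linkHeads E M) (linkTails E M)
  have h5 : (crossers P E M).card =
      (E false).card + ((linkStarts P M).card + (linkHeads E M ∩ linkTails E M).card) := by
    unfold crossers
    rw [Finset.card_union_of_disjoint, Finset.card_union_of_disjoint]
    · rw [Finset.disjoint_left]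
      intro v hv hv'
      exact L.notMem_P (hI (Finset.mem_inter.1 hv').1) _ (mem_linkStarts.1 hv).1
    · rw [Finset.disjoint_left]
      intro v hv hv'
      rcases Finset.mem_union.1 hv' with h | h
      · exact L.notMem_P hv _ (mem_linkStarts.1 h).1
      · exact Finset.disjoint_left.1 L.disj_E hv (hI (Finset.mem_inter.1 h).1)
  omega

end

/-! ### Embeddings for patterns with few sign changes -/

/-- If the sign changes rarely, then most stretches of a given length have constant sign. -/
theorem exists_card_le_of_not_constant (W : ℕ → Bool) (ℓ x y : ℕ) : ∃ Z : Finset ℕ,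
    Z.card ≤ (turns W true x (y + ℓ) + turns W false x (y + ℓ)) * ℓ ∧
      ∀ q, x ≤ q → q < y → q ∉ Z → ∀ j ≤ ℓ, W (q + j) = W q := by
  classical
  let C := (Finset.Ico x (y + ℓ)).filter fun p => W p ≠ W (p + 1)
  have hC : C.card ≤ turns W true x (y + ℓ) + turns W false x (y + ℓ) := by
    refine (Finset.card_le_card fun p hp => ?_).trans (Finset.card_union_le _ _)
    rw [Finset.mem_filter] at hp
    rw [Finset.mem_union, Finset.mem_filter, Finset.mem_filter]
    cases h1 : W p <;> cases h2 : W (p + 1) <;> simp_all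
  -- A change after position `p` spoils only the starting points `p + 1 - ℓ, …, p`.
  refine ⟨C.biUnion fun p => Finset.Ico (p + 1 - ℓ) (p + 1),
    (Finset.card_biUnion_le_card_mul _ _ _ fun p _ => by
      rw [Nat.card_Ico]; omega).trans (Nat.mul_le_mul_right ℓ hC), fun q hx hy hq j hj => ?_⟩
  induction j with
  | zero => rfl
  | succ j ih =>
    rw [← ih (by omega)]
    by_contra hne
    refine hq (Finset.mem_biUnion.2 ⟨q + j, ?_, ?_⟩)
    · rw [Finset.mem_filter, Finset.mem_Ico]
      exact ⟨by omega, fun h => hne h.symm⟩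
    · rw [Finset.mem_Ico]
      omega

section

variable [Fintype V] [DecidableEq V] {G : Digraph V} {P Q E : Bool → Finset V} {κ D : ℕ}
  {M : Finset (V × V)}

set_option maxHeartbeats 1000000 in
/-- Embedding when the signs change rarely: every vertex of `B` outside the matching is combined
with a piece that leads back, except that two pieces are kept for the changes of side. -/
theorem Layout.hasSignedCycle_of_pieces (L : G.Layout P Q E κ D) {n : ℕ}
    (hn : Fintype.card V = n) (w : ZMod n → Bool)
    (hσ : turns (fun j => w (j : ZMod n)) true 0 n < 400 * κ) (hM : G.IsLinkMatching P E M)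
    {B C : Finset V} (hB : B ⊆ unlinked E M) (hC : C ⊆ crossers P E M) (hBC : B.card = C.card)
    {v₁ v₂ : V} (hne : v₁ ≠ v₂)
    (hv : ∀ v, v = v₁ ∨ v = v₂ ↔ (v ∈ unlinked E M ∧ v ∉ B) ∨ (v ∈ crossers P E M ∧ v ∉ C))
    (m : ℕ)
    (hF₁ : G.FeasN P Q (fun j => w ((14 + j : ℕ) : ZMod n)) false true (piece E M v₁) 6 (100 * κ))
    (hF₂ : G.FeasN P Q (fun j => w ((14 + m + j : ℕ) : ZMod n)) true false (piece E M v₂) 6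
      (100 * κ))
    (hm : n ≤ 3 * m) (hmn : 3 * m ≤ 2 * n)
    (hcount : m + 3 * B.card = (P true).card + (linkHeads E M \ linkTails E M).card) :
    G.HasSignedCycle w := by
  classical
  have hκ := L.large
  have hκD := L.κ_le
  have hDn := L.D_le
  rw [hn] at hDn
  have hz : 100 * κ + 12 < D := by omega
  -- Every vertex of `B` leads from the side `false` to the side `true`; its partner under `g` is
  -- the crosser that leads back.
  obtain ⟨g, hgC, hginj, hgsurj⟩ : ∃ g : V → V, (∀ b ∈ B, g b ∈ C) ∧
      (∀ b ∈ B, ∀ b' ∈ B, g b = g b' → b = b') ∧ ∀ c ∈ C, ∃ b ∈ B, g b = c := by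
    let e := Finset.equivOfCardEq hBC
    refine ⟨fun v => if h : v ∈ B then (e ⟨v, h⟩).1 else v, fun b hb => ?_, fun b hb b' hb' h => ?_,
      fun c hc => ⟨(e.symm ⟨c, hc⟩).1, (e.symm ⟨c, hc⟩).2, ?_⟩⟩
    · simp only [hb, dif_pos]
      exact (e ⟨b, hb⟩).2
    · simp only [hb, hb', dif_pos] at h
      exact congrArg Subtype.val (e.injective (Subtype.ext h))
    · simp
  set H := linkHeads E M \ linkTails E M with hH
  set O := linkTails E M \ linkHeads E M with hO
  have hunl : ∀ v, v ∈ unlinked E M ↔ v ∈ E true ∧ v ∉ linkHeads E M ∧ v ∉ linkTails E M := by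
    intro v
    simp [unlinked]
  have hcr : ∀ v, v ∈ crossers P E M ↔
      v ∈ E false ∨ v ∈ linkStarts P M ∨ (v ∈ linkHeads E M ∧ v ∈ linkTails E M) := by
    intro v
    simp [crossers]
  have hHE : ∀ v ∈ H, v ∈ E true := fun v hv =>
    (mem_linkHeads.1 (Finset.mem_sdiff.1 hv).1).1
  have hOE : ∀ v ∈ O, v ∈ E true := fun v hv =>
    (mem_linkTails.1 (Finset.mem_sdiff.1 hv).1).1
  have hBE : ∀ v ∈ B, v ∈ E true := fun v hv => ((hunl v).1 (hB hv)).1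
  have hBH : ∀ v ∈ B, v ∉ H := fun v hv h =>
    ((hunl v).1 (hB hv)).2.1 (Finset.mem_sdiff.1 h).1
  -- vertices of `E true` that are handled by items are not crossers
  have hnc : ∀ v, v ∈ B ∨ v ∈ H ∨ v ∈ O → v ∈ crossers P E M → False := by
    intro v hv hc
    have hvE : v ∈ E true := by
      rcases hv with h | h | h
      exacts [hBE v h, hHE v h, hOE v h]
    rcases (hcr v).1 hc with h | h | h
    · exact Finset.disjoint_left.1 L.disj_E h hvE
    · exact L.notMem_P hvE _ (mem_linkStarts.1 h).1
    · rcases hv with h' | h' | h'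
      · exact ((hunl v).1 (hB h')).2.1 h.1
      · exact (Finset.mem_sdiff.1 h').2 h.2
      · exact (Finset.mem_sdiff.1 h').2 h.1
  have hrepE : ∀ v ∈ E true, IsPieceRep P E M v := fun v hv => Or.inr (Or.inl hv)
  have hrepC : ∀ v ∈ crossers P E M, IsPieceRep P E M v := by
    intro v hv
    rcases (hcr v).1 hv with h | h | h
    · exact Or.inl h
    · exact Or.inr (Or.inr h)
    · exact hrepE v (mem_linkHeads.1 h.1).1
  have hrep₁₂ : ∀ v, v = v₁ ∨ v = v₂ → IsPieceRep P E M v ∧ v ∉ B ∧ v ∉ H ∧ v ∉ O ∧ v ∉ C := by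
    intro v h
    rcases (hv v).1 h with h | h
    · have h1 := (hunl v).1 h.1
      refine ⟨hrepE v h1.1, h.2, fun h' => h1.2.1 (Finset.mem_sdiff.1 h').1,
        fun h' => h1.2.2 (Finset.mem_sdiff.1 h').1, fun h' => ?_⟩
      rcases (hcr v).1 (hC h') with h2 | h2 | h2
      · exact Finset.disjoint_left.1 L.disj_E h2 h1.1
      · exact L.notMem_P h1.1 _ (mem_linkStarts.1 h2).1
      · exact h1.2.1 h2.1
    · exact ⟨hrepC v h.1, fun h' => hnc v (Or.inl h') h.1, fun h' => hnc v (Or.inr (Or.inl h')) h.1,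
        fun h' => hnc v (Or.inr (Or.inr h')) h.1, h.2⟩
  have hself : ∀ v, v ∈ piece E M v := fun v => mem_piece.2 (Or.inl rfl)
  -- Windows are needed for the atypical vertices of the sides outside all pieces (`F`), for the
  -- pairs indexed by `B`, and for the vertices of `E true` with exactly one matching edge (`H` and
  -- `O`), which are inserted into the side of their matching partner.
  let F := Finset.univ.filter fun x => (x ∉ Q false ∧ x ∉ Q true) ∧
    ∀ r, IsPieceRep P E M r → x ∉ piece E M r
  let J := F ∪ (B ∪ (H ∪ O))
  have hmemJ : ∀ x, x ∈ J ↔ x ∈ F ∨ x ∈ B ∨ x ∈ H ∨ x ∈ O := fun x => by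
    simp [J]
  have hmemF : ∀ x, x ∈ F ↔ (x ∉ Q false ∧ x ∉ Q true) ∧
    ∀ r, IsPieceRep P E M r → x ∉ piece E M r := fun x => by simp [F]
  have hFE : ∀ x ∈ F, x ∉ E true := fun x hx h => ((hmemF x).1 hx).2 x (hrepE x h) (hself x)
  have hFP : ∀ x ∈ F, ∃ c, x ∈ P c := by
    intro x hx
    refine (L.cover x).resolve_right ?_
    rintro ⟨t, ht⟩
    refine ((hmemF x).1 hx).2 x ?_ (hself x)
    cases t
    · exact Or.inl ht
    · exact hrepE x ht
  have hJ : J.card ≤ 3 * κ := (Finset.card_le_card fun x hx => by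
    simp only [Finset.mem_filter, Finset.mem_univ, true_and]
    have hE : x ∈ E true → x ∉ Q false ∧ x ∉ Q true := fun h =>
      ⟨fun h' => L.notMem_P h _ (L.sub _ h'), fun h' => L.notMem_P h _ (L.sub _ h')⟩
    rcases (hmemJ x).1 hx with h | h | h | h
    exacts [((hmemF x).1 h).1, hE (hBE x h), hE (hHE x h), hE (hOE x h)]).trans L.card_bad_le
  -- the pieces used by an item
  let used : V → V → Prop := fun v r => (r = v ∧ v ∈ E true) ∨ (v ∈ B ∧ r = g v)
  let kit : V → Finset V := fun v => if v ∈ B then insert v (piece E M (g v)) else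
    if v ∈ E true then piece E M v else {v}
  have hkitB : ∀ v ∈ B, kit v = insert v (piece E M (g v)) := fun v hv => if_pos hv
  have hkitE : ∀ v ∈ E true, v ∉ B → kit v = piece E M v := fun v hv hv' => by
    simp [kit, hv, hv']
  have hkitF : ∀ v ∈ F, kit v = {v} := fun v hv => by
    have h1 := hFE v hv
    have h2 : v ∉ B := fun h => h1 (hBE v h)
    simp [kit, h1, h2]
  have hkit : ∀ v ∈ J, ∀ x ∈ kit v, (v ∈ F ∧ x = v) ∨
      ∃ r, used v r ∧ IsPieceRep P E M r ∧ x ∈ piece E M r := by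
    intro v hv x hx
    by_cases hvB : v ∈ B
    · rw [hkitB v hvB, Finset.mem_insert] at hx
      rcases hx with rfl | hx
      · exact Or.inr ⟨x, Or.inl ⟨rfl, hBE x hvB⟩, hrepE x (hBE x hvB), hself x⟩
      · exact Or.inr ⟨g v, Or.inr ⟨hvB, rfl⟩, hrepC _ (hC (hgC v hvB)), hx⟩
    · by_cases hvE : v ∈ E true
      · rw [hkitE v hvE hvB] at hx
        exact Or.inr ⟨v, Or.inl ⟨rfl, hvE⟩, hrepE v hvE, hx⟩
      · have hvF : v ∈ F := by
          rcases (hmemJ v).1 hv with h | h | h | h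
          exacts [h, absurd h hvB, absurd (hHE v h) hvE, absurd (hOE v h) hvE]
        rw [hkitF v hvF, Finset.mem_singleton] at hx
        exact Or.inl ⟨hvF, hx⟩
  have hJE : ∀ v ∈ J, v ∈ E true → v ∈ B ∨ v ∈ H ∨ v ∈ O := fun v hv hE =>
    ((hmemJ v).1 hv).resolve_left fun h => hFE v h hE
  have hused : ∀ v ∈ J, ∀ v' ∈ J, ∀ r, used v r → used v' r → v = v' := by
    rintro v hv v' hv' r (⟨rfl, h⟩ | ⟨h, rfl⟩) (⟨h', h''⟩ | ⟨h', h''⟩)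
    · exact h'
    · exact (hnc _ (hJE _ hv h) (h'' ▸ hC (hgC v' h'))).elim
    · exact (hnc _ (hJE _ hv' h'') (h' ▸ hC (hgC v h))).elim
    · exact hginj v h v' h' h''
  have hused₁₂ : ∀ v ∈ J, ∀ r, (r = v₁ ∨ r = v₂) → ¬ used v r := by
    rintro v hv r hr (⟨rfl, h⟩ | ⟨h, rfl⟩)
    · obtain ⟨-, h1, h2, h3, -⟩ := hrep₁₂ _ hr
      rcases hJE _ hv h with h' | h' | h' <;> contradiction
    · exact (hrep₁₂ _ hr).2.2.2.2 (hgC v h)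
  have hdisj₁₂ : ∀ r, (r = v₁ ∨ r = v₂) → ∀ v : J, Disjoint (kit v) (piece E M r) := by
    intro r hr v
    rw [Finset.disjoint_left]
    intro x hx hx'
    rcases hkit v v.2 x hx with ⟨h, rfl⟩ | ⟨r', h1, h2, h3⟩
    · exact ((hmemF _).1 h).2 r (hrep₁₂ r hr).1 hx'
    · refine Finset.disjoint_left.1 (L.disjoint_piece hM h2 (hrep₁₂ r hr).1 ?_) h3 hx'
      rintro rfl
      exact hused₁₂ v v.2 _ hr h1
  let side : V → Bool := fun x => decide (x ∈ P true ∨ x ∈ H)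
  -- A vertex of `H` takes a place on the arc of `P true` without belonging to `P true`, and the
  -- excursion of a pair uses three vertices of `P true` on the arc of `P false`. These are the two
  -- corrections in `hcount`.
  let τ : V → ℕ := fun x => if x ∈ P true then 12 else if x ∈ H then 11 else if x ∈ B then 3 else 0
  let win : Bool → Finset ℕ := fun c =>
    if c then Finset.Ico 27 (m + 2) else Finset.Ico (27 + m) (n - 12)
  let W : ℕ → Bool := fun j => w (j : ZMod n)
  have hclean : ∀ x y, 80000 * κ ≤ y - x → y + 10 ≤ n → ∃ S ⊆ Finset.Ico x y,
      75 * κ ≤ S.card ∧ ∀ q ∈ S, ∀ j ≤ 10, W (q + j) = W q := by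
    intro x y hxy hy
    obtain ⟨Z, h1, hZ⟩ := exists_card_le_of_not_constant W 10 x y
    have h2 := Finset.le_card_sdiff Z (Finset.Ico x y)
    have h3 := turns_mono (W := W) (s := true) (Nat.zero_le x) hy
    have h4 := turns_le_turns (W := W) (show x ≤ y + 10 by omega) false true
    have h5 : turns W true 0 n < 400 * κ := hσ
    rw [Nat.card_Ico] at h2
    refine ⟨Finset.Ico x y \ Z, Finset.sdiff_subset, by omega, fun q hq => ?_⟩
    rw [Finset.mem_sdiff, Finset.mem_Ico] at hq
    exact hZ q hq.1.1 hq.1.2 hq.2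
  have hCand : ∀ c, ∃ S ⊆ win c, 75 * κ ≤ S.card ∧ ∀ q ∈ S, ∀ j ≤ 10, W (q + j) = W q := by
    rintro (_ | _)
    · simp only [win, Bool.false_eq_true, if_false]
      exact hclean _ _ (by omega) (by omega)
    · simp only [win, if_true]
      exact hclean _ _ (by omega) (by omega)
  choose Cand hCwin hCcard hCcl using hCand
  refine L.hasSignedCycle_of_arcs hn w m (ι := J) (fun x => side x) (fun x => kit x)
    (fun x => τ x) (z := 100 * κ)
    (fun x => Cand (side x))
    ?_ ?_ ?_ (piece E M v₁) (piece E M v₂) 6 6 hF₁ hF₂ ?_ (hdisj₁₂ v₁ (Or.inl rfl))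
    (hdisj₁₂ v₂ (Or.inr rfl))
    (L.disjoint_piece hM (hrep₁₂ v₁ (Or.inl rfl)).1 (hrep₁₂ v₂ (Or.inr rfl)).1 hne) ?_
    ((piece_card_le hM _).trans (by omega)) ((piece_card_le hM _).trans (by omega)) ?_ ?_ ?_ ?_
  · rw [Fintype.card_coe]
    omega
  · intro x
    rw [Fintype.card_coe]
    have := hCcard (side x)
    omega
  · intro x q hq
    have hqw := hCwin _ hq
    have hcl := hCcl _ q hq
    refine ⟨fun h => ?_, fun h => ?_, ?_⟩
    · simp only [win, h, if_true, Finset.mem_Ico] at hqw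
      omega
    · simp only [win, h, Bool.false_eq_true, if_false, Finset.mem_Ico] at hqw
      omega
    · have hx := (hmemJ x).1 x.2
      by_cases hxE : x.1 ∈ E true
      · have hxP := L.notMem_P hxE true
        by_cases hxB : x.1 ∈ B
        · have hxH := hBH x hxB
          have h1 : side x = false := by simp [side, hxP, hxH]
          have h2 : τ x = 3 := by simp [τ, hxP, hxH, hxB]
          rw [h1, h2, hkitB x hxB]
          refine (L.isCrosser_piece hM hz (hC (hgC x hxB))).feasN_insert L hz hxE (fun h => ?_) hcl
          refine Finset.disjoint_left.1 (L.disjoint_piece hM (hrepE x hxE)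
            (hrepC _ (hC (hgC x hxB))) fun h' => ?_) (hself x) h
          exact hnc x (Or.inl hxB) (h' ▸ hC (hgC x hxB))
        · rw [hkitE x hxE hxB]
          by_cases hxH : x.1 ∈ H
          · have h1 : side x = true := by simp [side, hxH]
            have h2 : τ x = 11 := by simp [τ, hxP, hxH]
            rw [h1, h2]
            exact L.feasN_piece_head hM hz (Finset.mem_sdiff.1 hxH).1 (Finset.mem_sdiff.1 hxH).2
              hcl
          · have hxO : x.1 ∈ O := ((hJE x x.2 hxE).resolve_left hxB).resolve_left hxH
            have h1 : side x = false := by simp [side, hxP, hxH]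
            have h2 : τ x = 0 := by simp [τ, hxP, hxH, hxB]
            rw [h1, h2]
            exact L.feasN_piece_tail hM hz (Finset.mem_sdiff.1 hxO).1 (Finset.mem_sdiff.1 hxO).2
              hcl
      · have hxB : x.1 ∉ B := fun h => hxE (hBE x h)
        have hxH : x.1 ∉ H := fun h => hxE (hHE x h)
        have hxO : x.1 ∉ O := fun h => hxE (hOE x h)
        have hxF : x.1 ∈ F := by
          rcases hx with h | h | h | h
          exacts [h, absurd h hxB, absurd h hxH, absurd h hxO]
        obtain ⟨c, hc⟩ := hFP x hxF
        have h1 : side x = c := by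
          simp only [side, hxH, or_false]
          rw [Bool.eq_iff_iff, decide_eq_true_eq]
          exact L.mem_true_iff hc
        have h2 : τ x = if c then 12 else 0 := by
          simp only [τ, L.mem_true_iff hc, hxH, hxB, if_false]
        rw [h1, h2, hkitF x hxF]
        exact feasN_side L hz hc _
  · intro v v' hvv
    rw [Finset.disjoint_left]
    intro x hx hx'
    rcases hkit v v.2 x hx with ⟨h, h0⟩ | ⟨r, h1, h2, h3⟩ <;>
      rcases hkit v' v'.2 x hx' with ⟨h', h0'⟩ | ⟨r', h1', h2', h3'⟩
    · exact hvv (Subtype.ext (h0.symm.trans h0'))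
    · subst h0
      exact ((hmemF _).1 h).2 r' h2' h3'
    · subst h0'
      exact ((hmemF _).1 h').2 r h2 h3
    · by_cases hrr : r = r'
      · subst hrr
        exact hvv (Subtype.ext (hused v v.2 v' v'.2 r h1 h1'))
      · exact Finset.disjoint_left.1 (L.disjoint_piece hM h2 h2' hrr) h3 h3'
  · intro v
    by_cases hvB : v.1 ∈ B
    · rw [hkitB v hvB]
      have h1 := Finset.card_insert_le v.1 (piece E M (g v))
      have h2 := piece_card_le hM (g v)
      omega
    · simp only [kit, hvB, if_false]
      split_ifs
      · exact (piece_card_le hM _).trans (by omega)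
      · simp
  · intro x
    by_cases hxr : ∃ r, IsPieceRep P E M r ∧ x ∈ piece E M r
    · obtain ⟨r, hr, hx⟩ := hxr
      have hH' : r ∈ H → ∃ i : J, x ∈ kit i := fun h => by
        refine ⟨⟨r, (hmemJ r).2 (Or.inr (Or.inr (Or.inl h)))⟩, ?_⟩
        rw [hkitE r (hHE r h) fun h' => hBH r h' h]
        exact hx
      have hO' : r ∈ O → ∃ i : J, x ∈ kit i := fun h => by
        refine ⟨⟨r, (hmemJ r).2 (Or.inr (Or.inr (Or.inr h)))⟩, ?_⟩
        rw [hkitE r (hOE r h) fun h' => ((hunl r).1 (hB h')).2.2 (Finset.mem_sdiff.1 h).1]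
        exact hx
      have h₁₂ : (r = v₁ ∨ r = v₂) → x ∈ piece E M v₁ ∨ x ∈ piece E M v₂ := by
        rintro (rfl | rfl)
        exacts [Or.inl hx, Or.inr hx]
      have hC' : r ∈ crossers P E M → x ∈ piece E M v₁ ∨ x ∈ piece E M v₂ ∨ ∃ i : J, x ∈ kit i := by
        intro h
        by_cases hrC : r ∈ C
        · obtain ⟨b, hb, rfl⟩ := hgsurj r hrC
          refine Or.inr (Or.inr ⟨⟨b, (hmemJ b).2 (Or.inr (Or.inl hb))⟩, ?_⟩)
          rw [hkitB b hb]
          exact Finset.mem_insert_of_mem hx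
        · exact (h₁₂ ((hv r).2 (Or.inr ⟨h, hrC⟩))).imp_right Or.inl
      have hU' : r ∈ unlinked E M → x ∈ piece E M v₁ ∨ x ∈ piece E M v₂ ∨ ∃ i : J, x ∈ kit i := by
        intro h
        by_cases hrB : r ∈ B
        · refine Or.inr (Or.inr ⟨⟨r, (hmemJ r).2 (Or.inr (Or.inl hrB))⟩, ?_⟩)
          rw [hkitB r hrB]
          rw [piece_eq_of_unlinked h, Finset.mem_singleton] at hx
          rw [hx]
          exact Finset.mem_insert_self _ _
        · exact (h₁₂ ((hv r).2 (Or.inl ⟨h, hrB⟩))).imp_right Or.inl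
      right
      rcases hr with h | h | h
      · exact hC' ((hcr r).2 (Or.inl h))
      · by_cases h1 : r ∈ linkHeads E M <;> by_cases h2 : r ∈ linkTails E M
        · exact hC' ((hcr r).2 (Or.inr (Or.inr ⟨h1, h2⟩)))
        · exact Or.inr (Or.inr (hH' (Finset.mem_sdiff.2 ⟨h1, h2⟩)))
        · exact Or.inr (Or.inr (hO' (Finset.mem_sdiff.2 ⟨h2, h1⟩)))
        · exact hU' ((hunl r).2 ⟨h, h1, h2⟩)
      · exact hC' ((hcr r).2 (Or.inr (Or.inl h)))
    · push Not at hxr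
      by_cases h3 : ∃ c, x ∈ Q c
      · exact Or.inl h3
      · push Not at h3
        have hxF : x ∈ F := (hmemF x).2 ⟨⟨h3 _, h3 _⟩, hxr⟩
        refine Or.inr (Or.inr (Or.inr ⟨⟨x, (hmemJ x).2 (Or.inl hxF)⟩, ?_⟩))
        rw [hkitF x hxF]
        exact Finset.mem_singleton_self x
  · rw [Fintype.card_coe]
    omega
  · rw [Fintype.card_coe]
    omega
  · have hind : ∀ Y : Finset V, Y ⊆ J → Y.card = ∑ x : J, if x.1 ∈ Y then 1 else 0 := by
      intro Y hY
      rw [Finset.sum_coe_sort J fun x => if x ∈ Y then 1 else 0, ← Finset.card_filter,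
        Finset.filter_mem_eq_inter, Finset.inter_eq_right.2 hY]
    have hsum : ∑ x : J, τ x + H.card = ∑ x : J, (if side x then 12 else 0) + 3 * B.card := by
      rw [hind H fun x hx => (hmemJ x).2 (Or.inr (Or.inr (Or.inl hx))),
        hind B fun x hx => (hmemJ x).2 (Or.inr (Or.inl hx)), Finset.mul_sum,
        ← Finset.sum_add_distrib, ← Finset.sum_add_distrib]
      refine Finset.sum_congr rfl fun x _ => ?_
      simp only [side, τ]
      by_cases hP : x.1 ∈ P true
      · have h1 : x.1 ∉ H := fun h => L.notMem_P (hHE _ h) _ hP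
        have h2 : x.1 ∉ B := fun h => L.notMem_P (hBE _ h) _ hP
        simp [hP, h1, h2]
      · by_cases h1 : x.1 ∈ H
        · have h2 : x.1 ∉ B := fun h => hBH _ h h1
          simp [hP, h1, h2]
        · by_cases h2 : x.1 ∈ B <;> simp [hP, h1, h2]
    omega

end

section

variable {P E : Bool → Finset V} {M M' : Finset (V × V)}

theorem linkHeads_mono (h : M' ⊆ M) : linkHeads E M' ⊆ linkHeads E M := fun v hv => by
  obtain ⟨h1, y, h2⟩ := mem_linkHeads.1 hv
  exact mem_linkHeads.2 ⟨h1, y, h h2⟩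

theorem linkTails_mono (h : M' ⊆ M) : linkTails E M' ⊆ linkTails E M := fun v hv => by
  obtain ⟨h1, y, h2⟩ := mem_linkTails.1 hv
  exact mem_linkTails.2 ⟨h1, y, h h2⟩

theorem linkStarts_mono (h : M' ⊆ M) : linkStarts P M' ⊆ linkStarts P M := fun v hv => by
  obtain ⟨h1, y, h2, h3⟩ := mem_linkStarts.1 hv
  exact mem_linkStarts.2 ⟨h1, y, h2, h h3⟩

theorem mem_unlinked {v : V} :
    v ∈ unlinked E M ↔ v ∈ E true ∧ v ∉ linkHeads E M ∧ v ∉ linkTails E M := by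
  classical
  simp [unlinked]

theorem mem_crossers {v : V} : v ∈ crossers P E M ↔
    v ∈ E false ∨ v ∈ linkStarts P M ∨ (v ∈ linkHeads E M ∧ v ∈ linkTails E M) := by
  classical
  simp [crossers]

theorem IsLinkMatching.exists_avoiding {G : Digraph V} (hM : G.IsLinkMatching P E M) (b : V) :
    ∃ M' ⊆ M, M.card ≤ M'.card + 2 ∧ ∀ e ∈ M', e.1 ≠ b ∧ e.2 ≠ b := by
  classical
  refine ⟨M.filter fun e => e.1 ≠ b ∧ e.2 ≠ b, Finset.filter_subset _ _, ?_,
    fun e he => (Finset.mem_filter.1 he).2⟩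
  have h1 : (M.filter fun e => e.1 = b).card ≤ 1 := Finset.card_le_one.2 fun e he e' he' => by
    rw [Finset.mem_filter] at he he'
    exact hM.fst_inj _ he.1 _ he'.1 (he.2.trans he'.2.symm)
  have h2 : (M.filter fun e => e.2 = b).card ≤ 1 := Finset.card_le_one.2 fun e he e' he' => by
    rw [Finset.mem_filter] at he he'
    exact hM.snd_inj _ he.1 _ he'.1 (he.2.trans he'.2.symm)
  have h3 : M ⊆ (M.filter fun e => e.1 ≠ b ∧ e.2 ≠ b) ∪
      ((M.filter fun e => e.1 = b) ∪ (M.filter fun e => e.2 = b)) := fun e he => by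
    simp only [Finset.mem_union, Finset.mem_filter]
    tauto
  have h4 := Finset.card_le_card h3
  have h5 := Finset.card_union_le (M.filter fun e => e.1 ≠ b ∧ e.2 ≠ b)
    ((M.filter fun e => e.1 = b) ∪ (M.filter fun e => e.2 = b))
  have h6 := Finset.card_union_le (M.filter fun e => e.1 = b) (M.filter fun e => e.2 = b)
  omega

end

section

variable [Fintype V] [DecidableEq V] {G : Digraph V} {P Q E : Bool → Finset V} {κ D : ℕ}
  {M : Finset (V × V)}

omit [DecidableEq V] in
theorem Layout.disjoint_unlinked_crossers (L : G.Layout P Q E κ D) :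
    Disjoint (unlinked E M) (crossers P E M) := by
  rw [Finset.disjoint_left]
  intro v hv hv'
  have h1 := mem_unlinked.1 hv
  rcases mem_crossers.1 hv' with h2 | h2 | h2
  · exact Finset.disjoint_left.1 L.disj_E h2 h1.1
  · exact L.notMem_P h1.1 _ (mem_linkStarts.1 h2).1
  · exact h1.2.1 h2.1

theorem Layout.card_unlinked (hM : G.IsLinkMatching P E M) (L : G.Layout P Q E κ D) :
    (unlinked E M).card + (linkHeads E M ∪ linkTails E M).card = (E true).card ∧
    (linkHeads E M \ linkTails E M).card + (linkHeads E M ∩ linkTails E M).card =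
      (linkHeads E M).card ∧
    (linkHeads E M ∪ linkTails E M).card + (linkHeads E M ∩ linkTails E M).card =
      (linkHeads E M).card + (linkTails E M).card ∧
    M.card = (linkStarts P M).card + (linkHeads E M).card + (linkTails E M).card := by
  have hsub : linkHeads E M ∪ linkTails E M ⊆ E true := Finset.union_subset
    (fun v hv => (mem_linkHeads.1 hv).1) fun v hv => (mem_linkTails.1 hv).1
  have hU : unlinked E M = E true \ (linkHeads E M ∪ linkTails E M) := by
    ext v
    simp [mem_unlinked]
  refine ⟨?_, Finset.card_sdiff_add_card_inter _ _, Finset.card_union_add_card_inter _ _,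
    L.card_linkMatching hM⟩
  rw [hU, Finset.card_sdiff_add_card_eq_card hsub]

/-- Some three stretches of the cycle at given distances have constant signs. -/
theorem exists_three_constant {n κ : ℕ} (W : ℕ → Bool) (hW : ∀ j, W (j + n) = W j)
    (hσ : turns W true 0 n < 400 * κ) (hn : 1000000 * κ ≤ n) (hκ : 1000 ≤ κ) (m : ℕ) :
    ∃ i, (∀ j ≤ 40, W (i + j) = W i) ∧ (∀ j ≤ 40, W (i + m + j) = W (i + m)) ∧
      ∀ j ≤ 40, W (i + m + m + j) = W (i + m + m) := by
  have hZ : ∀ d, ∃ Z : Finset ℕ, Z.card ≤ 40000 * κ ∧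
      ∀ i < n, i ∉ Z → ∀ j ≤ 40, W (i + d + j) = W (i + d) := by
    intro d
    obtain ⟨Z, h1, h2⟩ := exists_card_le_of_not_constant W 40 d (d + n)
    refine ⟨Z.image fun q => q - d, Finset.card_image_le.trans (h1.trans ?_),
      fun i hi hiZ => h2 (i + d) (by omega) (by omega) fun h => hiZ ?_⟩
    · have h3 := turns_add (W := W) (s := true) (show d ≤ d + n by omega)
        (show d + n ≤ d + n + 40 by omega)
      have h4 : turns W true (d + n) (d + n + 40) ≤ _ := turns_le
      have h5 := turns_period (s := true) hW d
      have h6 := turns_le_turns (W := W) (show d ≤ d + n + 40 by omega) false true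
      omega
    · exact Finset.mem_image.2 ⟨i + d, h, by simp⟩
  obtain ⟨Z₀, h0, h0'⟩ := hZ 0
  obtain ⟨Z₁, h1, h1'⟩ := hZ m
  obtain ⟨Z₂, h2, h2'⟩ := hZ (m + m)
  have h3 := Finset.card_union_le Z₀ (Z₁ ∪ Z₂)
  have h4 := Finset.card_union_le Z₁ Z₂
  obtain ⟨i, hi, hiZ⟩ := Finset.exists_mem_notMem_of_card_lt_card
    (show (Z₀ ∪ (Z₁ ∪ Z₂)).card < (Finset.range n).card by rw [Finset.card_range]; omega)
  simp only [Finset.mem_union, not_or] at hiZ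
  rw [Finset.mem_range] at hi
  refine ⟨i, h0' i hi hiZ.1, h1' i hi hiZ.2.1, ?_⟩
  rw [add_assoc]
  exact h2' i hi hiZ.2.2

/-- Embedding with the change of sides at given positions of the cycle. -/
theorem Layout.hasSignedCycle_of_pieces_at (L : G.Layout P Q E κ D) {n : ℕ}
    (hn : Fintype.card V = n) (w : ZMod n → Bool)
    (hσ : turns (fun j => w (j : ZMod n)) true 0 n < 400 * κ) (hM : G.IsLinkMatching P E M)
    {B C : Finset V} (hB : B ⊆ unlinked E M) (hC : C ⊆ crossers P E M) (hBC : B.card = C.card)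
    {v₁ v₂ : V} (hne : v₁ ≠ v₂)
    (hv : ∀ v, v = v₁ ∨ v = v₂ ↔ (v ∈ unlinked E M ∧ v ∉ B) ∨ (v ∈ crossers P E M ∧ v ∉ C))
    (m i : ℕ) {s₁ s₂ : Bool} (hs₁ : ∀ j ≤ 10, w ((i + 15 + j : ℕ) : ZMod n) = s₁)
    (hs₂ : ∀ j ≤ 10, w ((i + m + 15 + j : ℕ) : ZMod n) = s₂)
    (hF₁ : ∀ σ : ℕ → Bool, (∀ j ≤ 10, σ j = s₁) →
      G.FeasN P Q σ false true (piece E M v₁) 6 (100 * κ))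
    (hF₂ : ∀ σ : ℕ → Bool, (∀ j ≤ 10, σ j = s₂) →
      G.FeasN P Q σ true false (piece E M v₂) 6 (100 * κ))
    (hm : n ≤ 3 * m) (hmn : 3 * m ≤ 2 * n)
    (hcount : m + 3 * B.card = (P true).card + (linkHeads E M \ linkTails E M).card) :
    G.HasSignedCycle w := by
  refine HasSignedCycle.of_rotate ((i + 1 : ℕ) : ZMod n) ?_
  have hcast : ∀ j : ℕ, w ((j : ZMod n) + ((i + 1 : ℕ) : ZMod n)) =
      w ((j + (i + 1) : ℕ) : ZMod n) := fun j => by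
    rw [Nat.cast_add j]
  refine L.hasSignedCycle_of_pieces hn _ ?_ hM hB hC hBC hne hv m (hF₁ _ fun j hj => ?_)
    (hF₂ _ fun j hj => ?_) hm hmn hcount
  · simp only [hcast]
    rw [turns_shift (W := fun j => w (j : ZMod n)), zero_add, add_comm n,
      turns_period (natCast_periodic w)]
    exact hσ
  · simp only [hcast]
    rw [show 14 + j + (i + 1) = i + 15 + j by omega]
    exact hs₁ j hj
  · simp only [hcast]
    rw [show 14 + m + j + (i + 1) = i + m + 15 + j by omega]
    exact hs₂ j hj

-- By `card_crossers`, the matching `M` leaves two crossers more than unlinked vertices, whereas the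
-- submatching `M'` with two edges fewer, which avoids `b₀`, leaves equally many. With `M'` the
-- changes of side are made by `b₀` and one crosser, which suits stretches of equal sign; with `M`
-- they are made by two crossers, which suits the signs `false` and then `true`.
set_option maxHeartbeats 1000000 in
theorem Layout.hasSignedCycle_of_few_turns (L : G.Layout P Q E κ D) {n : ℕ}
    (hn : Fintype.card V = n) (w : ZMod n → Bool)
    (hσ : turns (fun j => w (j : ZMod n)) true 0 n < 400 * κ) {b₀ : V} (hb₀ : b₀ ∈ E true) :
    G.HasSignedCycle w := by
  have hκ := L.large
  have hκD := L.κ_le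
  have hDn := L.D_le
  have hs0 := L.size false
  have hs1 := L.size true
  have hce := L.card_eq
  have hE := L.E_le
  have hexc := L.exc
  rw [hn] at hDn hs0 hs1 hce
  have hz : 100 * κ + 12 < D := by omega
  obtain ⟨M, hM, hMcard⟩ := L.exists_linkMatching
  obtain ⟨M₀, hM₀, hM₀card, hM₀b⟩ := hM.exists_avoiding b₀
  obtain ⟨M', hM'₀, hM'card⟩ := Finset.exists_subset_card_eq
    (show (E true).card - (E false).card ≤ M₀.card by omega)
  have hMM := hM'₀.trans hM₀
  have hM' := hM.mono hMM
  have hbU : b₀ ∈ unlinked E M' := mem_unlinked.2 ⟨hb₀, fun h => by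
    obtain ⟨-, y, hy⟩ := mem_linkHeads.1 h
    exact (hM₀b _ (hM'₀ hy)).2 rfl, fun h => by
    obtain ⟨-, y, hy⟩ := mem_linkTails.1 h
    exact (hM₀b _ (hM'₀ hy)).1 rfl⟩
  have c1 := L.card_crossers hM
  have c2 := L.card_crossers hM'
  obtain ⟨d1, d2, d3, d4⟩ := L.card_unlinked hM
  obtain ⟨d1', d2', d3', d4'⟩ := L.card_unlinked hM'
  have f1 := Finset.card_le_card (linkHeads_mono (E := E) hMM)
  have f2 := Finset.card_le_card (linkTails_mono (E := E) hMM)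
  have f3 := Finset.card_le_card (linkStarts_mono (P := P) hMM)
  have f4 := Finset.card_le_card (Finset.union_subset_union (linkHeads_mono (E := E) hMM)
    (linkTails_mono (E := E) hMM))
  have f5 := Finset.card_le_card (Finset.inter_subset_inter (linkHeads_mono (E := E) hMM)
    (linkTails_mono (E := E) hMM))
  have hU1 := Finset.card_pos.2 ⟨b₀, hbU⟩
  obtain ⟨c₀, hc₀⟩ : (crossers P E M').Nonempty := Finset.card_pos.1 (by omega)
  obtain ⟨c₁, hc₁, c₂, hc₂, hcc⟩ := Finset.one_lt_card.1
    (show 1 < (crossers P E M).card by omega)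
  have hbc : b₀ ≠ c₀ := fun h =>
    Finset.disjoint_left.1 L.disjoint_unlinked_crossers hbU (h ▸ hc₀)
  obtain ⟨m₁, hm₁⟩ : ∃ m₁, m₁ + 3 * ((unlinked E M').erase b₀).card =
      (P true).card + (linkHeads E M' \ linkTails E M').card :=
    ⟨_, Nat.sub_add_cancel (by rw [Finset.card_erase_of_mem hbU]; omega)⟩
  obtain ⟨m₂, hm₂⟩ : ∃ m₂, m₂ + 3 * (unlinked E M).card =
      (P true).card + (linkHeads E M \ linkTails E M).card :=
    ⟨_, Nat.sub_add_cancel (by omega)⟩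
  have hB1 := Finset.card_erase_of_mem hbU
  have hC1 := Finset.card_erase_of_mem hc₀
  have hC2 := Finset.card_erase_of_mem (Finset.mem_erase.2 ⟨hcc.symm, hc₂⟩)
  have hC3 := Finset.card_erase_of_mem hc₁
  set W : ℕ → Bool := fun j => w (j : ZMod n) with hWdef
  have same : ∀ i s, (∀ j ≤ 40, W (i + j) = s) → (∀ j ≤ 40, W (i + m₁ + j) = s) →
      G.HasSignedCycle w := by
    intro i s h1 h2
    have hs₁ : ∀ j ≤ 10, w ((i + 15 + j : ℕ) : ZMod n) = s := fun j hj => by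
      rw [add_assoc i]
      exact h1 _ (by omega)
    have hs₂ : ∀ j ≤ 10, w ((i + m₁ + 15 + j : ℕ) : ZMod n) = s := fun j hj => by
      rw [add_assoc (i + m₁)]
      exact h2 _ (by omega)
    have hv : ∀ v, v = b₀ ∨ v = c₀ ↔
        (v ∈ unlinked E M' ∧ v ∉ (unlinked E M').erase b₀) ∨
        (v ∈ crossers P E M' ∧ v ∉ (crossers P E M').erase c₀) := by
      intro v
      simp only [Finset.mem_erase, not_and_or, not_not]
      constructor
      · rintro (rfl | rfl)
        · exact Or.inl ⟨hbU, Or.inl rfl⟩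
        · exact Or.inr ⟨hc₀, Or.inl rfl⟩
      · rintro (⟨h, h' | h'⟩ | ⟨h, h' | h'⟩)
        exacts [Or.inl h', absurd h h', Or.inr h', absurd h h']
    have hthrough : ∀ σ : ℕ → Bool, (∀ j ≤ 10, σ j = s) →
        G.FeasN P Q σ (!(s == true)) (s == true) (piece E M' b₀) 6 (100 * κ) := fun σ h => by
      rw [piece_eq_of_unlinked hbU]
      exact feasN_through L hz hb₀ h
    have hcross : ∀ σ : ℕ → Bool, (∀ j ≤ 10, σ j = s) →
        G.FeasN P Q σ s (!s) (piece E M' c₀) 6 (100 * κ) := fun σ h =>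
      (L.isCrosser_piece hM' hz hc₀).feasN L hz h
    cases s
    · exact L.hasSignedCycle_of_pieces_at hn w hσ hM' (Finset.erase_subset b₀ _)
        (Finset.erase_subset c₀ _) (by omega) hbc.symm (fun v => or_comm.trans (hv v)) m₁ i hs₁ hs₂
        hcross hthrough (by omega) (by omega) hm₁
    · exact L.hasSignedCycle_of_pieces_at hn w hσ hM' (Finset.erase_subset b₀ _)
        (Finset.erase_subset c₀ _) (by omega) hbc hv m₁ i hs₁ hs₂
        hthrough hcross (by omega) (by omega) hm₁
  have opposite : ∀ i, (∀ j ≤ 40, W (i + j) = false) → (∀ j ≤ 40, W (i + m₁ + j) = true) →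
      G.HasSignedCycle w := by
    intro i h1 h2
    have hs₁ : ∀ j ≤ 10, w ((i + 15 + j : ℕ) : ZMod n) = false := fun j hj => by
      rw [add_assoc i]
      exact h1 _ (by omega)
    -- The lengths `m₁` and `m₂` differ only slightly, since the matchings differ in two edges. The
    -- margin 15 and the stretch length 40 absorb the difference.
    have hs₂ : ∀ j ≤ 10, w ((i + m₂ + 15 + j : ℕ) : ZMod n) = true := fun j hj => by
      rw [show i + m₂ + 15 + j = i + m₁ + (m₂ + 15 + j - m₁) by omega]
      exact h2 _ (by omega)
    refine L.hasSignedCycle_of_pieces_at hn w hσ hM (C := ((crossers P E M).erase c₁).erase c₂)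
      (Finset.Subset.refl _) ((Finset.erase_subset _ _).trans (Finset.erase_subset _ _))
      (by omega) hcc (fun v => ?_) m₂ i hs₁ hs₂
      (fun σ h => (L.isCrosser_piece hM hz hc₁).feasN L hz h)
      (fun σ h => (L.isCrosser_piece hM hz hc₂).feasN L hz h) (by omega) (by omega) hm₂
    simp only [Finset.mem_erase, not_and_or, not_not]
    constructor
    · rintro (rfl | rfl)
      · exact Or.inr ⟨hc₁, Or.inr (Or.inl rfl)⟩
      · exact Or.inr ⟨hc₂, Or.inl rfl⟩
    · rintro (⟨h, h'⟩ | ⟨h, h' | h' | h'⟩)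
      exacts [absurd h h', Or.inr h', Or.inl h', absurd h h']
  -- Only the signs `true`, `false` at `i` and `i + m₁` are of no use; but then the pair `i + m₁`,
  -- `i + m₁ + m₁` begins with `false` and is usable whatever its second sign.
  obtain ⟨i, h0, h1, h2⟩ := exists_three_constant W (natCast_periodic w) hσ
    (by omega) hκ m₁
  cases e0 : W i <;> cases e1 : W (i + m₁) <;> rw [e0] at h0 <;> rw [e1] at h1
  · exact same i _ h0 h1
  · exact opposite i h0 h1
  · cases e2 : W (i + m₁ + m₁) <;> rw [e2] at h2
    · exact same _ _ h1 h2
    · exact opposite _ h1 h2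
  · exact same i _ h0 h1

end

/-! ### From extremality to the numerical layout; conclusion -/

theorem sDeg_le_sDeg_add {G : Digraph V} {s : Bool} {X Y : Finset V} {x : V} {k : ℕ} (h : Y ⊆ X)
    (hk : X.card ≤ Y.card + k) : G.sDeg s X x ≤ G.sDeg s Y x + k := by
  classical
  have h1 : (X.filter fun y => G.SAdj s x y) ⊆ (Y.filter fun y => G.SAdj s x y) ∪ (X \ Y) := by
    intro y hy
    rw [Finset.mem_filter] at hy
    rw [Finset.mem_union, Finset.mem_filter, Finset.mem_sdiff]
    by_cases hyY : y ∈ Y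
    · exact Or.inl ⟨hyY, hy.2⟩
    · exact Or.inr ⟨hy.1, hyY⟩
  have h2 := Finset.card_le_card h1
  have h3 := Finset.card_union_le (Y.filter fun y => G.SAdj s x y) (X \ Y)
  have h4 := Finset.card_sdiff_of_subset h
  simp only [sDeg]
  omega

theorem minSemidegree_le_sDeg [Fintype V] {G : Digraph V} (s : Bool) (x : V) :
    G.minSemidegree ≤ G.sDeg s Finset.univ x := by
  have h : G.minSemidegree ≤ min (G.outDegIn Finset.univ x) (G.inDegIn Finset.univ x) :=
    ciInf_le (OrderBot.bddBelow _) x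
  cases s
  · rw [sDeg_false]
    exact h.trans (min_le_right _ _)
  · rw [sDeg_true]
    exact h.trans (min_le_left _ _)

theorem minSemidegree_inducedOn_le {G : Digraph V} {S : Finset V} (s : Bool) {x : V}
    (hx : x ∈ S) : (G.inducedOn S).minSemidegree ≤ G.sDeg s S x := by
  classical
  refine (minSemidegree_le_sDeg s ⟨x, hx⟩).trans ?_
  refine Finset.card_le_card_of_injOn Subtype.val (fun y hy => ?_) Subtype.val_injective.injOn
  simp only [Finset.coe_filter, Set.mem_ofPred_eq, Finset.mem_univ, true_and] at hy ⊢
  refine ⟨y.2, ?_⟩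
  cases s
  · exact sAdj_false.2 (sAdj_false.1 hy)
  · exact sAdj_true.2 (sAdj_true.1 hy)

/-- Here `κ` is about `ε n`, rounded up with a margin of one, and absorbs all deviations. `D` is
about `η n - κ`, because degrees are counted into the typical vertices only and at most `κ` vertices
of a side are atypical. -/
theorem IsSTPartition.exists_layout [Fintype V] {G : Digraph V} {ε η : ℝ} {A B S T : Finset V}
    (h : G.IsSTPartition ε η A B S T) (hG : G.Loopless)
    (hδ : (Fintype.card V : ℝ) / 2 ≤ (G.minSemidegree : ℝ))
    (hε : 1000 ≤ ε * Fintype.card V) (hεη : 10000 * ε ≤ η) (hη : η ≤ 1 / 10000) :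
    ∃ P Q E κ D, G.Layout P Q E κ D := by
  classical
  obtain ⟨hpart, h1, h2, h3, h4, h5, h6, h7, h8, h9, h10, h11, h12, h13⟩ := h
  obtain ⟨hcov, hAB, hAS, hAT, hBS, hBT, hST⟩ := hpart
  have hεη' := mul_le_mul_of_nonneg_right hεη (Nat.cast_nonneg (α := ℝ) (Fintype.card V))
  have hη' := mul_le_mul_of_nonneg_right hη (Nat.cast_nonneg (α := ℝ) (Fintype.card V))
  simp only [mul_assoc] at h12 h13 hεη'
  generalize hn : Fintype.card V = n at h3 h4 h5 h6 h7 h8 h9 h10 h11 h12 h13 hε hδ hεη' hη'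
  -- From here on only linear inequalities between `n`, `e = ε n` and `d = η n` matter.
  generalize ε * (n : ℝ) = e at h3 h4 h5 h6 h9 h10 h11 hε hεη'
  generalize η * (n : ℝ) = d at h7 h8 h12 h13 hεη' hη'
  have hfloor : ((n : ℝ) / 2) - 1 < (⌊(n : ℝ) / 2⌋ : ℝ) := Int.sub_one_lt_floor _
  have hceil : (⌈(n : ℝ) / 2⌉ : ℝ) < (n : ℝ) / 2 + 1 := Int.ceil_lt_add_one _
  let κ := ⌈e⌉₊ + 1
  have hκ1 : e + 1 ≤ κ := by
    have := Nat.le_ceil e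
    push_cast [κ]
    linarith
  have hκ2 : (κ : ℝ) ≤ e + 2 := by
    have := Nat.ceil_lt_add_one (show 0 ≤ e by linarith)
    push_cast [κ]
    linarith
  let D := ⌊d - κ⌋₊
  have hD1 : d - κ - 1 < D := Nat.sub_one_lt_floor _
  have hD2 : (D : ℝ) ≤ d - κ := Nat.floor_le (by linarith)
  let P : Bool → Finset V := fun c => cond c T S
  let E : Bool → Finset V := fun c => cond c B A
  let Q : Bool → Finset V := fun c => (P c).filter fun x =>
    (n : ℝ) / 2 - e ≤ G.outDegIn (P c) x ∧ (n : ℝ) / 2 - e ≤ G.inDegIn (P c) x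
  have hQP : ∀ c, Q c ⊆ P c := fun c => Finset.filter_subset _ _
  have hbad : ∀ c, (P c).card ≤ (Q c).card + κ := by
    intro c
    have h14 : ((P c \ Q c).card : ℝ) ≤ e := by
      cases c
      · refine le_trans (Nat.cast_le.2 (Finset.card_le_card fun x hx => ?_)) h9
        rw [Finset.mem_sdiff, Finset.mem_filter] at hx
        exact Finset.mem_filter.2 ⟨hx.1, fun h => hx.2 ⟨hx.1, h⟩⟩
      · refine le_trans (Nat.cast_le.2 (Finset.card_le_card fun x hx => ?_)) h10
        rw [Finset.mem_sdiff, Finset.mem_filter] at hx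
        exact Finset.mem_filter.2 ⟨hx.1, fun h => hx.2 ⟨hx.1, h⟩⟩
    have h15 : (P c \ Q c).card ≤ κ := by
      rw [← Nat.cast_le (α := ℝ)]
      linarith
    have h16 := Finset.card_sdiff_of_subset (hQP c)
    omega
  have hPQ : ∀ c s x, (G.sDeg s (P c) x : ℝ) ≤ G.sDeg s (Q c) x + κ := by
    intro c s x
    exact_mod_cast sDeg_le_sDeg_add (hQP c) (hbad c)
  have hPlo : ∀ c, (n : ℝ) / 2 - 1 - e ≤ (P c).card := by
    rintro (_ | _)
    · change _ ≤ (S.card : ℝ)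
      linarith
    · change _ ≤ (T.card : ℝ)
      linarith
  have hPhi : ∀ c, ((P c).card : ℝ) ≤ (n : ℝ) / 2 + 1 + e := by
    rintro (_ | _)
    · change (S.card : ℝ) ≤ _
      linarith
    · change (T.card : ℝ) ≤ _
      linarith
  have hdegE : ∀ t s, ∀ x ∈ E t, (n : ℝ) / 2 - 3 * d < G.sDeg s (P (s == t)) x ∧
      (G.sDeg s (P (!(s == t))) x : ℝ) ≤ 3 * d := by
    rintro (_ | _) (_ | _) x hx
    · rw [sDeg_false, sDeg_false]
      exact ⟨(h12 x hx).1, (h12 x hx).2.2.1⟩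
    · rw [sDeg_true, sDeg_true]
      exact ⟨(h12 x hx).2.1, (h12 x hx).2.2.2⟩
    · rw [sDeg_false, sDeg_false]
      exact ⟨(h13 x hx).1, (h13 x hx).2.2.1⟩
    · rw [sDeg_true, sDeg_true]
      exact ⟨(h13 x hx).2.1, (h13 x hx).2.2.2⟩
  refine ⟨P, Q, E, κ, D, ?_⟩
  constructor
  case loopless => exact hG
  case cover =>
    intro x
    rcases hcov x with h | h | h | h
    exacts [Or.inr ⟨false, h⟩, Or.inr ⟨true, h⟩, Or.inl ⟨false, h⟩, Or.inl ⟨true, h⟩]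
  case disj_P => exact hST
  case disj_E => exact hAB
  case disj_PE =>
    rintro (_ | _) (_ | _)
    exacts [hAS.symm, hBS.symm, hAT.symm, hBT.symm]
  case sub => exact hQP
  case bad => exact hbad
  case exc =>
    change A.card + B.card ≤ κ
    rw [← Nat.cast_le (α := ℝ)]
    push_cast
    linarith
  case size =>
    intro c
    rw [hn, ← Nat.cast_le (α := ℝ)]
    push_cast
    have := hPlo c
    linarith
  case deg =>
    intro c s x hx
    rw [← Nat.cast_le (α := ℝ)]
    have h14 := hPQ c s x
    have h15 : d ≤ (G.sDeg s (P c) x : ℝ) := by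
      cases c
      · exact h7.trans (Nat.cast_le.2 (minSemidegree_inducedOn_le s hx))
      · exact h8.trans (Nat.cast_le.2 (minSemidegree_inducedOn_le s hx))
    linarith
  case typical =>
    intro c s x hx
    rw [← Nat.cast_le (α := ℝ)]
    push_cast
    have h14 := hPQ c s x
    have h15 : (n : ℝ) / 2 - e ≤ (G.sDeg s (P c) x : ℝ) := by
      cases s
      · rw [sDeg_false]
        exact (Finset.mem_filter.1 hx).2.2
      · rw [sDeg_true]
        exact (Finset.mem_filter.1 hx).2.1
    have h16 := hPhi c
    have h17 : ((Q c).card : ℝ) ≤ (P c).card := Nat.cast_le.2 (Finset.card_le_card (hQP c))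
    linarith
  case natural =>
    intro t s x hx
    rw [hn, ← Nat.cast_le (α := ℝ)]
    push_cast
    have h14 := hPQ (s == t) s x
    have h15 := (hdegE t s x hx).1
    linarith
  case unnatural =>
    intro t s x hx
    rw [hn, ← Nat.cast_le (α := ℝ)]
    push_cast
    have h15 := (hdegE t s x hx).2
    linarith
  case semidegree =>
    intro s x
    have h14 : (G.minSemidegree : ℝ) ≤ G.sDeg s Finset.univ x :=
      Nat.cast_le.2 (minSemidegree_le_sDeg s x)
    rw [hn, ← Nat.cast_le (α := ℝ)]
    push_cast
    linarith
  case large =>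
    rw [← Nat.cast_le (α := ℝ)]
    push_cast
    linarith
  case κ_le =>
    rw [← Nat.cast_le (α := ℝ)]
    push_cast
    linarith
  case D_le =>
    rw [hn, ← Nat.cast_le (α := ℝ)]
    push_cast
    linarith
  case E_le => exact h1
  case P_le => exact h2

/-- Few sign changes are an obstacle only in the presence of exceptional vertices. Without them,
`P_le` is already the size condition of `hasSignedCycle_of_le_card`. -/
theorem Layout.hasSignedCycle [Fintype V] {G : Digraph V} {P Q E : Bool → Finset V} {κ D : ℕ}
    (L : G.Layout P Q E κ D) {n : ℕ} (hn : Fintype.card V = n) (w : ZMod n → Bool) :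
    G.HasSignedCycle w := by
  classical
  rcases Nat.lt_or_ge (turns (fun j => w (j : ZMod n)) true 0 n) (400 * κ) with hσ | hσ
  · rcases (E true).eq_empty_or_nonempty with h | ⟨b, hb⟩
    · have hE := L.E_le
      have hP := L.P_le
      have h' : E false = ∅ := Finset.card_eq_zero.1 (by rw [h, Finset.card_empty] at hE; omega)
      refine L.hasSignedCycle_of_le_card hn w (fun t x hx => ?_) (by simpa [h, h'] using hP)
      cases t
      · simp [h'] at hx
      · simp [h] at hx
    · exact L.hasSignedCycle_of_few_turns hn w hσ hb
  · rcases Nat.lt_or_ge (P true).card ((P false).card + ((E false).card + (E true).card)) with h | h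
    · exact L.hasSignedCycle_of_card_lt hn w hσ h
    · exact L.hasSignedCycle_of_le_card hn w (fun _ _ _ => hσ) h

end Digraph

theorem mainTheorem2 :
    -- the hierarchy `1/n ≪ ε₃ ≪ ε₄ ≪ η₂ ≪ 1`, where `a ≪ b` means `a ≤ f b`
    -- for a suitable positive increasing function `f`
    ∃ f : ℝ → ℝ, StrictMonoOn f (Set.Ioi 0) ∧ (∀ x, 0 < x → 0 < f x) ∧
      ∀ (n : ℕ) (ε₃ ε₄ η₂ : ℝ), 0 < n → 0 < ε₃ → 0 < ε₄ → 0 < η₂ →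
        1 / (n : ℝ) ≤ f ε₃ → ε₃ ≤ f ε₄ → ε₄ ≤ f η₂ → η₂ ≤ f 1 →
        ∀ (V : Type*) [Fintype V] (G : Digraph V),
          Fintype.card V = n → G.Loopless →
          (n : ℝ) / 2 ≤ (G.minSemidegree : ℝ) →
          G.IsSTExtremal ε₃ η₂ →
          ∀ (W : Type*) (C : Digraph W), C.IsOrientationOfCycle n → G.ContainsCopy C := by
  -- A linear `f` suffices: the argument needs only `1000 ≤ ε₃ n`, `10000 ε₃ ≤ η₂` and `η₂ ≤ 1 /
  -- 10000`.
  refine ⟨fun x => x / 10000, fun x _ y _ hxy => by simp only; linarith,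
    fun x hx => by positivity, ?_⟩
  intro n ε₃ ε₄ η₂ hn h3 h4 h2 hnε hε hεη hη V _ G hV hG hδ hST W C hC
  obtain ⟨A, B, S, T, hP⟩ := hST
  subst hV
  have hn' : (0 : ℝ) < Fintype.card V := Nat.cast_pos.2 hn
  simp only at hnε hε hεη hη
  rw [div_le_iff₀ hn'] at hnε
  obtain ⟨P, Q, E, κ, D, L⟩ := hP.exists_layout hG hδ (by linarith) (by linarith) (by linarith)
  exact Digraph.containsCopy_of_forall_hasSignedCycle hC fun w => L.hasSignedCycle rfl w
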